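/- **Setting.** Let $X$ be a compact Kähler manifold, and let $V$ be a finite-dimensional complex vector space with a nondegenerate bilinear form $C$ that is symmetric (orthogonal case) or skew-symmetric (symplectic case); write $O(V)$ for the group of $C$ and $\mathfrak o(V)$ for its Lie algebra. Let $H\subset O(V)$ be a closed abelian reductive subgroup, $R$ its centralizer in $O(V)$, and $V=\bigoplus_{\chi\in I}V_\chi$ the decomposition into isotypic components for the characters of $H$ that occur in $V$; put $\sigma(\chi)=\chi^{-1}$, so that $C$ pairs $V_\chi$ with $V_{\sigma(\chi)}$. Let $\tilde Q$ be a generalized $O(V)$-quiver with these data, with representation space $\bigoplus_\alpha Z_\alpha$, a finite sum whose summands are nonzero pieces (repetitions are allowed) $$Z_\alpha=\mathfrak o(V)\cap\big(\mathrm{Hom}(V_\chi,V_\mu)\oplus \mathrm{Hom}(V_{\sigma(\mu)},V_{\sigma(\chi)})\big),\qquad \chi,\mu\in I,$$ of the adjoint representation. The corresponding symmetric quiver $(Q,\sigma)$ has vertex set $I$ and, for every $\alpha$ with $Z_\alpha$ as above, the arrows $\chi\to\mu$ and $\sigma(\mu)\to\sigma(\chi)$ (one arrow if they coincide), which $\sigma$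 exchanges. Fix hermitian holomorphic twisting bundles $\mathbb M_\alpha$ over $X$, the same for the arrows coming from the same $\alpha$. Choose a hermitian metric on $V$ for which the $V_\chi$ are orthogonal to each other and $C(v,w)=\langle Jv,w\rangle$ with $J$ antiunitary, so that $K=R\cap U(V)$ is a maximal compact subgroup of $R$. Let $E$ be a smooth principal $K$-bundle on $X$, $\mathbb V_\chi$ the associated hermitian vector bundles with fibre $V_\chi$, $\mathbb V=\bigoplus_\chi\mathbb V_\chi$, $\mathscr A^{1,1}$ the space of smooth $K$-connections on $E$ with curvature of type $(1,1)$, and $\mathfrak{Rep}(\tilde Q,M)$ the vector bundle $\bigoplus_\alpha \mathrm{Hom}(\mathbb M_\alpha,E\times_KZ_\alpha)$. Choose representatives $i\in S$ of the pairs $\{i,\sigma(i)\}$ of non-fixed vertices and positive weights $a_i$ ($i\in S$) and $b_j$ ($\sigma(j)=j$). On $\mathscr A^{1,1}\times\Omega^0(\mathfrak{Rep}(\tilde Q,M))$, where $\Omega^0$ denotes smooth sections, take $$\omega=\sum_{i\in S}a_i\,\omega_i+\sum_{\sigma(j)=j}b_j\,\omega_j+\int_X \mathrm{Im}\,\mathrm{tr}(\phi^*\psi)\,d\mathrm{vol},\qquad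 \omega_i(A,B)=\int_X\Lambda\big(-\mathrm{tr}_{\mathbb V_i}(A_i\wedge B_i)\big)\,d\mathrm{vol},$$ $\omega_i$ being the Atiyah–Bott form of the factor of $R=\prod_{i\in S}\mathrm{GL}(V_i)\times\prod_{\sigma(j)=j}O(V_j)$ and $Z_\alpha\subset\mathrm{End}(V)$ carrying the induced hermitian form. On the other side let $\mathscr A^{1,1}\times\Omega^0(\mathfrak{Rep}^o(Q,M,V))$ be the space of orthogonal $Q$-bundles: families $(A_\chi)_{\chi\in I}$ of unitary connections on the $\mathbb V_\chi$ with curvature of type $(1,1)$ and $A_{\sigma(\chi)}=-A_\chi^t$ (transpose with respect to $C$), together with smooth sections $\phi_c$ of $\mathrm{Hom}(\mathbb V_{t(c)}\otimes\mathbb M_c,\mathbb V_{h(c)})$, $c$ an arrow of $Q$, with $C(\phi_c(v\otimes m),w)+C(v,\phi_{\sigma(c)}(w\otimes m))=0$. It carries the restriction of the form $\sum_{\chi\in I}p_\chi\omega_\chi+\sum_c\int_X\mathrm{Im}\,\mathrm{tr}(\phi_c^*\psi_c)\,d\mathrm{vol}$ of the space of plain $Q$-bundles, for real parameters $p_\chi$.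 **Proposition.** Suppose that $p_i+p_{\sigma(i)}=a_i$ for $i\in S$ and $p_j=b_j$ whenever $\sigma(j)=j$. Then the map that sends a $K$-connection to the induced connections on the $\mathbb V_\chi$, and a section of $\mathrm{Hom}(\mathbb M_\alpha,E\times_KZ_\alpha)$ to its components along the arrows belonging to $\alpha$, is a symplectomorphism $$\mathscr A^{1,1}\times\Omega^0(\mathfrak{Rep}(\tilde Q,M))\longrightarrow\mathscr A^{1,1}\times\Omega^0(\mathfrak{Rep}^o(Q,M,V)).$$ That is: both forms are symplectic (they have constant coefficients and are weakly nondegenerate on the tangent spaces, the tangent space of $\mathscr A^{1,1}$ at $A$ being the space of forms $\alpha\in\Omega^1(\mathrm{ad}\,E)$ with $d_A\alpha$ of type $(1,1)$), and the map is a bijection that is smooth in both directions (it and its inverse send smooth finite-dimensional families to smooth families), identifies the tangent spaces, and carries one form to the other. Moreover, the morphisms on one side are holomorphic for the connection on that side if and only if their images are. -/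

import Mathlib

open scoped ContDiff Manifold

noncomputable section

namespace SQ

/-- The coordinate space `ℂⁿ`. -/
abbrev Cn (n : ℕ) := Fin n → ℂ

/-! ### Kähler geometry of the base -/

section Kahler

variable {n : ℕ} {X : Type*} [TopologicalSpace X] [ChartedSpace (Cn n) X]

/-- The coordinate expression, at the point `e` of the target of the chart `φ`, of a field of
bilinear forms on the tangent spaces of `X`. -/
def coordMetric
    (g : ∀ x : X, TangentSpace 𝓘(ℂ, Cn n) x → TangentSpace 𝓘(ℂ, Cn n) x → ℝ)
    (φ : OpenPartialHomeomorph X (Cn n)) (e u v : Cn n) : ℝ :=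
  g (φ.symm e) (mfderiv 𝓘(ℂ, Cn n) 𝓘(ℂ, Cn n) φ.symm e u)
    (mfderiv 𝓘(ℂ, Cn n) 𝓘(ℂ, Cn n) φ.symm e v)

variable (n X) in
/-- A Kähler metric on the complex manifold `X`: a smooth Riemannian metric `g`, invariant under
the complex structure, with closed Kähler form `ω(u,v) = g(iu,v)`. -/
structure KahlerMetric where
  g : ∀ x : X, TangentSpace 𝓘(ℂ, Cn n) x → TangentSpace 𝓘(ℂ, Cn n) x → ℝ
  add_left : ∀ x u u' v, g x (u + u') v = g x u v + g x u' v
  smul_left : ∀ x (r : ℝ) u v, g x ((r : ℂ) • u) v = r * g x u v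
  symm : ∀ x u v, g x u v = g x v u
  pos : ∀ x u, u ≠ 0 → 0 < g x u u
  invariant : ∀ x u v, g x (Complex.I • u) (Complex.I • v) = g x u v
  smooth : ∀ φ ∈ IsManifold.maximalAtlas 𝓘(ℂ, Cn n) ∞ X, ∀ u v : Cn n,
    ContDiffOn ℝ ∞ (fun e => coordMetric g φ e u v) φ.target
  closed : ∀ φ ∈ IsManifold.maximalAtlas 𝓘(ℂ, Cn n) ∞ X, ∀ e ∈ φ.target, ∀ u v w : Cn n,
    fderiv ℝ (fun e' => coordMetric g φ e' (Complex.I • v) w) e u +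
    fderiv ℝ (fun e' => coordMetric g φ e' (Complex.I • w) u) e v +
    fderiv ℝ (fun e' => coordMetric g φ e' (Complex.I • u) v) e w = 0

/-- The real basis `∂/∂x_j, ∂/∂y_j` of `ℂⁿ`. -/
def realBasis (k : Fin n × Fin 2) : Cn n := Pi.single k.1 (if k.2 = 0 then 1 else Complex.I)

namespace KahlerMetric

/-- The Gram matrix of the metric in the real coordinates of the chart `φ`. -/
def gram (κ : KahlerMetric n X) (φ : OpenPartialHomeomorph X (Cn n)) (e : Cn n) :
    Matrix (Fin n × Fin 2) (Fin n × Fin 2) ℝ :=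
  Matrix.of fun k l => coordMetric κ.g φ e (realBasis k) (realBasis l)

/-- The contraction `Λβ = ½ ∑ₖ β(eₖ, i eₖ)` (over a `g`-orthonormal real frame) of a real 2-form
`β` with the Kähler form, i.e. the adjoint of multiplication by the Kähler form; it is written in
the coordinates of `φ`, where it is `½ tr (g⁻¹ β(·, i ·))`. -/
def contr (κ : KahlerMetric n X) (φ : OpenPartialHomeomorph X (Cn n)) (e : Cn n)
    (β : Cn n → Cn n → ℝ) : ℝ :=
  (1 / 2) * Matrix.trace ((κ.gram φ e)⁻¹ *
    Matrix.of fun k l => β (realBasis k) (Complex.I • realBasis l))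

end KahlerMetric

variable (n) in
/-- The coordinate ball of radius `r` around `x`, in the preferred chart at `x`. -/
def coordBall (x : X) (r : ℝ) : Set X :=
  (chartAt (Cn n) x).source ∩ chartAt (Cn n) x ⁻¹' Metric.ball (chartAt (Cn n) x x) r

variable (n X) in
theorem exists_coordBalls [CompactSpace X] : ∃ (t : Finset X) (r : X → ℝ),
    (∀ x, 0 < r x ∧
      Metric.closedBall (chartAt (Cn n) x x) (r x) ⊆ (chartAt (Cn n) x).target) ∧
    ∀ y, ∃ x ∈ t, y ∈ coordBall n x (r x) := by
  have h : ∀ x : X, ∃ r : ℝ, 0 < r ∧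
      Metric.closedBall (chartAt (Cn n) x x) r ⊆ (chartAt (Cn n) x).target := fun x =>
    Metric.nhds_basis_closedBall.mem_iff.1
      ((chartAt (Cn n) x).open_target.mem_nhds (mem_chart_target (Cn n) x))
  choose r hr hr' using h
  have ho : ∀ x, IsOpen (coordBall n x (r x)) := fun x =>
    (chartAt (Cn n) x).isOpen_inter_preimage Metric.isOpen_ball
  obtain ⟨t, ht⟩ := isCompact_univ.elim_finite_subcover (fun x => coordBall n x (r x)) ho
    (fun x _ => Set.mem_iUnion.2 ⟨x, mem_chart_source _ x, Metric.mem_ball_self (hr x)⟩)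
  refine ⟨t, r, fun x => ⟨hr x, hr' x⟩, fun y => ?_⟩
  obtain ⟨x, hx, hy⟩ := Set.mem_iUnion₂.1 (ht (Set.mem_univ y))
  exact ⟨x, hx, hy⟩

variable [CompactSpace X]

variable (n X) in
/-- A finite set of centres of coordinate balls covering `X`. -/
def centres : Finset X := (exists_coordBalls n X).choose

variable (n X) in
/-- The radii of the coordinate balls covering `X`. -/
def radius : X → ℝ := (exists_coordBalls n X).choose_spec.choose

open Classical in
/-- The Riemannian volume measure of a Kähler metric. Each coordinate ball of a finite cover
contributes `√(det g)` times Lebesgue measure, divided by the number of balls of the cover that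
contain the point; the result does not depend on the cover. -/
def KahlerMetric.vol (κ : KahlerMetric n X) [MeasurableSpace X] : MeasureTheory.Measure X :=
  ∑ x ∈ centres n X,
    (MeasureTheory.Measure.map (chartAt (Cn n) x).symm
      ((MeasureTheory.volume.withDensity fun e : Cn n =>
          ENNReal.ofReal (Real.sqrt (κ.gram (chartAt (Cn n) x) e).det)).restrict
        (Metric.ball (chartAt (Cn n) x x) (radius n X x)))).withDensity
      fun y => ((((centres n X).filter fun z => y ∈ coordBall n z (radius n X z)).card : ℕ) :
        ENNReal)⁻¹

end Kahler

/-! ### Principal bundles, connections, sections -/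

section Bundles

/-- A cover of `X` by the domains of holomorphic coordinate charts. -/
structure HolCover (n : ℕ) (X : Type*) [TopologicalSpace X] [ChartedSpace (Cn n) X] where
  ι : Type*
  chart : ι → OpenPartialHomeomorph X (Cn n)
  mem_atlas : ∀ i, chart i ∈ IsManifold.maximalAtlas 𝓘(ℂ, Cn n) ∞ X
  cover : ∀ x, ∃ i, x ∈ (chart i).source

variable {n : ℕ} {X : Type*} [TopologicalSpace X] [ChartedSpace (Cn n) X]

namespace HolCover

/-- The overlap of the `i`-th and `j`-th chart domain, in the coordinates of the `i`-th. -/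
def overlap (U : HolCover n X) (i j : U.ι) : Set (Cn n) :=
  (U.chart i).target ∩ (U.chart i).symm ⁻¹' (U.chart j).source

/-- The coordinate change from the `i`-th to the `j`-th chart. -/
def trans (U : HolCover n X) (i j : U.ι) (e : Cn n) : Cn n := U.chart j ((U.chart i).symm e)

/-- Some chart of the cover around `x`. -/
def idx (U : HolCover n X) (x : X) : U.ι := (U.cover x).choose

end HolCover

section
variable (W : Type*) [NormedAddCommGroup W] [InnerProductSpace ℂ W]

/-- The unitary group of the (finite-dimensional) space `W`. -/
def unitaryGroup : Set (W →L[ℂ] W) := {T | ∀ v w, inner ℂ (T v) (T w) = inner ℂ v w}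

/-- The Lie algebra of skew-hermitian endomorphisms. -/
def unitaryLie : Set (W →L[ℂ] W) := {T | ∀ v w, inner ℂ (T v) w + inner ℂ v (T w) = 0}

end

/-- A smooth principal `K`-bundle, `K ⊆ GL(W)`, trivialized over the coordinate domains of the
cover `U`: a smooth `K`-valued cocycle. Values off the overlaps are irrelevant. -/
structure PrincipalBundle (U : HolCover n X) (W : Type*) [NormedAddCommGroup W]
    [InnerProductSpace ℂ W] (K : Set (W →L[ℂ] W)) where
  tr : U.ι → U.ι → X → (W →L[ℂ] W)
  mem : ∀ i j, ∀ x ∈ (U.chart i).source ∩ (U.chart j).source, tr i j x ∈ K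
  smooth : ∀ i j, ContDiffOn ℝ ∞ (fun e => tr i j ((U.chart i).symm e)) (U.overlap i j)
  one : ∀ i, ∀ x ∈ (U.chart i).source, tr i i x = 1
  cocycle : ∀ i j k, ∀ x ∈ (U.chart i).source ∩ (U.chart j).source ∩ (U.chart k).source,
    tr i j x * tr j k x = tr i k x

variable {U : HolCover n X}
variable {W W₁ W₂ N : Type*}
  [NormedAddCommGroup W] [InnerProductSpace ℂ W]
  [NormedAddCommGroup W₁] [InnerProductSpace ℂ W₁]
  [NormedAddCommGroup W₂] [InnerProductSpace ℂ W₂]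
  [NormedAddCommGroup N] [InnerProductSpace ℂ N]

/-- Families of local `End W`-valued 1-forms in the coordinates of the charts of the cover. -/
def LocForm (U : HolCover n X) (W : Type*) [NormedAddCommGroup W] [InnerProductSpace ℂ W] :=
  U.ι → Cn n → (Cn n →L[ℝ] (W →L[ℂ] W))

instance : AddCommGroup (LocForm U W) :=
  inferInstanceAs (AddCommGroup (U.ι → Cn n → (Cn n →L[ℝ] (W →L[ℂ] W))))

instance : Module ℝ (LocForm U W) :=
  inferInstanceAs (Module ℝ (U.ι → Cn n → (Cn n →L[ℝ] (W →L[ℂ] W))))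

/-- Families of local functions with values in `Hom(N, Hom(W₁, W₂)) = Hom(W₁ ⊗ N, W₂)`. -/
def LocSec (U : HolCover n X) (W₁ W₂ N : Type*)
    [NormedAddCommGroup W₁] [InnerProductSpace ℂ W₁]
    [NormedAddCommGroup W₂] [InnerProductSpace ℂ W₂]
    [NormedAddCommGroup N] [InnerProductSpace ℂ N] :=
  U.ι → Cn n → (N →L[ℂ] (W₁ →L[ℂ] W₂))

instance : AddCommGroup (LocSec U W₁ W₂ N) :=
  inferInstanceAs (AddCommGroup (U.ι → Cn n → (N →L[ℂ] (W₁ →L[ℂ] W₂))))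

instance : Module ℝ (LocSec U W₁ W₂ N) :=
  inferInstanceAs (Module ℝ (U.ι → Cn n → (N →L[ℂ] (W₁ →L[ℂ] W₂))))

/-- `A` is a smooth connection on the principal bundle `P`, given by its local connection forms
(extended by zero off the chart domains), which have values in the Lie algebra `𝔨` and satisfy
`A_j = g⁻¹ A_i g + g⁻¹ dg` with `g = g_ij`. -/
structure IsConnection {K : Set (W →L[ℂ] W)} (P : PrincipalBundle U W K)
    (𝔨 : Set (W →L[ℂ] W)) (A : LocForm U W) : Prop where
  zero_off : ∀ i, ∀ e ∉ (U.chart i).target, A i e = 0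
  mem_lie : ∀ i e u, A i e u ∈ 𝔨
  smooth : ∀ i, ContDiffOn ℝ ∞ (A i) (U.chart i).target
  gauge : ∀ i j, ∀ e ∈ U.overlap i j, ∀ u,
    P.tr i j ((U.chart i).symm e) * A j (U.trans i j e) (fderiv ℝ (U.trans i j) e u) =
      A i e u * P.tr i j ((U.chart i).symm e) +
        fderiv ℝ (fun e' => P.tr i j ((U.chart i).symm e')) e u

/-- `a` is a smooth 1-form on `X` with values in the adjoint bundle of `P`; these 1-forms are the
tangent vectors of the affine space of connections. -/
structure IsAdForm {K : Set (W →L[ℂ] W)} (P : PrincipalBundle U W K)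
    (𝔨 : Set (W →L[ℂ] W)) (a : LocForm U W) : Prop where
  zero_off : ∀ i, ∀ e ∉ (U.chart i).target, a i e = 0
  mem_lie : ∀ i e u, a i e u ∈ 𝔨
  smooth : ∀ i, ContDiffOn ℝ ∞ (a i) (U.chart i).target
  gauge : ∀ i j, ∀ e ∈ U.overlap i j, ∀ u,
    P.tr i j ((U.chart i).symm e) * a j (U.trans i j e) (fderiv ℝ (U.trans i j) e u) =
      a i e u * P.tr i j ((U.chart i).symm e)

/-- The curvature `F = dA + A ∧ A`. -/
def curv (A : LocForm U W) (i : U.ι) (e u v : Cn n) : W →L[ℂ] W :=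
  fderiv ℝ (A i) e u v - fderiv ℝ (A i) e v u + (A i e u * A i e v - A i e v * A i e u)

/-- The covariant exterior derivative `d_A a`, the derivative of the curvature at `A`. -/
def covExtDeriv (A a : LocForm U W) (i : U.ι) (e u v : Cn n) : W →L[ℂ] W :=
  fderiv ℝ (a i) e u v - fderiv ℝ (a i) e v u +
    (A i e u * a i e v - a i e v * A i e u) - (A i e v * a i e u - a i e u * A i e v)

/-- A 2-form on the cover is of type `(1,1)`. -/
def IsType11 (β : ∀ _ : U.ι, Cn n → Cn n → Cn n → (W →L[ℂ] W)) : Prop :=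
  ∀ i, ∀ e ∈ (U.chart i).target, ∀ u v,
    β i e (Complex.I • u) (Complex.I • v) = β i e u v

/-- `s` is a smooth section of the bundle `Hom(𝕎₁ ⊗ ℕ, 𝕎₂)` of twisted homomorphisms between the
vector bundles associated with `P₁`, `F`, `P₂`. -/
structure IsSection {K₁ : Set (W₁ →L[ℂ] W₁)} {K₂ : Set (W₂ →L[ℂ] W₂)} {K : Set (N →L[ℂ] N)}
    (P₁ : PrincipalBundle U W₁ K₁) (P₂ : PrincipalBundle U W₂ K₂) (F : PrincipalBundle U N K)
    (s : LocSec U W₁ W₂ N) : Prop where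
  zero_off : ∀ i, ∀ e ∉ (U.chart i).target, s i e = 0
  smooth : ∀ i, ContDiffOn ℝ ∞ (s i) (U.chart i).target
  gauge : ∀ i j, ∀ e ∈ U.overlap i j, ∀ m,
    (s i e (F.tr i j ((U.chart i).symm e) m)).comp (P₁.tr i j ((U.chart i).symm e)) =
      (P₂.tr i j ((U.chart i).symm e)).comp (s j (U.trans i j e) m)

/-- The covariant derivative of a twisted homomorphism, for connections `A₁`, `A₂`, `B` on the
source, target and twisting bundle. -/
def covDeriv (A₁ : LocForm U W₁) (A₂ : LocForm U W₂) (B : LocForm U N)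
    (s : LocSec U W₁ W₂ N) (i : U.ι) (e u : Cn n) (m : N) : W₁ →L[ℂ] W₂ :=
  fderiv ℝ (s i) e u m + (A₂ i e u).comp (s i e m) - (s i e m).comp (A₁ i e u) -
    s i e (B i e u m)

/-- `s` is holomorphic: the `(0,1)`-part of its covariant derivative vanishes. -/
def IsHol (A₁ : LocForm U W₁) (A₂ : LocForm U W₂) (B : LocForm U N)
    (s : LocSec U W₁ W₂ N) : Prop :=
  ∀ i, ∀ e ∈ (U.chart i).target, ∀ u m,
    covDeriv A₁ A₂ B s i e (Complex.I • u) m = Complex.I • covDeriv A₁ A₂ B s i e u m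

variable [CompactSpace X] [MeasurableSpace X]

/-- The Atiyah–Bott form `∫_X Λ ⟨a ∧ b⟩`, where `⟨X, Y⟩ = -tr(XY)` is the invariant inner product
that the standard representation `W` induces on skew-hermitian endomorphisms. The integrand at `x`
is computed in some chart of the cover around `x`; it does not depend on the chart. -/
def atiyahBott (κ : KahlerMetric n X) (a b : LocForm U W) : ℝ :=
  ∫ x, κ.contr (U.chart (U.idx x)) (U.chart (U.idx x) x) (fun u v =>
    -(LinearMap.trace ℂ W
        (a (U.idx x) (U.chart (U.idx x) x) u * b (U.idx x) (U.chart (U.idx x) x) v :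
          W →L[ℂ] W)).re +
      (LinearMap.trace ℂ W
        (a (U.idx x) (U.chart (U.idx x) x) v * b (U.idx x) (U.chart (U.idx x) x) u :
          W →L[ℂ] W)).re) ∂κ.vol

/-- The hermitian form `tr (φ^* ψ)` on `Hom(W₁ ⊗ N, W₂)`. -/
def hermTrace [FiniteDimensional ℂ W₁] [FiniteDimensional ℂ N]
    (φ ψ : N →L[ℂ] (W₁ →L[ℂ] W₂)) : ℂ :=
  ∑ k, ∑ l, inner ℂ (φ (stdOrthonormalBasis ℂ N k) (stdOrthonormalBasis ℂ W₁ l))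
    (ψ (stdOrthonormalBasis ℂ N k) (stdOrthonormalBasis ℂ W₁ l))

end Bundles

/-! ### Spaces with a constant symplectic form -/

section Symplectic

/-- A subset (`carrier`) of a real vector space `𝓔` of families of functions, with its tangent
spaces inside `𝓔`, its smooth finite-dimensional families (`plot k O c`, for `O` open in `ℝᵏ`), and
a 2-form with constant coefficients (so that it is closed). -/
structure FormSpace (𝓔 : Type*) where
  carrier : Set 𝓔
  tangent : 𝓔 → Set 𝓔
  plot : (k : ℕ) → Set (Fin k → ℝ) → ((Fin k → ℝ) → 𝓔) → Prop
  form : 𝓔 → 𝓔 → ℝ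

variable {𝓔 𝓔₁ 𝓔₂ : Type*} [AddCommGroup 𝓔] [Module ℝ 𝓔] [AddCommGroup 𝓔₁] [Module ℝ 𝓔₁]
  [AddCommGroup 𝓔₂] [Module ℝ 𝓔₂]

/-- The 2-form is symplectic: on each tangent space, which is a real vector space, it is bilinear,
alternating and (weakly) nondegenerate. -/
def FormSpace.IsSymplectic (S : FormSpace 𝓔) : Prop :=
  ∀ x ∈ S.carrier, ∃ (T : Submodule ℝ 𝓔) (B : T →ₗ[ℝ] T →ₗ[ℝ] ℝ),
    (T : Set 𝓔) = S.tangent x ∧ (∀ u v : T, B u v = S.form u v) ∧ (∀ u, B u u = 0) ∧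
      ∀ u, (∀ v, B u v = 0) → u = 0

/-- A map is smooth if it sends smooth finite-dimensional families to smooth ones. -/
def IsSmoothMap (S₁ : FormSpace 𝓔₁) (S₂ : FormSpace 𝓔₂) (f : 𝓔₁ → 𝓔₂) : Prop :=
  ∀ (k : ℕ) (O : Set (Fin k → ℝ)) (c : (Fin k → ℝ) → 𝓔₁), IsOpen O →
    (∀ t ∈ O, c t ∈ S₁.carrier) → S₁.plot k O c → S₂.plot k O (fun t => f (c t))

/-- The restriction of the linear map `L` is a symplectomorphism from `S₁` to `S₂`. Since `L` is
linear, the differential of the restriction is `L` at every point. -/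
structure IsSymplectomorphism (S₁ : FormSpace 𝓔₁) (S₂ : FormSpace 𝓔₂) (L : 𝓔₁ →ₗ[ℝ] 𝓔₂) :
    Prop where
  symplectic_source : S₁.IsSymplectic
  symplectic_target : S₂.IsSymplectic
  bijOn : Set.BijOn L S₁.carrier S₂.carrier
  smooth : IsSmoothMap S₁ S₂ L
  smooth_inv : ∃ f : 𝓔₂ → 𝓔₁, Set.MapsTo f S₂.carrier S₁.carrier ∧
    Set.InvOn f L S₁.carrier S₂.carrier ∧ IsSmoothMap S₂ S₁ f
  tangent_bijOn : ∀ x ∈ S₁.carrier, Set.BijOn L (S₁.tangent x) (S₂.tangent (L x))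
  form_eq : ∀ x ∈ S₁.carrier, ∀ u ∈ S₁.tangent x, ∀ v ∈ S₁.tangent x,
    S₂.form (L u) (L v) = S₁.form u v

end Symplectic

/-! ### Generalized orthogonal (symplectic) quivers -/

section Gen

variable {V : Type*} [NormedAddCommGroup V] [InnerProductSpace ℂ V]

variable (V) in
/-- A nondegenerate symmetric (`ε = 1`) or skew-symmetric (`ε = -1`) bilinear form. -/
structure EpsForm where
  form : V →ₗ[ℂ] V →ₗ[ℂ] ℂ
  ε : ℂ
  ε_eq : ε = 1 ∨ ε = -1
  symm : ∀ v w, form v w = ε * form w v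
  nondeg : ∀ v, (∀ w, form v w = 0) → v = 0

/-- The orthogonal group `O(V)` (resp. the symplectic group) of the form. -/
def EpsForm.group (C : EpsForm V) : Subgroup (V →L[ℂ] V)ˣ where
  carrier := {g | ∀ v w, C.form (g.val v) (g.val w) = C.form v w}
  mul_mem' := by
    intro a b ha hb v w
    simpa using (ha (b.val v) (b.val w)).trans (hb v w)
  one_mem' := by intro v w; simp
  inv_mem' := by
    intro a ha v w
    have h := ha (a⁻¹.val v) (a⁻¹.val w)
    have hv : ∀ v, a.val (a⁻¹.val v) = v := fun v => by
      rw [← mul_apply_eq_comp, ← Units.val_mul, mul_inv_cancel]; rfl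
    rw [hv, hv] at h
    exact h.symm

/-- The Lie algebra `𝔬(V)` of `O(V)`. -/
def EpsForm.lie (C : EpsForm V) : Submodule ℂ (V →L[ℂ] V) where
  carrier := {T | ∀ v w, C.form (T v) w + C.form v (T w) = 0}
  add_mem' := by
    intro a b ha hb v w
    have h1 := ha v w
    have h2 := hb v w
    simp only [add_apply, map_add, LinearMap.add_apply]
    linear_combination h1 + h2
  zero_mem' := by intro v w; simp
  smul_mem' := by
    intro c a ha v w
    have h1 := ha v w
    simp only [smul_apply, map_smul, LinearMap.smul_apply, smul_eq_mul]
    linear_combination c * h1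

/-- The isotypic component of the character `χ` of `H`. -/
def weightSpace (H : Subgroup (V →L[ℂ] V)ˣ) (χ : H →* ℂˣ) : Submodule ℂ V where
  carrier := {v | ∀ h : H, h.1.val v = (χ h : ℂ) • v}
  add_mem' := by intro a b ha hb h; rw [map_add, ha h, hb h, smul_add]
  zero_mem' := by intro h; simp
  smul_mem' := by intro c a ha h; rw [map_smul, ha h, smul_comm]

/-- The characters of `H` that occur in `V`. -/
def Weight (H : Subgroup (V →L[ℂ] V)ˣ) := {χ : H →* ℂˣ // weightSpace H χ ≠ ⊥}

/-- The summand `𝔬(V) ∩ (Hom(V_χ, V_μ) ⊕ Hom(V_{μ⁻¹}, V_{χ⁻¹}))` of `𝔬(V)`. With `χ`, `μ` ranging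
over the occurring characters these are all the pieces `Λ²V_i`, `Λ²V_i^*`, `E_i = End V_i`, `Λ²W_i`,
`Hom(V_i, V_j)`, `Hom(V_i, V_j^*)`, `Hom(V_i^*, V_j)`, `Hom(W_i, W_j)`, `Hom(V_i, W_j)`,
`Hom(V_i^*, W_j)` of the adjoint representation (with `S²` for `Λ²` in the symplectic case). -/
def piece (C : EpsForm V) (H : Subgroup (V →L[ℂ] V)ˣ) (χ μ : H →* ℂˣ) :
    Submodule ℂ (V →L[ℂ] V) where
  carrier := {T | T ∈ C.lie ∧ (∀ v ∈ weightSpace H χ, T v ∈ weightSpace H μ) ∧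
    (∀ v ∈ weightSpace H μ⁻¹, T v ∈ weightSpace H χ⁻¹) ∧
    ∀ ν, ν ≠ χ → ν ≠ μ⁻¹ → ∀ v ∈ weightSpace H ν, T v = 0}
  add_mem' := by
    rintro a b ⟨ha, ha1, ha2, ha3⟩ ⟨hb, hb1, hb2, hb3⟩
    refine ⟨add_mem ha hb, fun v hv => add_mem (ha1 v hv) (hb1 v hv),
      fun v hv => add_mem (ha2 v hv) (hb2 v hv), fun ν h1 h2 v hv => ?_⟩
    rw [add_apply, ha3 ν h1 h2 v hv, hb3 ν h1 h2 v hv, add_zero]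
  zero_mem' := ⟨zero_mem _, fun v _ => zero_mem _, fun v _ => zero_mem _, fun _ _ _ _ _ => rfl⟩
  smul_mem' := by
    rintro c a ⟨ha, ha1, ha2, ha3⟩
    refine ⟨Submodule.smul_mem _ c ha, fun v hv => Submodule.smul_mem _ c (ha1 v hv),
      fun v hv => Submodule.smul_mem _ c (ha2 v hv), fun ν h1 h2 v hv => ?_⟩
    rw [smul_apply, ha3 ν h1 h2 v hv, smul_zero]

theorem char_inv_inv {H : Subgroup (V →L[ℂ] V)ˣ} (χ : H →* ℂˣ) : χ⁻¹⁻¹ = χ :=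
  MonoidHom.ext fun h => inv_inv (χ h)

theorem piece_swap (C : EpsForm V) (H : Subgroup (V →L[ℂ] V)ˣ) (χ μ : H →* ℂˣ) :
    piece C H μ⁻¹ χ⁻¹ = piece C H χ μ := by
  ext T
  show (_ ∧ _ ∧ _ ∧ _) ↔ (_ ∧ _ ∧ _ ∧ _)
  rw [char_inv_inv, char_inv_inv]
  constructor
  · rintro ⟨h, h1, h2, h3⟩
    exact ⟨h, h2, h1, fun ν a b => h3 ν b a⟩
  · rintro ⟨h, h1, h2, h3⟩
    exact ⟨h, h2, h1, fun ν a b => h3 ν b a⟩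

/-- A generalized `O(V)`-quiver (with dimension vector): a closed abelian reductive subgroup `H` of
`O(V)` (reductive: `V` is a completely reducible `H`-module), and a representation
`⨁_α Z_α` of the centralizer of `H`, the summands being nonzero pieces of the adjoint
representation on `𝔬(V)` and possibly occurring several times. -/
structure GenQuiver (C : EpsForm V) where
  H : Subgroup (V →L[ℂ] V)ˣ
  H_le : H ≤ C.group
  isClosed : IsClosed (H : Set (V →L[ℂ] V)ˣ)
  comm : ∀ g ∈ H, ∀ h ∈ H, g * h = h * g
  reductive : ∀ p : Submodule ℂ V, (∀ h ∈ H, ∀ v ∈ p, h.val v ∈ p) →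
    ∃ q : Submodule ℂ V, (∀ h ∈ H, ∀ v ∈ q, h.val v ∈ q) ∧ IsCompl p q
  Summand : Type*
  finite_summand : Finite Summand
  Z : Summand → Submodule ℂ (V →L[ℂ] V)
  Z_ne_bot : ∀ α, Z α ≠ ⊥
  Z_eq : ∀ α, ∃ χ μ : Weight H, Z α = piece C H χ.1 μ.1

namespace GenQuiver

variable {C : EpsForm V} (G : GenQuiver C)

/-- The group `R`: the centralizer of `H` in `O(V)`. -/
def R : Subgroup (V →L[ℂ] V)ˣ :=
  C.group ⊓ Subgroup.centralizer (G.H : Set (V →L[ℂ] V)ˣ)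

/-- The group `K = R ∩ U(V)` (a maximal compact subgroup of `R` when the metric is adapted). -/
def K : Set (V →L[ℂ] V) := {T | T ∈ unitaryGroup V ∧ ∃ g ∈ G.R, g.val = T}

/-- The Lie algebra of `K`. -/
def lieK : Set (V →L[ℂ] V) :=
  {T | T ∈ unitaryLie V ∧ T ∈ C.lie ∧ ∀ h ∈ G.H, T * h.val = h.val * T}

/-- The hermitian metric of `V` is adapted: it is compatible with the form `C`, i.e.
`C(v,w) = ⟨Jv,w⟩` for an antiunitary `J`, and distinct isotypic components are orthogonal. -/
def Adapted : Prop :=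
  (∃ J : V →ₛₗ[starRingEnd ℂ] V, (∀ v, ‖J v‖ = ‖v‖) ∧ ∀ v w, C.form v w = inner ℂ (J v) w) ∧
  ∀ χ μ : G.H →* ℂˣ, χ ≠ μ → ∀ v ∈ weightSpace G.H χ, ∀ w ∈ weightSpace G.H μ, inner ℂ v w = 0

theorem exists_weight [FiniteDimensional ℂ V] (d : ℕ) : ∀ q : Submodule ℂ V,
    Module.finrank ℂ q ≤ d → q ≠ ⊥ → (∀ h ∈ G.H, ∀ v ∈ q, h.val v ∈ q) →
    ∃ χ : G.H →* ℂˣ, ∃ v ∈ q, v ≠ 0 ∧ v ∈ weightSpace G.H χ := by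
  induction d with
  | zero =>
    intro q hq hne _
    exact absurd (Submodule.finrank_eq_zero.1 (Nat.le_zero.1 hq)) hne
  | succ d ih =>
    intro q hq hne hinv
    by_cases hs : ∀ h : G.H, ∃ c : ℂ, ∀ v ∈ q, h.1.val v = c • v
    · choose c hc using hs
      obtain ⟨v, hv, hv0⟩ := q.ne_bot_iff.1 hne
      have c1 : c 1 = 1 := by
        have := hc 1 v hv
        refine smul_left_injective ℂ hv0 ?_
        simpa using this.symm
      have cm : ∀ a b, c (a * b) = c a * c b := fun a b => by
        have h1 := hc (a * b) v hv
        have h2 : (a * b).1.val v = a.1.val (b.1.val v) := rfl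
        rw [h2, hc b v hv, map_smul, hc a v hv, smul_smul] at h1
        exact smul_left_injective ℂ hv0 (h1.symm.trans (by rw [mul_comm]))
      let χ₀ : G.H →* ℂ := { toFun := c, map_one' := c1, map_mul' := cm }
      refine ⟨χ₀.toHomUnits, v, hv, hv0, fun h => ?_⟩
      simpa [χ₀] using hc h v hv
    · push Not at hs
      obtain ⟨h, hh⟩ := hs
      have : Nontrivial q := Submodule.nontrivial_iff_ne_bot.2 hne
      let f : Module.End ℂ q := LinearMap.restrict (h.1.val : V →ₗ[ℂ] V) (hinv h.1 h.2)
      obtain ⟨μ, hμ⟩ := Module.End.exists_eigenvalue f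
      obtain ⟨w, hw⟩ := hμ.exists_hasEigenvector
      let q' : Submodule ℂ V := q ⊓ LinearMap.ker ((h.1.val : V →ₗ[ℂ] V) - μ • LinearMap.id)
      have hq' : ∀ v, v ∈ q' ↔ v ∈ q ∧ h.1.val v = μ • v := fun v => by
        simp [q', sub_eq_zero]
      have hlt : q' < q := by
        refine lt_of_le_of_ne inf_le_left fun he => ?_
        obtain ⟨v, hv, hv'⟩ := hh μ
        exact hv' ((hq' v).1 (he ▸ hv)).2
      have hne' : q' ≠ ⊥ := by
        refine q'.ne_bot_iff.2 ⟨w, (hq' _).2 ⟨w.2, ?_⟩, fun h0 => hw.2 (Subtype.ext h0)⟩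
        exact congrArg Subtype.val hw.apply_eq_smul
      obtain ⟨χ, v, hv, hv0⟩ := ih q' (by have := Submodule.finrank_lt_finrank_of_lt hlt; omega)
        hne' (fun k hk v hv => by
          obtain ⟨h1, h2⟩ := (hq' v).1 hv
          refine (hq' _).2 ⟨hinv k hk v h1, ?_⟩
          have h3 : h.1.val (k.val v) = k.val (h.1.val v) :=
            congrArg (fun g : (V →L[ℂ] V)ˣ => g.val v) (G.comm h.1 h.2 k hk)
          rw [h3, h2, map_smul])
      exact ⟨χ, v, hlt.le hv, hv0⟩

/-- `V` is the sum of its isotypic components. -/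
theorem iSup_weightSpace [FiniteDimensional ℂ V] : ⨆ χ, weightSpace G.H χ = ⊤ := by
  obtain ⟨q, hq, hc⟩ := G.reductive (⨆ χ, weightSpace G.H χ) (by
    intro h hh v hv
    have hle : (⨆ χ, weightSpace G.H χ) ≤
        (⨆ χ, weightSpace G.H χ).comap (h.val : V →ₗ[ℂ] V) := by
      refine iSup_le fun χ v hv => ?_
      have : h.val v = (χ ⟨h, hh⟩ : ℂ) • v := hv ⟨h, hh⟩
      show h.val v ∈ (⨆ χ, weightSpace G.H χ : Submodule ℂ V)
      rw [this]
      exact Submodule.smul_mem _ _ (Submodule.mem_iSup_of_mem χ hv)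
    exact hle hv)
  by_cases hb : q = ⊥
  · simpa [hb] using hc.sup_eq_top
  · obtain ⟨χ, v, hv, hv0, hvχ⟩ := G.exists_weight _ q le_rfl hb hq
    exact absurd (Submodule.disjoint_def.1 hc.disjoint v (Submodule.mem_iSup_of_mem χ hvχ) hv) hv0

theorem finite_weight [FiniteDimensional ℂ V] : Finite (Weight G.H) := by
  let f : G.H → Module.End ℂ V := fun h => (h.1.val : V →ₗ[ℂ] V)
  have hind := Module.End.independent_iInf_maxGenEigenspace_of_forall_mapsTo f
    (fun i j φ => Module.End.mapsTo_maxGenEigenspace_of_comm (by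
      refine LinearMap.ext fun v => ?_
      exact congrArg (fun g : (V →L[ℂ] V)ˣ => g.val v) (G.comm j.1 j.2 i.1 i.2)) φ)
  have hinj : Function.Injective fun (χ : G.H →* ℂˣ) (h : G.H) => (χ h : ℂ) := fun χ μ h =>
    MonoidHom.ext fun k => Units.ext (congrFun h k)
  have hle : ∀ χ : G.H →* ℂˣ, weightSpace G.H χ ≤
      ⨅ h, (f h).maxGenEigenspace (χ h : ℂ) := by
    intro χ v hv
    rw [Submodule.mem_iInf]
    intro h
    refine (Module.End.mem_maxGenEigenspace _ _ _).2 ⟨1, ?_⟩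
    have hvh : f h v = (χ h : ℂ) • v := hv h
    rw [pow_one, LinearMap.sub_apply, hvh]
    exact sub_self _
  have h2 : iSupIndep fun χ : G.H →* ℂˣ => weightSpace G.H χ := (hind.comp hinj).mono hle
  exact (WellFoundedGT.finite_ne_bot_of_iSupIndep h2).to_subtype

theorem mapsTo_of_mem_K {T : V →L[ℂ] V}
    (hT : T ∈ G.K) (χ : G.H →* ℂˣ) : ∀ v ∈ weightSpace G.H χ, T v ∈ weightSpace G.H χ := by
  obtain ⟨-, g, hg, rfl⟩ := hT
  intro v hv h
  have h1 : h.1.val (g.val v) = g.val (h.1.val v) :=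
    congrArg (fun g : (V →L[ℂ] V)ˣ => g.val v) (Subgroup.mem_centralizer_iff.1 hg.2 h.1 h.2)
  rw [h1, hv h, map_smul]

instance [FiniteDimensional ℂ V] : Fintype (Weight G.H) :=
  @Fintype.ofFinite _ G.finite_weight

instance : Fintype G.Summand := @Fintype.ofFinite _ G.finite_summand

theorem form_eq_zero {χ μ : G.H →* ℂˣ} (h : μ ≠ χ⁻¹) {v w : V} (hv : v ∈ weightSpace G.H χ)
    (hw : w ∈ weightSpace G.H μ) : C.form v w = 0 := by
  by_contra h0
  refine h (MonoidHom.ext fun k => ?_)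
  have h1 := G.H_le k.2 v w
  rw [hv k, hw k] at h1
  simp only [map_smul, LinearMap.smul_apply, smul_eq_mul] at h1
  rw [MonoidHom.inv_apply, eq_inv_iff_mul_eq_one]
  refine Units.ext ?_
  push_cast
  refine mul_right_cancel₀ h0 ?_
  linear_combination h1

theorem inv_weight [FiniteDimensional ℂ V] (χ : Weight G.H) : weightSpace G.H χ.1⁻¹ ≠ ⊥ := by
  intro hb
  obtain ⟨v, hv, hv0⟩ := (weightSpace G.H χ.1).ne_bot_iff.1 χ.2
  refine hv0 (C.nondeg v fun w => ?_)
  have hle : (⨆ μ, weightSpace G.H μ) ≤ LinearMap.ker (C.form v) := by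
    refine iSup_le fun μ w hw => ?_
    by_cases hμ : μ = χ.1⁻¹
    · subst hμ
      rw [hb] at hw
      rw [(Submodule.mem_bot ℂ).1 hw]
      exact zero_mem _
    · exact G.form_eq_zero hμ hv hw
  rw [G.iSup_weightSpace] at hle
  exact hle (Submodule.mem_top (x := w))

/-- The involution `χ ↦ χ⁻¹` on the characters occurring in `V`. -/
def dual [FiniteDimensional ℂ V] (χ : Weight G.H) : Weight G.H := ⟨χ.1⁻¹, G.inv_weight χ⟩

end GenQuiver

end Gen

/-! ### Symmetric quivers -/

section Sym

/-- A symmetric quiver, its arrows being labelled by `Orb` in such a way that the involution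
preserves the labels. The labels carry the twisting bundles, so that `𝕄_a = 𝕄_{σ(a)}`. -/
structure SymQuiver where
  Vert : Type*
  Orb : Type*
  Arr : Orb → Type*
  fintypeVert : Fintype Vert
  fintypeOrb : Fintype Orb
  fintypeArr : ∀ o, Fintype (Arr o)
  tail : ∀ {o}, Arr o → Vert
  head : ∀ {o}, Arr o → Vert
  σv : Vert → Vert
  σa : ∀ {o}, Arr o → Arr o
  σv_σv : ∀ v, σv (σv v) = v
  σa_σa : ∀ {o} (a : Arr o), σa (σa a) = a
  tail_σa : ∀ {o} (a : Arr o), tail (σa a) = σv (head a)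
  head_σa : ∀ {o} (a : Arr o), head (σa a) = σv (tail a)
  fixed : ∀ {o} (a : Arr o), tail a = σv (head a) → σa a = a

attribute [instance] SymQuiver.fintypeVert SymQuiver.fintypeOrb SymQuiver.fintypeArr

open Classical in
/-- The symmetric quiver of a generalized quiver: one vertex for each character occurring in `V`;
each summand `Z_α = 𝔬(V) ∩ (Hom(V_χ, V_μ) ⊕ Hom(V_{μ⁻¹}, V_{χ⁻¹}))` gives the arrows `χ → μ` and
`μ⁻¹ → χ⁻¹` (a single one if they coincide), which the involution exchanges. -/
abbrev GenQuiver.toSym {V : Type*} [NormedAddCommGroup V] [InnerProductSpace ℂ V]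
    [FiniteDimensional ℂ V] {C : EpsForm V} (G : GenQuiver C) : SymQuiver where
  Vert := Weight G.H
  Orb := G.Summand
  Arr α := {q : Weight G.H × Weight G.H // G.Z α = piece C G.H q.1.1 q.2.1}
  fintypeVert := inferInstance
  fintypeOrb := inferInstance
  fintypeArr _ := inferInstance
  tail a := a.1.1
  head a := a.1.2
  σv := G.dual
  σa a := ⟨(G.dual a.1.2, G.dual a.1.1),
    a.2.trans (piece_swap C G.H a.1.1.1 a.1.2.1).symm⟩
  σv_σv v := Subtype.ext (char_inv_inv v.1)
  σa_σa a := Subtype.ext (Prod.ext (Subtype.ext (char_inv_inv _)) (Subtype.ext (char_inv_inv _)))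
  tail_σa _ := rfl
  head_σa _ := rfl
  fixed a h := Subtype.ext (Prod.ext h.symm (by
    have h' : a.1.1 = G.dual a.1.2 := h
    show G.dual a.1.1 = a.1.2
    rw [h']
    exact Subtype.ext (char_inv_inv _)))

end Sym

/-! ### The two spaces and the bijection -/

section Spaces

variable {V : Type*} [NormedAddCommGroup V] [InnerProductSpace ℂ V]

variable {n : ℕ} {X : Type*} [TopologicalSpace X] [ChartedSpace (Cn n) X]

section Sandwich

variable {W₁ W₂ W N : Type*} [NormedAddCommGroup W₁] [InnerProductSpace ℂ W₁]
  [NormedAddCommGroup W₂] [InnerProductSpace ℂ W₂] [NormedAddCommGroup W] [InnerProductSpace ℂ W]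
  [NormedAddCommGroup N] [InnerProductSpace ℂ N] {U : HolCover n X}

/-- The linear map `T ↦ P T J`. -/
def sandwich (P : V →L[ℂ] W₂) (J : W₁ →L[ℂ] V) : (V →L[ℂ] V) →L[ℂ] (W₁ →L[ℂ] W₂) :=
  (ContinuousLinearMap.compL ℂ W₁ V W₂ P).comp ((ContinuousLinearMap.compL ℂ W₁ V V).flip J)

/-- The linear map `a ↦ P a J` on local 1-forms. -/
def sandwichForm (P : V →L[ℂ] W) (J : W →L[ℂ] V) : LocForm U V →ₗ[ℝ] LocForm U W where
  toFun a i e := ((sandwich P J).restrictScalars ℝ).comp (a i e)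
  map_add' x y := by
    funext i e
    exact ContinuousLinearMap.comp_add _ (x i e) (y i e)
  map_smul' r x := by
    funext i e
    exact ContinuousLinearMap.comp_smul _ r (x i e)

/-- The linear map `s ↦ P s J` on local sections. -/
def sandwichSec (P : V →L[ℂ] W₂) (J : W₁ →L[ℂ] V) : LocSec U V V N →ₗ[ℝ] LocSec U W₁ W₂ N where
  toFun s i e := (sandwich P J).comp (s i e)
  map_add' x y := by
    funext i e
    exact ContinuousLinearMap.comp_add _ (x i e) (y i e)
  map_smul' r x := by
    funext i e
    exact ContinuousLinearMap.ext fun m => map_smul ((sandwich P J).restrictScalars ℝ) r (x i e m)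

theorem contDiff_sandwich (P : V →L[ℂ] W₂) (J : W₁ →L[ℂ] V) : ContDiff ℝ ∞ (sandwich P J) :=
  ((sandwich P J).restrictScalars ℝ).contDiff

end Sandwich

variable [FiniteDimensional ℂ V]

/-- The component in `Hom(p, q)` of an endomorphism of `V` (for the orthogonal projection
to `q`). -/
def block (p q : Submodule ℂ V) : (V →L[ℂ] V) →L[ℂ] (p →L[ℂ] q) :=
  sandwich q.orthogonalProjectionOnto p.subtypeL

/-- The component in `End p` of a local 1-form with values in `End V`. -/
def blockForm {U : HolCover n X} (p : Submodule ℂ V) : LocForm U V →ₗ[ℝ] LocForm U p :=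
  sandwichForm p.orthogonalProjectionOnto p.subtypeL

/-- The component in `Hom(p ⊗ N, q)` of a local section with values in `Hom(N, End V)`. -/
def blockSec {U : HolCover n X} {N : Type*} [NormedAddCommGroup N] [InnerProductSpace ℂ N]
    (p q : Submodule ℂ V) : LocSec U V V N →ₗ[ℝ] LocSec U p q N :=
  sandwichSec q.orthogonalProjectionOnto p.subtypeL

theorem block_apply (p q : Submodule ℂ V) (T : V →L[ℂ] V) (v : p) :
    block p q T v = q.orthogonalProjectionOnto (T v) := rfl

theorem coe_block {p : Submodule ℂ V} {T : V →L[ℂ] V} (hT : ∀ v ∈ p, T v ∈ p) (v : p) :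
    ((block p p T v : p) : V) = T v :=
  p.starProjection_eq_self_iff.2 (hT v v.2)

theorem block_one (p : Submodule ℂ V) : block p p (1 : V →L[ℂ] V) = 1 :=
  ContinuousLinearMap.ext fun v => Subtype.ext (coe_block (fun _ h => h) v)

theorem block_mul {p : Submodule ℂ V} (S T : V →L[ℂ] V) (hT : ∀ v ∈ p, T v ∈ p) :
    block p p S * block p p T = block p p (S * T) := by
  refine ContinuousLinearMap.ext fun v => ?_
  show block p p S (block p p T v) = block p p (S * T) v
  rw [block_apply, coe_block hT, block_apply]
  rfl

theorem block_unitary {p : Submodule ℂ V} {T : V →L[ℂ] V} (hT : ∀ v ∈ p, T v ∈ p)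
    (hu : T ∈ unitaryGroup V) : block p p T ∈ unitaryGroup p := by
  intro v w
  rw [Submodule.coe_inner, coe_block hT, coe_block hT, hu, Submodule.coe_inner]

/-- The vector bundle (with its hermitian metric) at the vertex `χ` that is associated with a
principal `K`-bundle through the action of `K` on the isotypic component `V_χ`. -/
def vertexBundle {C : EpsForm V} {G : GenQuiver C} {U : HolCover n X}
    (E : PrincipalBundle U V G.K) (χ : Weight G.H) :
    PrincipalBundle U (weightSpace G.H χ.1) (unitaryGroup (weightSpace G.H χ.1)) where
  tr i j x := block _ _ (E.tr i j x)
  mem i j x hx := block_unitary (G.mapsTo_of_mem_K (E.mem i j x hx) χ.1) (E.mem i j x hx).1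
  smooth i j := (contDiff_sandwich _ _).comp_contDiffOn (E.smooth i j)
  one i x hx := by rw [E.one i x hx, block_one]
  cocycle i j k x hx := by
    rw [block_mul _ _ (G.mapsTo_of_mem_K (E.mem j k x ⟨hx.1.2, hx.2⟩) χ.1),
      E.cocycle i j k x hx]

variable [CompactSpace X] [MeasurableSpace X]

section GenSide

variable {C : EpsForm V} (G : GenQuiver C) {U : HolCover n X}
  (M : G.Summand → Type*) [∀ α, NormedAddCommGroup (M α)] [∀ α, InnerProductSpace ℂ (M α)]

/-- The ambient vector space for pairs (connection on `E`, section of `Rep(Q̃, M)`), where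
`Rep(Q̃, M) = ⨁_α Hom(M_α, Z_α)` and `Z_α ⊆ End V`. -/
abbrev GenAmbient (U : HolCover n X) := LocForm U V × (∀ α, LocSec U V V (M α))

variable [∀ α, FiniteDimensional ℂ (M α)]

open Classical in
/-- The space `𝒜^{1,1} × Ω⁰(𝔯𝔢𝔭(Q̃, M))` for the generalized quiver, with the weighted Atiyah–Bott
form. The factors of `R = ∏_{i ∈ S} GL(V_i) × ∏_j O(W_j)` have the weights `a i` and `b j`. -/
def genSpace (κ : KahlerMetric n X) (E : PrincipalBundle U V G.K)
    (F : ∀ α, PrincipalBundle U (M α) (unitaryGroup (M α)))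
    (S : Finset (Weight G.H)) (a b : Weight G.H → ℝ) : FormSpace (GenAmbient G M U) where
  carrier := {x | (IsConnection E G.lieK x.1 ∧ IsType11 (curv x.1)) ∧
    ∀ α, IsSection E E (F α) (x.2 α) ∧ ∀ i e m, x.2 α i e m ∈ G.Z α}
  tangent x := {y | (IsAdForm E G.lieK y.1 ∧ IsType11 (covExtDeriv x.1 y.1)) ∧
    ∀ α, IsSection E E (F α) (y.2 α) ∧ ∀ i e m, y.2 α i e m ∈ G.Z α}
  plot k O c := ∀ i,
    ContDiffOn ℝ ∞ (fun t : (Fin k → ℝ) × Cn n => (c t.1).1 i t.2) (O ×ˢ (U.chart i).target) ∧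
    ∀ α, ContDiffOn ℝ ∞ (fun t : (Fin k → ℝ) × Cn n => (c t.1).2 α i t.2)
      (O ×ˢ (U.chart i).target)
  form x y :=
    ∑ χ ∈ S, a χ * atiyahBott κ (blockForm (weightSpace G.H χ.1) x.1)
        (blockForm (weightSpace G.H χ.1) y.1) +
      ∑ χ ∈ Finset.univ.filter (fun χ => G.dual χ = χ),
        b χ * atiyahBott κ (blockForm (weightSpace G.H χ.1) x.1)
          (blockForm (weightSpace G.H χ.1) y.1) +
      ∫ z, ∑ α, (hermTrace (x.2 α (U.idx z) (U.chart (U.idx z) z))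
        (y.2 α (U.idx z) (U.chart (U.idx z) z))).im ∂κ.vol

/-- The morphisms of the pair are holomorphic for the connection of the pair (and fixed
connections `B` on the twisting bundles). -/
def GenIsHol (B : ∀ α, LocForm U (M α)) (x : GenAmbient G M U) : Prop :=
  ∀ α, IsHol x.1 x.1 (B α) (x.2 α)

end GenSide

section PlainSide

variable (Q : SymQuiver) (C : EpsForm V) (D : Q.Vert → Submodule ℂ V) {U : HolCover n X}
  (M : Q.Orb → Type*) [∀ o, NormedAddCommGroup (M o)] [∀ o, InnerProductSpace ℂ (M o)]

/-- The ambient vector space for plain `Q`-bundles (connections at the vertices, morphisms at the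
arrows) with fibres `D v ⊆ V` at the vertices. -/
abbrev PlainAmbient (U : HolCover n X) :=
  (∀ v, LocForm U (D v)) × (∀ o (c : Q.Arr o), LocSec U (D (Q.tail c)) (D (Q.head c)) (M o))

/-- A family of 1-forms at the vertices is compatible with the form `C` of the total space, i.e.
`A_{σ(v)} = -A_vᵗ`. -/
def CompatForm (A : ∀ v, LocForm U (D v)) : Prop :=
  ∀ v i e u, ∀ (x : D v) (y : D (Q.σv v)),
    C.form (A v i e u x : D v) (y : V) + C.form (x : V) (A (Q.σv v) i e u y : D (Q.σv v)) = 0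

/-- The morphisms satisfy `C(φ_c (v ⊗ m), w) + C(v, φ_{σ(c)} (w ⊗ m)) = 0`. -/
def OrthSec (s : ∀ o (c : Q.Arr o), LocSec U (D (Q.tail c)) (D (Q.head c)) (M o)) : Prop :=
  ∀ o (c : Q.Arr o) i e m, ∀ (x : D (Q.tail c)) (y : D (Q.tail (Q.σa c))),
    C.form (s o c i e m x : D (Q.head c)) (y : V) +
      C.form (x : V) (s o (Q.σa c) i e m y : D (Q.head (Q.σa c))) = 0

variable [∀ o, FiniteDimensional ℂ (M o)]

/-- The space `𝒜^{1,1} × Ω⁰(𝔯𝔢𝔭ᵒ(Q, M, V))` of orthogonal `Q`-bundles, as a subspace of the space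
of plain unitary `Q`-bundles, with the restriction of the symplectic form of the latter for the
parameters `p v` at the vertices. -/
def orthSpace (κ : KahlerMetric n X)
    (P : ∀ v, PrincipalBundle U (D v) (unitaryGroup (D v)))
    (F : ∀ o, PrincipalBundle U (M o) (unitaryGroup (M o)))
    (p : Q.Vert → ℝ) : FormSpace (PlainAmbient Q D M U) where
  carrier := {x |
    ((∀ v, IsConnection (P v) (unitaryLie (D v)) (x.1 v) ∧ IsType11 (curv (x.1 v))) ∧
      CompatForm Q C D x.1) ∧
    (∀ o c, IsSection (P (Q.tail c)) (P (Q.head c)) (F o) (x.2 o c)) ∧ OrthSec Q C D M x.2}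
  tangent x := {y |
    ((∀ v, IsAdForm (P v) (unitaryLie (D v)) (y.1 v) ∧
        IsType11 (covExtDeriv (x.1 v) (y.1 v))) ∧
      CompatForm Q C D y.1) ∧
    (∀ o c, IsSection (P (Q.tail c)) (P (Q.head c)) (F o) (y.2 o c)) ∧ OrthSec Q C D M y.2}
  plot k O c := ∀ i,
    (∀ v, ContDiffOn ℝ ∞ (fun t : (Fin k → ℝ) × Cn n => (c t.1).1 v i t.2)
      (O ×ˢ (U.chart i).target)) ∧
    ∀ o r, ContDiffOn ℝ ∞ (fun t : (Fin k → ℝ) × Cn n => (c t.1).2 o r i t.2)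
      (O ×ˢ (U.chart i).target)
  form x y :=
    ∑ v, p v * atiyahBott κ (x.1 v) (y.1 v) +
      ∫ z, ∑ o, ∑ c, (hermTrace (x.2 o c (U.idx z) (U.chart (U.idx z) z))
        (y.2 o c (U.idx z) (U.chart (U.idx z) z))).im ∂κ.vol

/-- All the morphisms are holomorphic. -/
def PlainIsHol (B : ∀ o, LocForm U (M o)) (x : PlainAmbient Q D M U) : Prop :=
  ∀ o (c : Q.Arr o), IsHol (x.1 (Q.tail c)) (x.1 (Q.head c)) (B o) (x.2 o c)

end PlainSide

section Map

variable {C : EpsForm V} (G : GenQuiver C) {U : HolCover n X}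
  (M : G.Summand → Type*) [∀ α, NormedAddCommGroup (M α)] [∀ α, InnerProductSpace ℂ (M α)]

/-- The fibre of the total space at a vertex of the symmetric quiver. -/
def vertexSpace (v : Weight G.H) : Submodule ℂ V := weightSpace G.H v.1

/-- The correspondence between twisted `Q̃`-bundles and twisted orthogonal `Q`-bundles: a
connection on `E` is sent to the induced connections on the bundles of the vertices, and an element
of `Hom(M_α, Z_α)` to its components along the arrows that belong to `α`. -/
def bundleMap : GenAmbient G M U →ₗ[ℝ] PlainAmbient G.toSym (vertexSpace G) M U where
  toFun x := (fun v => blockForm (vertexSpace G v) x.1,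
    fun α c => blockSec (vertexSpace G (G.toSym.tail c)) (vertexSpace G (G.toSym.head c)) (x.2 α))
  map_add' x y := Prod.ext (funext fun _ => map_add _ _ _)
    (funext fun _ => funext fun _ => map_add _ _ _)
  map_smul' r x := Prod.ext (funext fun _ => map_smul _ _ _)
    (funext fun α => funext fun c =>
      (blockSec (vertexSpace G (G.toSym.tail c)) (vertexSpace G (G.toSym.head c))).map_smul r
        (x.2 α))

end Map

end Spaces

end SQ

end

/-! An operator on `V` that commutes with `H` is block diagonal for the isotypic decomposition, and
skewness for `C` makes its block at `σ(χ)` the negative transpose of its block at `χ`. Hence a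
connection form with values in the Lie algebra of `K` is the same thing as a compatible family of
skew-hermitian forms at the vertices (`block_compat`, `mem_lieK_of_blocks`). In the same way an
element of `Z_α` is the same thing as its components along the arrows of `α`, subject to the
orthogonality relation (`block_orth`, `mem_Z_of_blocks`). This needs that two arrows belonging to
one `α` never start at the same vertex, which holds because a nonzero piece determines the pair `(χ,
μ)` up to exchange with `(μ⁻¹, χ⁻¹)` (`eq_of_piece_eq`, `tail_injective`). The inverse map `asm`
adds up the blocks; it works because the isotypic components are mutually orthogonal, so that the
orthogonal projections are the isotypic ones.

The gauge laws, type `(1,1)` and holomorphy pass between operators on `V` and their blocks because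
the relation `Intertwines` is stable under sums, composition and derivatives.

For the forms, `C` identifies `V_σ(χ)` with the dual of `V_χ`, and a product of two blocks at `σ(χ)`
becomes the transpose of the product in reverse order at `χ`. Traces agree, so the Atiyah–Bott forms
at `χ` and `σ(χ)` coincide on tangent vectors (`traceL_dual`, `atiyahBott_dual`), and only `p_χ +
p_σ(χ)` matters (`sum_vertices`). For the sections, an orthonormal basis of `V` adapted to the
decomposition splits `tr (φ^* ψ)` into the contributions of the arrows (`sum_hermTrace_block`).

Nondegeneracy is proved on the generalized side, by pairing a tangent vector `(a, s)` with `(a(-i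
·), 0)` and with `(0, is)`. Both are again tangent, and the values are weighted squared `L²`-norms
(`atiyahBott_rot_nonneg`, `eq_zero_of_secForm`). They vanish only for zero integrands, since the
integrands are continuous and the volume is finite and charges open sets. The weights see one vertex
of each dual pair; the block at the other vertex then vanishes by duality (`eq_zero_on_dual`). On
the side of orthogonal bundles the individual `p_χ` may be negative, so nondegeneracy there is
transported along the bijection (`FormSpace.IsSymplectic.transport`). -/

set_option linter.unusedSectionVars false

noncomputable section

namespace SQ

/-! ### Real coordinates on `ℂⁿ` and Gram matrices of real bilinear forms. -/

section RealBasis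

variable {n : ℕ}

/-- The real coordinates on `ℂⁿ`. -/
def realCoord (n : ℕ) : Cn n ≃ₗ[ℝ] (Fin n × Fin 2 → ℝ) where
  toFun u k := if k.2 = 0 then (u k.1).re else (u k.1).im
  invFun c j := ⟨c (j, 0), c (j, 1)⟩
  map_add' u v := by ext k; by_cases h : k.2 = 0 <;> simp [h]
  map_smul' r v := by ext k; by_cases h : k.2 = 0 <;> simp [h]
  left_inv u := by ext j; simp
  right_inv c := by
    ext ⟨j, k⟩
    fin_cases k <;> simp

/-- The vectors `realBasis k` form a real basis of `ℂⁿ`. -/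
def realBas (n : ℕ) : Module.Basis (Fin n × Fin 2) ℝ (Cn n) := Module.Basis.ofEquivFun (realCoord n)

theorem realBas_apply (k : Fin n × Fin 2) : realBas n k = realBasis k := by
  rw [realBas, Module.Basis.coe_ofEquivFun, LinearEquiv.symm_apply_eq]
  ext ⟨j, l⟩
  obtain ⟨i, m⟩ := k
  rcases eq_or_ne j i with rfl | h
  · fin_cases m <;> fin_cases l <;> simp [realCoord, realBasis]
  · have : (i, m) ≠ (j, l) := fun h' => h (congrArg Prod.fst h').symm
    by_cases hl : l = 0 <;> simp [realCoord, realBasis, h, hl, Prod.ext_iff]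

/-- The Gram matrix of a bilinear form in the real basis. -/
def gramMat (b : Cn n → Cn n → ℝ) : Matrix (Fin n × Fin 2) (Fin n × Fin 2) ℝ :=
  Matrix.of fun k l => b (realBasis k) (realBasis l)

/-- The change of variables that makes the contraction with the Kähler form independent of the
chart. -/
theorem gramMat_comp (b : Cn n →ₗ[ℝ] Cn n →ₗ[ℝ] ℝ) (P : Cn n →ₗ[ℝ] Cn n) :
    gramMat (fun u v => b (P u) (P v)) =
      (LinearMap.toMatrix (realBas n) (realBas n) P).transpose * gramMat (fun u v => b u v) *
        LinearMap.toMatrix (realBas n) (realBas n) P := by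
  have h := LinearMap.toMatrix₂_compl₁₂ (realBas n) (realBas n) (realBas n) (realBas n) b P P
  have h1 : ∀ b : Cn n →ₗ[ℝ] Cn n →ₗ[ℝ] ℝ, gramMat (fun u v => b u v) =
      LinearMap.toMatrix₂ (realBas n) (realBas n) b := by
    intro b
    ext k l
    rw [LinearMap.toMatrix₂_apply, realBas_apply, realBas_apply]
    rfl
  rw [h1 b, ← h, ← h1]
  rfl

theorem gramMat_quadratic (b : Cn n →ₗ[ℝ] Cn n →ₗ[ℝ] ℝ) (c : Fin n × Fin 2 → ℝ) :
    dotProduct c (Matrix.mulVec (gramMat (fun u v => b u v)) c) =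
      b (∑ k, c k • realBasis k) (∑ k, c k • realBasis k) := by
  simp only [map_sum, map_smul, LinearMap.sum_apply, LinearMap.smul_apply, smul_eq_mul,
    dotProduct, Matrix.mulVec, gramMat, Matrix.of_apply, Finset.mul_sum]
  rw [Finset.sum_comm]
  refine Finset.sum_congr rfl fun k _ => Finset.sum_congr rfl fun l _ => ?_
  ring

theorem sum_smul_realBasis_ne_zero {c : Fin n × Fin 2 → ℝ} (hc : c ≠ 0) :
    ∑ k, c k • realBasis k ≠ (0 : Cn n) := by
  intro h
  refine hc (funext fun k => ?_)
  have := Fintype.linearIndependent_iff.1 (realBas n).linearIndependent c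
    (by simpa only [realBas_apply] using h) k
  exact this

theorem gramMat_posDef (b : Cn n →ₗ[ℝ] Cn n →ₗ[ℝ] ℝ) (hs : ∀ u v, b u v = b v u)
    (hp : ∀ u, u ≠ 0 → 0 < b u u) : (gramMat (fun u v => b u v)).PosDef := by
  refine Matrix.PosDef.of_dotProduct_mulVec_pos ?_ fun c hc => ?_
  · ext k l
    exact hs _ _
  · rw [star_trivial, gramMat_quadratic]
    exact hp _ (sum_smul_realBasis_ne_zero hc)

theorem gramMat_posSemidef (b : Cn n →ₗ[ℝ] Cn n →ₗ[ℝ] ℝ) (hs : ∀ u v, b u v = b v u)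
    (hp : ∀ u, 0 ≤ b u u) : (gramMat (fun u v => b u v)).PosSemidef := by
  refine Matrix.PosSemidef.of_dotProduct_mulVec_nonneg ?_ fun c => ?_
  · ext k l
    exact hs _ _
  · rw [star_trivial, gramMat_quadratic]
    exact hp _

end RealBasis

/-! ### Traces of the form `tr (A⁻¹ B)`: invariance and positivity. -/

section Trace

variable {ι : Type*} [Fintype ι] [DecidableEq ι]

/-- Under a simultaneous congruence `A⁻¹ B` is only conjugated by `P`. Here `A` will be the metric
and `B` the form `β(·, i ·)`. -/
theorem trace_inv_mul_congr {A B P : Matrix ι ι ℝ} (hP : IsUnit P.det) :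
    Matrix.trace ((P.transpose * A * P)⁻¹ * (P.transpose * B * P)) = Matrix.trace (A⁻¹ * B) := by
  have hT : IsUnit P.transpose.det := by rwa [Matrix.det_transpose]
  rw [Matrix.mul_inv_rev, Matrix.mul_inv_rev]
  have : P⁻¹ * (A⁻¹ * P.transpose⁻¹) * (P.transpose * B * P) = P⁻¹ * (A⁻¹ * B * P) := by
    simp only [Matrix.mul_assoc]
    rw [← Matrix.mul_assoc P.transpose⁻¹, Matrix.nonsing_inv_mul _ hT, Matrix.one_mul]
  rw [this, Matrix.trace_mul_comm, Matrix.mul_assoc, Matrix.mul_nonsing_inv _ hP, Matrix.mul_one]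

-- Writing `A⁻¹ = S^* S` with `S` invertible turns the trace into that of the positive semidefinite
-- matrix `S B S^*`, which vanishes only if the matrix does.
open scoped ComplexOrder MatrixOrder Matrix.Norms.L2Operator in
theorem trace_inv_mul_nonneg {A B : Matrix ι ι ℝ} (hA : A.PosDef) (hB : B.PosSemidef) :
    0 ≤ Matrix.trace (A⁻¹ * B) ∧ (Matrix.trace (A⁻¹ * B) = 0 → B = 0) := by
  obtain ⟨S, hS, h⟩ : ∃ S : Matrix ι ι ℝ, IsUnit S ∧ A⁻¹ = star S * S := by
    obtain ⟨S, h⟩ := CStarAlgebra.nonneg_iff_eq_star_mul_self.1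
      (Matrix.nonneg_iff_posSemidef.2 hA.inv.posSemidef)
    refine ⟨S, ?_, h⟩
    have h1 : IsUnit (star S * S) := h ▸ hA.inv.isUnit
    exact isUnit_of_mul_isUnit_right h1
  have ht : Matrix.trace (A⁻¹ * B) = Matrix.trace (S * B * star S) := by
    rw [h, Matrix.mul_assoc, Matrix.trace_mul_comm]
  have hp : (S * B * star S).PosSemidef := hB.mul_mul_conjTranspose_same S
  refine ⟨ht ▸ hp.trace_nonneg, fun h0 => ?_⟩
  have h1 : S * B * star S = 0 := hp.trace_eq_zero_iff.1 (ht ▸ h0)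
  have h2 := (hS.star.mul_left_eq_zero).1 h1
  exact (hS.mul_right_eq_zero).1 h2

end Trace

/-! ### Coordinate changes, and the metric and the contraction in charts. -/

section Charts

variable {n : ℕ} {X : Type*} [TopologicalSpace X] [ChartedSpace (Cn n) X]

namespace HolCover

variable (U : HolCover n X)

theorem isOpen_overlap (i j : U.ι) : IsOpen (U.overlap i j) :=
  (U.chart i).isOpen_inter_preimage_symm (U.chart j).open_source

theorem trans_mem_overlap {i j : U.ι} {e : Cn n} (he : e ∈ U.overlap i j) :
    U.trans i j e ∈ U.overlap j i := by
  refine ⟨(U.chart j).map_source he.2, ?_⟩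
  show (U.chart j).symm (U.chart j ((U.chart i).symm e)) ∈ (U.chart i).source
  rw [(U.chart j).left_inv he.2]
  exact (U.chart i).map_target he.1

theorem symm_trans {i j : U.ι} {e : Cn n} (he : e ∈ U.overlap i j) :
    (U.chart j).symm (U.trans i j e) = (U.chart i).symm e := (U.chart j).left_inv he.2

theorem trans_trans {i j : U.ι} {e : Cn n} (he : e ∈ U.overlap i j) :
    U.trans j i (U.trans i j e) = e := by
  rw [trans, U.symm_trans he, (U.chart i).right_inv he.1]

theorem contDiffOn_trans (i j : U.ι) : ContDiffOn ℂ ∞ (U.trans i j) (U.overlap i j) := by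
  have h1 := IsManifold.compatible_of_mem_maximalAtlas (U.mem_atlas i) (U.mem_atlas j)
  rw [contDiffGroupoid, mem_groupoid_of_pregroupoid] at h1
  have h2 := h1.1
  simp only [contDiffPregroupoid, modelWithCornersSelf_coe, modelWithCornersSelf_coe_symm,
    Function.id_comp, Function.comp_id, Set.range_id, Set.inter_univ, Set.preimage_id] at h2
  refine h2.mono fun e he => ?_
  simpa [overlap] using he

theorem differentiableAt_trans {i j : U.ι} {e : Cn n} (he : e ∈ U.overlap i j) :
    DifferentiableAt ℂ (U.trans i j) e :=
  ((U.contDiffOn_trans i j).contDiffAt ((U.isOpen_overlap i j).mem_nhds he)).differentiableAt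
    (by simp)

theorem fderiv_trans {i j : U.ι} {e : Cn n} (he : e ∈ U.overlap i j) :
    fderiv ℝ (U.trans i j) e = (fderiv ℂ (U.trans i j) e).restrictScalars ℝ :=
  (U.differentiableAt_trans he).fderiv_restrictScalars ℝ

/-- Holomorphy of the coordinate changes enters here: it makes `β(·, i ·)` and the rotation `a ↦
a(-i ·)` independent of the chart. -/
theorem fderiv_trans_I {i j : U.ι} {e : Cn n} (he : e ∈ U.overlap i j) (u : Cn n) :
    fderiv ℝ (U.trans i j) e (Complex.I • u) = Complex.I • fderiv ℝ (U.trans i j) e u := by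
  rw [U.fderiv_trans he]
  exact map_smul (fderiv ℂ (U.trans i j) e) _ _

theorem fderiv_trans_trans {i j : U.ι} {e : Cn n} (he : e ∈ U.overlap i j) (u : Cn n) :
    fderiv ℝ (U.trans j i) (U.trans i j e) (fderiv ℝ (U.trans i j) e u) = u := by
  have h1 := ((U.differentiableAt_trans (U.trans_mem_overlap he)).restrictScalars ℝ).hasFDerivAt.comp e
    ((U.differentiableAt_trans he).restrictScalars ℝ).hasFDerivAt
  have h2 : (U.trans j i ∘ U.trans i j) =ᶠ[nhds e] id :=
    Filter.eventually_of_mem ((U.isOpen_overlap i j).mem_nhds he) fun e' he' => U.trans_trans he'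
  have h3 := (h1.congr_of_eventuallyEq h2.symm).unique (hasFDerivAt_id e)
  exact congrArg (fun T => T u) h3

theorem isUnit_det_fderiv_trans {i j : U.ι} {e : Cn n} (he : e ∈ U.overlap i j) :
    IsUnit (LinearMap.toMatrix (realBas n) (realBas n)
      (fderiv ℝ (U.trans i j) e : Cn n →ₗ[ℝ] Cn n)).det := by
  refine Matrix.isUnit_det_of_left_inverse (B := LinearMap.toMatrix (realBas n) (realBas n)
      (fderiv ℝ (U.trans j i) (U.trans i j e) : Cn n →ₗ[ℝ] Cn n)) ?_
  rw [← LinearMap.toMatrix_comp, ← LinearMap.toMatrix_id (realBas n)]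
  congr 1
  exact LinearMap.ext fun u => U.fderiv_trans_trans he u

end HolCover

theorem mdifferentiableAt_symm {φ : OpenPartialHomeomorph X (Cn n)}
    (hφ : φ ∈ IsManifold.maximalAtlas 𝓘(ℂ, Cn n) ∞ X) {e : Cn n} (he : e ∈ φ.target) :
    MDifferentiableAt 𝓘(ℂ, Cn n) 𝓘(ℂ, Cn n) φ.symm e :=
  (contMDiffAt_symm_of_mem_maximalAtlas hφ he).mdifferentiableAt (by simp)

/-- The differential of the inverse of a chart. -/
def dsymm (φ : OpenPartialHomeomorph X (Cn n)) (e : Cn n) : Cn n →L[ℂ] Cn n :=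
  mfderiv 𝓘(ℂ, Cn n) 𝓘(ℂ, Cn n) φ.symm e

theorem hasMFDerivAt_symm {φ : OpenPartialHomeomorph X (Cn n)}
    (hφ : φ ∈ IsManifold.maximalAtlas 𝓘(ℂ, Cn n) ∞ X) {e : Cn n} (he : e ∈ φ.target) :
    HasMFDerivAt 𝓘(ℂ, Cn n) 𝓘(ℂ, Cn n) φ.symm e (dsymm φ e) :=
  (mdifferentiableAt_symm hφ he).hasMFDerivAt

/-- The chain rule for `φ ∘ φ.symm = id`; it carries positivity of the metric over to the Gram
matrix. -/
theorem dsymm_injective {φ : OpenPartialHomeomorph X (Cn n)}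
    (hφ : φ ∈ IsManifold.maximalAtlas 𝓘(ℂ, Cn n) ∞ X) {e : Cn n} (he : e ∈ φ.target) {u : Cn n}
    (hu : dsymm φ e u = 0) : u = 0 := by
  have h0 := (contMDiffAt_of_mem_maximalAtlas hφ (φ.map_target he)).mdifferentiableAt (by simp)
  have h1 := h0.hasMFDerivAt.comp e (hasMFDerivAt_symm hφ he)
  have h2 : (φ ∘ φ.symm) =ᶠ[nhds e] id :=
    Filter.eventually_of_mem (φ.open_target.mem_nhds he) fun e' he' => φ.right_inv he'
  have h3 := hasMFDerivAt_unique (h1.congr_of_eventuallyEq h2.symm) (hasMFDerivAt_id e)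
  have h4 : (mfderiv 𝓘(ℂ, Cn n) 𝓘(ℂ, Cn n) φ (φ.symm e) : Cn n →L[ℂ] Cn n) (dsymm φ e u) = u :=
    congrArg (fun T : Cn n →L[ℂ] Cn n => T u) h3
  rw [← h4, hu]
  exact map_zero (mfderiv 𝓘(ℂ, Cn n) 𝓘(ℂ, Cn n) φ (φ.symm e) : Cn n →L[ℂ] Cn n)

theorem dsymm_trans (U : HolCover n X) {i j : U.ι} {e : Cn n} (he : e ∈ U.overlap i j)
    (u : Cn n) :
    dsymm (U.chart j) (U.trans i j e) (fderiv ℝ (U.trans i j) e u) = dsymm (U.chart i) e u := by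
  have h1 := (hasMFDerivAt_symm (U.mem_atlas j) (U.trans_mem_overlap he).1).comp e
    (U.differentiableAt_trans he).hasFDerivAt.hasMFDerivAt
  have h2 : ((U.chart j).symm ∘ U.trans i j) =ᶠ[nhds e] (U.chart i).symm :=
    Filter.eventually_of_mem ((U.isOpen_overlap i j).mem_nhds he) fun e' he' => U.symm_trans he'
  have h3 := hasMFDerivAt_unique (h1.congr_of_eventuallyEq h2.symm)
    (hasMFDerivAt_symm (U.mem_atlas i) he.1)
  rw [U.fderiv_trans he]
  exact congrArg (fun T : Cn n →L[ℂ] Cn n => T u) h3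

namespace KahlerMetric

variable (κ : KahlerMetric n X)

/-- The metric at a point, as a bilinear form on the model space. -/
def bilin (x : X) : Cn n →ₗ[ℝ] Cn n →ₗ[ℝ] ℝ :=
  LinearMap.mk₂ ℝ (κ.g x) (κ.add_left x) (κ.smul_left x)
    (fun u v v' => (κ.symm x u _).trans ((κ.add_left x v v' u).trans
      (congrArg₂ (· + ·) (κ.symm x v u) (κ.symm x v' u))))
    (fun c u v => (κ.symm x u _).trans ((κ.smul_left x c v u).trans
      (congrArg (c * ·) (κ.symm x v u))))

/-- The metric in the coordinates of a chart, as a bilinear form. -/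
def coordForm (φ : OpenPartialHomeomorph X (Cn n)) (e : Cn n) : Cn n →ₗ[ℝ] Cn n →ₗ[ℝ] ℝ :=
  (κ.bilin (φ.symm e)).compl₁₂ ((dsymm φ e : Cn n →ₗ[ℂ] Cn n).restrictScalars ℝ)
    ((dsymm φ e : Cn n →ₗ[ℂ] Cn n).restrictScalars ℝ)

theorem coordMetric_eq (φ : OpenPartialHomeomorph X (Cn n)) (e u v : Cn n) :
    coordMetric κ.g φ e u v = κ.bilin (φ.symm e) (dsymm φ e u) (dsymm φ e v) := rfl

theorem coordMetric_trans (U : HolCover n X) {i j : U.ι} {e : Cn n} (he : e ∈ U.overlap i j)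
    (u v : Cn n) :
    coordMetric κ.g (U.chart i) e u v = coordMetric κ.g (U.chart j) (U.trans i j e)
      (fderiv ℝ (U.trans i j) e u) (fderiv ℝ (U.trans i j) e v) := by
  rw [coordMetric_eq, coordMetric_eq, dsymm_trans U he, dsymm_trans U he, U.symm_trans he]

theorem gram_eq (φ : OpenPartialHomeomorph X (Cn n)) (e : Cn n) :
    κ.gram φ e = gramMat fun u v => κ.coordForm φ e u v := rfl

theorem posDef_gram {φ : OpenPartialHomeomorph X (Cn n)}
    (hφ : φ ∈ IsManifold.maximalAtlas 𝓘(ℂ, Cn n) ∞ X) {e : Cn n} (he : e ∈ φ.target) :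
    (κ.gram φ e).PosDef := by
  rw [gram_eq]
  exact gramMat_posDef _ (fun u v => κ.symm _ _ _)
    fun u hu => κ.pos _ _ fun h => hu (dsymm_injective hφ he h)

theorem continuousOn_gram {φ : OpenPartialHomeomorph X (Cn n)}
    (hφ : φ ∈ IsManifold.maximalAtlas 𝓘(ℂ, Cn n) ∞ X) : ContinuousOn (κ.gram φ) φ.target :=
  continuousOn_pi.2 fun _ => continuousOn_pi.2 fun _ => (κ.smooth φ hφ _ _).continuousOn

/-- The Gram matrix and the matrix of `β(·, i ·)` undergo the same congruence, the second because
the differential of the coordinate change commutes with `i`. -/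
theorem contr_trans (U : HolCover n X) {i j : U.ι} {e : Cn n} (he : e ∈ U.overlap i j)
    (b : Cn n →ₗ[ℝ] Cn n →ₗ[ℝ] ℝ) {β : Cn n → Cn n → ℝ}
    (hβ : ∀ u v, β u v = b (fderiv ℝ (U.trans i j) e u) (fderiv ℝ (U.trans i j) e v)) :
    κ.contr (U.chart i) e β = κ.contr (U.chart j) (U.trans i j e) fun u v => b u v := by
  have h1 : κ.gram (U.chart i) e = _ :=
    (congrArg gramMat (funext fun u => funext fun v => κ.coordMetric_trans U he u v)).trans
    (gramMat_comp (κ.coordForm (U.chart j) (U.trans i j e)) (fderiv ℝ (U.trans i j) e))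
  let c : Cn n →ₗ[ℝ] Cn n →ₗ[ℝ] ℝ := b.compl₂ ((LinearMap.lsmul ℂ (Cn n) Complex.I).restrictScalars ℝ)
  have h2 : (Matrix.of fun k l => β (realBasis k) (Complex.I • realBasis l)) = _ :=
    (congrArg gramMat (funext fun u => funext fun v => show β u (Complex.I • v) =
      c (fderiv ℝ (U.trans i j) e u) (fderiv ℝ (U.trans i j) e v) by
        rw [hβ, U.fderiv_trans_I he]; rfl)).trans
    (gramMat_comp c (fderiv ℝ (U.trans i j) e))
  unfold contr
  rw [h1, h2, trace_inv_mul_congr (U.isUnit_det_fderiv_trans he)]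
  rfl

/-- Pointwise positivity behind nondegeneracy: if the trace is zero, the whole Gram matrix of `c` is
zero, in particular its diagonal. -/
theorem contr_nonneg {φ : OpenPartialHomeomorph X (Cn n)}
    (hφ : φ ∈ IsManifold.maximalAtlas 𝓘(ℂ, Cn n) ∞ X) {e : Cn n} (he : e ∈ φ.target)
    (c : Cn n →ₗ[ℝ] Cn n →ₗ[ℝ] ℝ) (hs : ∀ u v, c u v = c v u) (hp : ∀ u, 0 ≤ c u u)
    {β : Cn n → Cn n → ℝ} (hβ : ∀ u v, β u (Complex.I • v) = c u v) :
    0 ≤ κ.contr φ e β ∧ (κ.contr φ e β = 0 → ∀ k, c (realBasis k) (realBasis k) = 0) := by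
  have h := trace_inv_mul_nonneg (κ.posDef_gram hφ he) (gramMat_posSemidef c hs hp)
  have h1 : κ.contr φ e β = 1 / 2 * Matrix.trace ((κ.gram φ e)⁻¹ * gramMat fun u v => c u v) := by
    unfold contr
    simp only [hβ]
    rfl
  rw [h1]
  refine ⟨mul_nonneg (by norm_num) h.1, fun h0 k => ?_⟩
  have h2 := h.2 (by linarith)
  exact congrFun (congrFun h2 k) k

theorem continuousOn_contr {φ : OpenPartialHomeomorph X (Cn n)}
    (hφ : φ ∈ IsManifold.maximalAtlas 𝓘(ℂ, Cn n) ∞ X) {β : Cn n → Cn n → Cn n → ℝ}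
    (hβ : ∀ u v, ContinuousOn (fun e => β e u v) φ.target) :
    ContinuousOn (fun e => κ.contr φ e (β e)) φ.target := by
  have h1 : ContinuousOn (fun e => (κ.gram φ e)⁻¹) φ.target := by
    intro e he
    have hd : (κ.gram φ e).det ≠ 0 := (κ.posDef_gram hφ he).det_pos.ne'
    have h2 : ContinuousAt Ring.inverse (κ.gram φ e).det := by
      rw [Ring.inverse_eq_inv']
      exact continuousAt_inv₀ hd
    exact (continuousAt_matrix_inv (κ.gram φ e) h2).comp_continuousWithinAt
      (κ.continuousOn_gram hφ e he)
  unfold contr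
  refine continuousOn_const.mul ?_
  refine Continuous.comp_continuousOn (g := Matrix.trace) (by fun_prop) ?_
  refine ContinuousOn.mul h1 ?_
  exact continuousOn_pi.2 fun _ => continuousOn_pi.2 fun _ => hβ _ _

end KahlerMetric

end Charts

/-! ### The volume measure is finite and positive on nonempty open sets. -/

section Volume

open MeasureTheory

variable {n : ℕ} {X : Type*} [TopologicalSpace X] [ChartedSpace (Cn n) X]
  [CompactSpace X]

theorem closedBall_radius_subset (x : X) :
    Metric.closedBall (chartAt (Cn n) x x) (radius n X x) ⊆ (chartAt (Cn n) x).target :=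
  ((exists_coordBalls n X).choose_spec.choose_spec.1 x).2

theorem exists_mem_coordBall (y : X) : ∃ x ∈ centres n X, y ∈ coordBall n x (radius n X x) :=
  (exists_coordBalls n X).choose_spec.choose_spec.2 y

theorem isOpen_coordBall (x : X) (r : ℝ) : IsOpen (coordBall n x r) :=
  (chartAt (Cn n) x).isOpen_inter_preimage Metric.isOpen_ball

open Classical in
theorem card_coordBall_pos (y : X) :
    1 ≤ ((centres n X).filter fun z => y ∈ coordBall n z (radius n X z)).card := by
  obtain ⟨x, hx, hy⟩ := exists_mem_coordBall (n := n) y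
  exact Finset.card_pos.2 ⟨x, Finset.mem_filter.2 ⟨hx, hy⟩⟩

variable [IsManifold 𝓘(ℂ, Cn n) ∞ X] (κ : KahlerMetric n X)

theorem KahlerMetric.continuousOn_sqrt_det (x : X) : ContinuousOn
    (fun e : Cn n => ENNReal.ofReal (Real.sqrt (κ.gram (chartAt (Cn n) x) e).det))
    (chartAt (Cn n) x).target := by
  have h := κ.continuousOn_gram (IsManifold.chart_mem_maximalAtlas (I := 𝓘(ℂ, Cn n)) (n := ∞) x)
  exact ENNReal.continuous_ofReal.comp_continuousOn
    (Real.continuous_sqrt.comp_continuousOn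
      ((Continuous.matrix_det continuous_id).comp_continuousOn h))

variable [MeasurableSpace X]

instance KahlerMetric.isFiniteMeasure_vol : IsFiniteMeasure κ.vol := by
  classical
  unfold KahlerMetric.vol
  refine ⟨?_⟩
  rw [Measure.finsetSum_apply _ _ Set.univ]
  refine ENNReal.sum_lt_top.2 fun x _ => ?_
  rw [withDensity_apply _ MeasurableSet.univ, Measure.restrict_univ]
  -- Every point lies in at least one ball of the cover, so the reciprocal multiplicity is at most
  -- 1.
  refine lt_of_le_of_lt (lintegral_mono (g := fun _ => 1) fun y => ?_) ?_
  · rw [ENNReal.inv_le_one]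
    exact_mod_cast card_coordBall_pos y
  · rw [lintegral_one]
    refine lt_of_le_of_lt ?_ (b := ((volume.withDensity fun e : Cn n =>
      ENNReal.ofReal (Real.sqrt (κ.gram (chartAt (Cn n) x) e).det)).restrict
        (Metric.ball (chartAt (Cn n) x x) (radius n X x))) Set.univ) ?_
    -- An upper bound needs no measurability of the inverse chart: the pushforward is zero by
    -- convention if it fails.
    · by_cases hm : AEMeasurable (chartAt (Cn n) x).symm ((volume.withDensity fun e : Cn n =>
        ENNReal.ofReal (Real.sqrt (κ.gram (chartAt (Cn n) x) e).det)).restrict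
        (Metric.ball (chartAt (Cn n) x x) (radius n X x)))
      · rw [Measure.map_apply_of_aemeasurable hm MeasurableSet.univ, Set.preimage_univ]
      · rw [Measure.map_of_not_aemeasurable hm]
        simp
    · rw [Measure.restrict_apply_univ, withDensity_apply _ measurableSet_ball]
      -- The closed ball is compact and still inside the chart target, so `√(det g)` is bounded on
      -- it.
      obtain ⟨c, hc⟩ := (isCompact_closedBall (chartAt (Cn n) x x) (radius n X x)).bddAbove_image
        ((Real.continuous_sqrt.comp_continuousOn
          ((Continuous.matrix_det continuous_id).comp_continuousOn (κ.continuousOn_gram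
            (IsManifold.chart_mem_maximalAtlas (I := 𝓘(ℂ, Cn n)) (n := ∞) x)))).mono
              (closedBall_radius_subset x))
      refine lt_of_le_of_lt (setLIntegral_mono' (g := fun _ => ENNReal.ofReal c)
        measurableSet_ball fun e he => ENNReal.ofReal_le_ofReal ?_) ?_
      · exact hc ⟨e, Metric.ball_subset_closedBall he, rfl⟩
      · rw [setLIntegral_const]
        exact ENNReal.mul_lt_top ENNReal.ofReal_lt_top measure_ball_lt_top

/-- A null open set is null for the contribution of every ball. In a ball that meets it, its
coordinate image is a nonempty open set on which `√(det g)` is positive, a contradiction. -/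
instance KahlerMetric.isOpenPosMeasure_vol [BorelSpace X] : κ.vol.IsOpenPosMeasure := by
  classical
  refine ⟨fun O hO hne h0 => ?_⟩
  obtain ⟨y, hy⟩ := hne
  obtain ⟨x, hx, hyx⟩ := exists_mem_coordBall (n := n) y
  have h1 : κ.vol O = _ := Measure.finsetSum_apply _ _ O
  rw [h1, Finset.sum_eq_zero_iff] at h0
  have h2 := h0 x hx
  set φ := chartAt (Cn n) x with hφ
  have hb : Metric.ball (φ x) (radius n X x) ⊆ φ.target :=
    Metric.ball_subset_closedBall.trans (closedBall_radius_subset x)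
  rw [withDensity_apply_eq_zero' (by
    refine (Measurable.inv ?_).aemeasurable
    have : ∀ y : X, (((centres n X).filter fun z => y ∈ coordBall n z (radius n X z)).card : ENNReal)
        = ∑ z ∈ centres n X, (coordBall n z (radius n X z)).indicator (fun _ => (1 : ENNReal)) y := by
      intro y
      rw [Finset.card_filter]
      push_cast
      refine Finset.sum_congr rfl fun z _ => ?_
      rw [Set.indicator_apply]
    simp_rw [this]
    exact Finset.measurable_fun_sum _ fun z _ =>
      measurable_const.indicator (isOpen_coordBall z _).measurableSet)] at h2
  -- The multiplicity is finite, so its reciprocal never vanishes and the density does not enlarge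
  -- the null sets.
  have h3 : {y : X | ((((centres n X).filter fun z =>
      y ∈ coordBall n z (radius n X z)).card : ℕ) : ENNReal)⁻¹ ≠ 0} ∩ O = O := by
    refine Set.inter_eq_right.2 fun y _ => ?_
    exact ENNReal.inv_ne_zero.2 (ENNReal.natCast_ne_top _)
  rw [h3, Measure.map_apply_of_aemeasurable ?_ hO.measurableSet] at h2
  · have hopen : IsOpen (Metric.ball (φ x) (radius n X x) ∩ φ.symm ⁻¹' O) :=
      (φ.symm.continuousOn.mono hb).isOpen_inter_preimage Metric.isOpen_ball hO
    rw [Measure.restrict_apply' measurableSet_ball, Set.inter_comm,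
      withDensity_apply _ hopen.measurableSet] at h2
    have hmeas : AEMeasurable (fun e : Cn n => ENNReal.ofReal (Real.sqrt (κ.gram φ e).det))
        (volume.restrict (Metric.ball (φ x) (radius n X x) ∩ φ.symm ⁻¹' O)) :=
      ((κ.continuousOn_sqrt_det x).mono (Set.inter_subset_left.trans hb)).aemeasurable
        hopen.measurableSet
    rw [lintegral_eq_zero_iff' hmeas] at h2
    -- Almost everywhere `√(det g) = 0`, yet the Gram matrix is positive definite; so Lebesgue
    -- measure restricted to this open set is zero.
    have h4 : ∀ᵐ e ∂(volume.restrict (Metric.ball (φ x) (radius n X x) ∩ φ.symm ⁻¹' O)), False := by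
      filter_upwards [h2, ae_restrict_mem hopen.measurableSet] with e he hmem
      have hpos := (κ.posDef_gram (IsManifold.chart_mem_maximalAtlas (I := 𝓘(ℂ, Cn n)) (n := ∞) x)
        (hb hmem.1)).det_pos
      have := ENNReal.ofReal_eq_zero.1 he
      exact absurd (Real.sqrt_pos.2 hpos) (not_lt.2 this)
    rw [ae_iff] at h4
    simp only [not_false_eq_true, Set.ofPred_true, Measure.restrict_apply_univ] at h4
    refine hopen.measure_ne_zero volume ⟨φ y, hyx.2, ?_⟩ h4
    show φ.symm (φ y) ∈ O
    rwa [φ.left_inv hyx.1]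
  · have := (φ.symm.continuousOn.mono hb).aemeasurable (μ := volume.withDensity fun e : Cn n =>
      ENNReal.ofReal (Real.sqrt (κ.gram φ e).det)) measurableSet_ball
    exact this

theorem KahlerMetric.integrable_of_continuous [BorelSpace X] {f : X → ℝ} (hf : Continuous f) :
    Integrable f κ.vol :=
  hf.integrable_of_hasCompactSupport (HasCompactSupport.of_compactSpace f)

theorem KahlerMetric.eq_zero_of_integral_eq_zero [BorelSpace X] {f : X → ℝ} (hf : Continuous f)
    (h0 : ∀ x, 0 ≤ f x) (hi : ∫ x, f x ∂κ.vol = 0) (x : X) : f x = 0 := by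
  have h1 := (integral_eq_zero_iff_of_nonneg h0 (κ.integrable_of_continuous hf)).1 hi
  exact congrFun (Continuous.ae_eq_iff_eq κ.vol hf continuous_const |>.1 h1) x

end Volume

theorem fderiv_clm_comp {E F F' : Type*} [NormedAddCommGroup E] [NormedSpace ℝ E]
    [NormedAddCommGroup F] [NormedSpace ℝ F] [NormedAddCommGroup F'] [NormedSpace ℝ F']
    (L : F →L[ℝ] F') {f : E → F} {e : E} (hf : DifferentiableAt ℝ f e) (u : E) :
    fderiv ℝ (fun e' => L (f e')) e u = L (fderiv ℝ f e u) := by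
  have h : HasFDerivAt (fun e' => L (f e')) (L.comp (fderiv ℝ f e)) e :=
    L.hasFDerivAt.comp e hf.hasFDerivAt
  rw [h.fderiv]
  rfl

/-! ### Traces -/

section TraceForms

variable {W W₁ W₂ N : Type*}
  [NormedAddCommGroup W] [InnerProductSpace ℂ W] [FiniteDimensional ℂ W]
  [NormedAddCommGroup W₁] [InnerProductSpace ℂ W₁] [FiniteDimensional ℂ W₁]
  [NormedAddCommGroup W₂] [InnerProductSpace ℂ W₂]
  [NormedAddCommGroup N] [InnerProductSpace ℂ N] [FiniteDimensional ℂ N]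

variable (W) in
/-- The complex trace as a linear functional on continuous endomorphisms. -/
def traceL : (W →L[ℂ] W) →ₗ[ℂ] ℂ :=
  (LinearMap.trace ℂ W).comp (ContinuousLinearMap.coeLM ℂ)

theorem traceL_apply (T : W →L[ℂ] W) : traceL W T = LinearMap.trace ℂ W (T : W →ₗ[ℂ] W) := rfl

theorem re_traceL_smul (r : ℝ) (T : W →L[ℂ] W) :
    (traceL W (r • T)).re = r * (traceL W T).re := by
  rw [← Complex.coe_smul, map_smul, smul_eq_mul, Complex.re_ofReal_mul]

theorem traceL_mul_comm (S T : W →L[ℂ] W) : traceL W (S * T) = traceL W (T * S) :=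
  LinearMap.trace_mul_comm ℂ (S : W →ₗ[ℂ] W) (T : W →ₗ[ℂ] W)

theorem continuous_traceL : Continuous (traceL W) :=
  LinearMap.continuous_of_finiteDimensional _

/-- Gauge invariance of `tr (ST)`, for a cocycle value `g` and its inverse `g'`. -/
theorem traceL_conj {g g' S T : W →L[ℂ] W} (h : g' * g = 1) :
    traceL W (g * S * g' * (g * T * g')) = traceL W (S * T) := by
  have h1 : g * S * g' * (g * T * g') = g * (S * (g' * g) * T * g') := by simp only [mul_assoc]
  rw [h1, traceL_mul_comm, h, mul_one, mul_assoc, h, mul_one]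

/-- Since `T^* = -T`, the trace of `T²` is minus the squared Hilbert–Schmidt norm. -/
theorem re_traceL_sq {T : W →L[ℂ] W} (hT : T ∈ unitaryLie W) :
    (traceL W (T * T)).re = -∑ l, ‖T (stdOrthonormalBasis ℂ W l)‖ ^ 2 := by
  rw [traceL_apply, LinearMap.trace_eq_sum_inner _ (stdOrthonormalBasis ℂ W), Complex.re_sum,
    ← Finset.sum_neg_distrib]
  refine Finset.sum_congr rfl fun l _ => ?_
  set w := stdOrthonormalBasis ℂ W l
  have h : inner ℂ w (T (T w)) = -inner ℂ (T w) (T w) := by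
    rw [eq_neg_iff_add_eq_zero, add_comm]
    exact hT w (T w)
  show (inner ℂ w (T (T w))).re = _
  rw [h, inner_self_eq_norm_sq_to_K]
  norm_cast

theorem re_traceL_sq_nonpos {T : W →L[ℂ] W} (hT : T ∈ unitaryLie W) :
    (traceL W (T * T)).re ≤ 0 := by
  rw [re_traceL_sq hT]
  exact neg_nonpos.2 (Finset.sum_nonneg fun _ _ => sq_nonneg _)

theorem eq_zero_of_re_traceL_sq {T : W →L[ℂ] W} (hT : T ∈ unitaryLie W)
    (h : (traceL W (T * T)).re = 0) : T = 0 := by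
  rw [re_traceL_sq hT, neg_eq_zero,
    Finset.sum_eq_zero_iff_of_nonneg fun _ _ => sq_nonneg _] at h
  refine ContinuousLinearMap.coe_injective ((stdOrthonormalBasis ℂ W).toBasis.ext fun l => ?_)
  rw [OrthonormalBasis.coe_toBasis]
  simpa using h l (Finset.mem_univ l)

/-- Basis independence of the trace of a sesquilinear form: expand `b'` in `b`, and sum over `b'` by
Parseval. Applied in each variable it frees `hermTrace` from the standard bases. -/
theorem sum_sesq_eq (s : N →ₗ⋆[ℂ] N →ₗ[ℂ] ℂ) {ι ι' : Type*} [Fintype ι] [Fintype ι']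
    (b : OrthonormalBasis ι ℂ N) (b' : OrthonormalBasis ι' ℂ N) :
    ∑ k, s (b k) (b k) = ∑ k, s (b' k) (b' k) := by
  have h : ∀ k, s (b' k) (b' k) =
      ∑ j, ∑ l, inner ℂ (b l) (b' k) * inner ℂ (b' k) (b j) * s (b j) (b l) := by
    intro k
    conv_lhs => rw [← b.sum_repr' (b' k)]
    simp only [map_sum, map_smulₛₗ, LinearMap.sum_apply, LinearMap.smul_apply, smul_eq_mul,
      inner_conj_symm, Finset.mul_sum, RingHom.id_apply]
    rw [Finset.sum_comm]
    refine Finset.sum_congr rfl fun j _ => Finset.sum_congr rfl fun l _ => ?_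
    ring
  simp only [h]
  rw [Finset.sum_comm]
  refine Finset.sum_congr rfl fun j _ => ?_
  rw [Finset.sum_comm]
  simp only [← Finset.sum_mul, OrthonormalBasis.sum_inner_mul_inner]
  classical
  rw [Finset.sum_eq_single j (fun l _ hl => by
    rw [orthonormal_iff_ite.1 b.orthonormal l j, if_neg hl, zero_mul]) (by simp)]
  rw [orthonormal_iff_ite.1 b.orthonormal j j, if_pos rfl, one_mul]

theorem sum_inner_eq (A B : W₁ →L[ℂ] W₂) {ι ι' : Type*} [Fintype ι] [Fintype ι']
    (b : OrthonormalBasis ι ℂ W₁) (b' : OrthonormalBasis ι' ℂ W₁) :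
    ∑ k, inner ℂ (A (b k)) (B (b k)) = ∑ k, inner ℂ (A (b' k)) (B (b' k)) :=
  sum_sesq_eq (LinearMap.mk₂'ₛₗ (starRingEnd ℂ) (RingHom.id ℂ) (fun v w => inner ℂ (A v) (B w))
    (fun _ _ _ => by rw [map_add, inner_add_left]) (fun _ _ _ => by rw [map_smul, inner_smul_left]; rfl)
    (fun _ _ _ => by rw [map_add, inner_add_right])
    (fun _ _ _ => by rw [map_smul, inner_smul_right]; rfl)) b b'

theorem hermTrace_eq (φ ψ : N →L[ℂ] (W₁ →L[ℂ] W₂)) {ι ι' : Type*} [Fintype ι] [Fintype ι']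
    (b : OrthonormalBasis ι ℂ N) (b' : OrthonormalBasis ι' ℂ W₁) :
    hermTrace φ ψ = ∑ k, ∑ l, inner ℂ (φ (b k) (b' l)) (ψ (b k) (b' l)) := by
  have h := sum_sesq_eq (LinearMap.mk₂'ₛₗ (starRingEnd ℂ) (RingHom.id ℂ)
    (fun v w => ∑ l, inner ℂ (φ v (b' l)) (ψ w (b' l)))
    (fun _ _ _ => by
      rw [← Finset.sum_add_distrib]
      exact Finset.sum_congr rfl fun l _ => by rw [map_add, add_apply, inner_add_left])
    (fun _ _ _ => by
      rw [Finset.smul_sum]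
      exact Finset.sum_congr rfl fun l _ => by rw [map_smul, smul_apply, inner_smul_left]; rfl)
    (fun _ _ _ => by
      rw [← Finset.sum_add_distrib]
      exact Finset.sum_congr rfl fun l _ => by rw [map_add, add_apply, inner_add_right])
    (fun _ _ _ => by
      rw [Finset.smul_sum]
      exact Finset.sum_congr rfl fun l _ => by rw [map_smul, smul_apply, inner_smul_right]; rfl))
    (stdOrthonormalBasis ℂ N) b
  refine Eq.trans (Finset.sum_congr rfl fun k _ => sum_inner_eq _ _ _ b') h

theorem hermTrace_add_left (φ φ' ψ : N →L[ℂ] (W₁ →L[ℂ] W₂)) :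
    hermTrace (φ + φ') ψ = hermTrace φ ψ + hermTrace φ' ψ := by
  simp only [hermTrace, add_apply, inner_add_left, Finset.sum_add_distrib]

theorem hermTrace_add_right (φ ψ ψ' : N →L[ℂ] (W₁ →L[ℂ] W₂)) :
    hermTrace φ (ψ + ψ') = hermTrace φ ψ + hermTrace φ ψ' := by
  simp only [hermTrace, add_apply, inner_add_right, Finset.sum_add_distrib]

theorem hermTrace_smul_left (r : ℝ) (φ ψ : N →L[ℂ] (W₁ →L[ℂ] W₂)) :
    hermTrace (r • φ) ψ = r * hermTrace φ ψ := by
  simp only [hermTrace, smul_apply, ← Complex.coe_smul r, inner_smul_left, Finset.mul_sum,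
    Complex.conj_ofReal]

theorem hermTrace_smul_right (c : ℂ) (φ ψ : N →L[ℂ] (W₁ →L[ℂ] W₂)) :
    hermTrace φ (c • ψ) = c * hermTrace φ ψ := by
  simp only [hermTrace, smul_apply, inner_smul_right, Finset.mul_sum]

theorem hermTrace_self (φ : N →L[ℂ] (W₁ →L[ℂ] W₂)) :
    hermTrace φ φ = ((∑ k, ∑ l, ‖φ (stdOrthonormalBasis ℂ N k) (stdOrthonormalBasis ℂ W₁ l)‖ ^ 2 :
      ℝ) : ℂ) := by
  simp only [hermTrace, inner_self_eq_norm_sq_to_K]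
  push_cast
  rfl

theorem hermTrace_self_re_nonneg (φ : N →L[ℂ] (W₁ →L[ℂ] W₂)) : 0 ≤ (hermTrace φ φ).re := by
  rw [hermTrace_self, Complex.ofReal_re]
  positivity

theorem hermTrace_self_im (φ : N →L[ℂ] (W₁ →L[ℂ] W₂)) : (hermTrace φ φ).im = 0 := by
  rw [hermTrace_self, Complex.ofReal_im]

theorem eq_zero_of_hermTrace_self {φ : N →L[ℂ] (W₁ →L[ℂ] W₂)} (h : (hermTrace φ φ).re = 0) :
    φ = 0 := by
  rw [hermTrace_self, Complex.ofReal_re,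
    Finset.sum_eq_zero_iff_of_nonneg fun _ _ => Finset.sum_nonneg fun _ _ => sq_nonneg _] at h
  refine ContinuousLinearMap.coe_injective ((stdOrthonormalBasis ℂ N).toBasis.ext fun k => ?_)
  refine ContinuousLinearMap.coe_injective ((stdOrthonormalBasis ℂ W₁).toBasis.ext fun l => ?_)
  have h1 := h k (Finset.mem_univ k)
  rw [Finset.sum_eq_zero_iff_of_nonneg fun _ _ => sq_nonneg _] at h1
  simpa using h1 l (Finset.mem_univ l)

/-- A unitary endomorphism carries an orthonormal basis to an orthonormal basis. -/
theorem exists_orthonormalBasis_of_unitary {T : N →L[ℂ] N} (hT : T ∈ unitaryGroup N)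
    {ι : Type*} [Fintype ι] (b : OrthonormalBasis ι ℂ N) :
    ∃ b' : OrthonormalBasis ι ℂ N, ∀ k, b' k = T (b k) :=
  ⟨b.map (((T : N →ₗ[ℂ] N).isometryOfInner hT).toLinearIsometryEquiv rfl), fun k => by
    rw [OrthonormalBasis.map_apply]
    rfl⟩

/-- The unitary maps `f` and `g₁` merely replace the orthonormal bases by others, and `g₂` preserves
the inner product of the values. -/
theorem hermTrace_gauge {φ ψ φ' ψ' : N →L[ℂ] (W₁ →L[ℂ] W₂)} {f : N →L[ℂ] N} {g₁ : W₁ →L[ℂ] W₁}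
    {g₂ : W₂ →L[ℂ] W₂} (hf : f ∈ unitaryGroup N) (h₁ : g₁ ∈ unitaryGroup W₁)
    (h₂ : g₂ ∈ unitaryGroup W₂) (hφ : ∀ m, (φ (f m)).comp g₁ = g₂.comp (φ' m))
    (hψ : ∀ m, (ψ (f m)).comp g₁ = g₂.comp (ψ' m)) : hermTrace φ ψ = hermTrace φ' ψ' := by
  obtain ⟨b, hb⟩ := exists_orthonormalBasis_of_unitary hf (stdOrthonormalBasis ℂ N)
  obtain ⟨b', hb'⟩ := exists_orthonormalBasis_of_unitary h₁ (stdOrthonormalBasis ℂ W₁)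
  rw [hermTrace_eq φ ψ b b']
  refine Finset.sum_congr rfl fun k _ => Finset.sum_congr rfl fun l _ => ?_
  rw [hb, hb']
  have e1 := congrArg (fun T => T (stdOrthonormalBasis ℂ W₁ l)) (hφ (stdOrthonormalBasis ℂ N k))
  have e2 := congrArg (fun T => T (stdOrthonormalBasis ℂ W₁ l)) (hψ (stdOrthonormalBasis ℂ N k))
  simp only [ContinuousLinearMap.comp_apply] at e1 e2
  rw [e1, e2, h₂]

end TraceForms

/-! ### Integrands -/

section Integrands

variable {n : ℕ} {X : Type*} [TopologicalSpace X] [ChartedSpace (Cn n) X]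
  {U : HolCover n X}

theorem HolCover.idx_mem (U : HolCover n X) (x : X) : x ∈ (U.chart (U.idx x)).source :=
  (U.cover x).choose_spec

theorem HolCover.mem_overlap (U : HolCover n X) {i j : U.ι} {x : X}
    (hi : x ∈ (U.chart i).source) (hj : x ∈ (U.chart j).source) :
    U.chart i x ∈ U.overlap i j := by
  refine ⟨(U.chart i).map_source hi, ?_⟩
  show (U.chart i).symm (U.chart i x) ∈ (U.chart j).source
  rwa [(U.chart i).left_inv hi]

theorem HolCover.trans_chart (U : HolCover n X) {i j : U.ι} {x : X}
    (hi : x ∈ (U.chart i).source) : U.trans i j (U.chart i x) = U.chart j x := by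
  rw [HolCover.trans, (U.chart i).left_inv hi]

/-- Local continuous functions that agree on the overlaps glue to a continuous function. -/
theorem HolCover.continuous_glue (U : HolCover n X) {h : U.ι → Cn n → ℝ}
    (hc : ∀ i, ContinuousOn (h i) (U.chart i).target)
    (ht : ∀ i j, ∀ e ∈ U.overlap i j, h i e = h j (U.trans i j e)) :
    Continuous fun x => h (U.idx x) (U.chart (U.idx x) x) := by
  refine continuous_iff_continuousAt.2 fun x => ?_
  set i := U.idx x
  have hx : x ∈ (U.chart i).source := U.idx_mem x
  -- The chosen index jumps as the point moves, but near `x` the fixed chart `i` gives the same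
  -- values.
  have h1 : ContinuousAt (fun y => h i (U.chart i y)) x :=
    ((hc i).continuousAt ((U.chart i).open_target.mem_nhds ((U.chart i).map_source hx))).comp
      ((U.chart i).continuousAt hx)
  refine h1.congr (Filter.eventually_of_mem ((U.chart i).open_source.mem_nhds hx) fun y hy => ?_)
  show h i (U.chart i y) = _
  rw [ht i (U.idx y) _ (U.mem_overlap hy (U.idx_mem y)), U.trans_chart hy]

namespace KahlerMetric

variable (κ : KahlerMetric n X) (φ : OpenPartialHomeomorph X (Cn n)) (e : Cn n)

theorem contr_add (β γ : Cn n → Cn n → ℝ) :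
    κ.contr φ e (fun u v => β u v + γ u v) = κ.contr φ e β + κ.contr φ e γ := by
  unfold contr
  rw [← mul_add, ← Matrix.trace_add, ← Matrix.mul_add]
  rfl

theorem contr_smul (r : ℝ) (β : Cn n → Cn n → ℝ) :
    κ.contr φ e (fun u v => r * β u v) = r * κ.contr φ e β := by
  unfold contr
  have : (Matrix.of fun k l => r * β (realBasis k) (Complex.I • realBasis l)) =
      r • Matrix.of fun k l => β (realBasis k) (Complex.I • realBasis l) := rfl
  rw [this, Matrix.mul_smul, Matrix.trace_smul, smul_eq_mul]
  ring

end KahlerMetric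

theorem HolCover.symm_mem_source (U : HolCover n X) {i j : U.ι} {e : Cn n}
    (he : e ∈ U.overlap i j) : (U.chart i).symm e ∈ (U.chart i).source :=
  (U.chart i).map_target he.1

theorem PrincipalBundle.tr_mul_tr {W : Type*} [NormedAddCommGroup W] [InnerProductSpace ℂ W]
    {K : Set (W →L[ℂ] W)} (P : PrincipalBundle U W K) {i j : U.ι} {x : X}
    (hi : x ∈ (U.chart i).source) (hj : x ∈ (U.chart j).source) : P.tr i j x * P.tr j i x = 1 := by
  rw [P.cocycle i j i x ⟨⟨hi, hj⟩, hi⟩, P.one i x hi]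

/-! ### The Atiyah–Bott integrand, its gauge invariance, and positivity against the complex
structure. -/

section AB

variable {W : Type*} [NormedAddCommGroup W] [InnerProductSpace ℂ W] [FiniteDimensional ℂ W]

/-- The 2-form `-Re tr (a ∧ b)`. -/
def wedgeTrace (a b : Cn n →L[ℝ] (W →L[ℂ] W)) : Cn n →ₗ[ℝ] Cn n →ₗ[ℝ] ℝ :=
  LinearMap.mk₂ ℝ (fun u v => -(traceL W (a u * b v)).re + (traceL W (a v * b u)).re)
    (fun u u' v => by simp only [map_add, add_mul, mul_add, Complex.add_re]; ring)
    (fun c u v => by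
      simp only [map_smul, smul_mul_assoc, mul_smul_comm, re_traceL_smul,
        smul_eq_mul]
      ring)
    (fun u v v' => by simp only [map_add, add_mul, mul_add, Complex.add_re]; ring)
    (fun c u v => by
      simp only [map_smul, smul_mul_assoc, mul_smul_comm, re_traceL_smul,
        smul_eq_mul]
      ring)

theorem wedgeTrace_apply (a b : Cn n →L[ℝ] (W →L[ℂ] W)) (u v : Cn n) :
    wedgeTrace a b u v = -(traceL W (a u * b v)).re + (traceL W (a v * b u)).re := rfl

theorem wedgeTrace_self (a : Cn n →L[ℝ] (W →L[ℂ] W)) (u v : Cn n) : wedgeTrace a a u v = 0 := by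
  rw [wedgeTrace_apply, traceL_mul_comm]
  ring

/-- The endomorphism `u ↦ -iu` of `ℂⁿ`. -/
def negI (n : ℕ) : Cn n →L[ℝ] Cn n :=
  ((-Complex.I) • ContinuousLinearMap.id ℂ (Cn n)).restrictScalars ℝ

theorem negI_apply (u : Cn n) : negI n u = (-Complex.I) • u := rfl

/-- The symmetric form `(u, v) ↦ (a ∧ a(-i ·)) (u, iv)`. -/
def wedgeRot (a : Cn n →L[ℝ] (W →L[ℂ] W)) : Cn n →ₗ[ℝ] Cn n →ₗ[ℝ] ℝ :=
  (wedgeTrace a (a.comp (negI n))).compl₂ ((LinearMap.lsmul ℂ (Cn n) Complex.I).restrictScalars ℝ)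

theorem wedgeRot_eq (a : Cn n →L[ℝ] (W →L[ℂ] W)) (u v : Cn n) :
    wedgeTrace a (a.comp (negI n)) u (Complex.I • v) = wedgeRot a u v := rfl

/-- The rotation is by `-i` so that `(-i)(iv) = v`: both terms become minus a trace of a product of
values of `a`, hence nonnegative on the diagonal for skew-hermitian values. -/
theorem wedgeRot_apply (a : Cn n →L[ℝ] (W →L[ℂ] W)) (u v : Cn n) :
    wedgeRot a u v = -(traceL W (a u * a v)).re -
      (traceL W (a (Complex.I • v) * a (Complex.I • u))).re := by
  rw [← wedgeRot_eq, wedgeTrace_apply, ContinuousLinearMap.comp_apply,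
    ContinuousLinearMap.comp_apply, negI_apply, negI_apply, smul_smul, neg_mul, Complex.I_mul_I,
    neg_neg, one_smul, neg_smul, map_neg, mul_neg, map_neg, Complex.neg_re]
  ring

theorem wedgeRot_symm (a : Cn n →L[ℝ] (W →L[ℂ] W)) (u v : Cn n) :
    wedgeRot a u v = wedgeRot a v u := by
  rw [wedgeRot_apply, wedgeRot_apply, traceL_mul_comm, traceL_mul_comm (a (Complex.I • v))]

theorem wedgeRot_nonneg {a : Cn n →L[ℝ] (W →L[ℂ] W)} (ha : ∀ u, a u ∈ unitaryLie W) (u : Cn n) :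
    0 ≤ wedgeRot a u u ∧ (wedgeRot a u u = 0 → a u = 0) := by
  have h1 := re_traceL_sq_nonpos (ha u)
  have h2 := re_traceL_sq_nonpos (ha (Complex.I • u))
  rw [wedgeRot_apply]
  exact ⟨by linarith, fun h => eq_zero_of_re_traceL_sq (ha u) (by linarith)⟩

variable [CompactSpace X] [MeasurableSpace X] (κ : KahlerMetric n X)

/-- The integrand of the Atiyah–Bott form in a chart. -/
def abIntegrand (a b : LocForm U W) (i : U.ι) (e : Cn n) : ℝ :=
  κ.contr (U.chart i) e fun u v => wedgeTrace (a i e) (b i e) u v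

theorem atiyahBott_eq (a b : LocForm U W) : atiyahBott κ a b =
    ∫ x, abIntegrand κ a b (U.idx x) (U.chart (U.idx x) x) ∂κ.vol := rfl

theorem abIntegrand_add_left (a a' b : LocForm U W) (i : U.ι) (e : Cn n) :
    abIntegrand κ (a + a') b i e = abIntegrand κ a b i e + abIntegrand κ a' b i e := by
  unfold abIntegrand
  rw [← κ.contr_add]
  congr 1
  funext u v
  have : (a + a') i e = a i e + a' i e := rfl
  simp only [wedgeTrace_apply, this, add_apply, add_mul, map_add, Complex.add_re]
  ring

theorem abIntegrand_add_right (a b b' : LocForm U W) (i : U.ι) (e : Cn n) :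
    abIntegrand κ a (b + b') i e = abIntegrand κ a b i e + abIntegrand κ a b' i e := by
  unfold abIntegrand
  rw [← κ.contr_add]
  congr 1
  funext u v
  have : (b + b') i e = b i e + b' i e := rfl
  simp only [wedgeTrace_apply, this, add_apply, mul_add, map_add, Complex.add_re]
  ring

theorem abIntegrand_smul_left (r : ℝ) (a b : LocForm U W) (i : U.ι) (e : Cn n) :
    abIntegrand κ (r • a) b i e = r * abIntegrand κ a b i e := by
  unfold abIntegrand
  rw [← κ.contr_smul]
  congr 1
  funext u v
  have : (r • a) i e = r • a i e := rfl
  simp only [wedgeTrace_apply, this, smul_apply, smul_mul_assoc, re_traceL_smul]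
  ring

theorem abIntegrand_smul_right (r : ℝ) (a b : LocForm U W) (i : U.ι) (e : Cn n) :
    abIntegrand κ a (r • b) i e = r * abIntegrand κ a b i e := by
  unfold abIntegrand
  rw [← κ.contr_smul]
  congr 1
  funext u v
  have : (r • b) i e = r • b i e := rfl
  simp only [wedgeTrace_apply, this, smul_apply, mul_smul_comm, re_traceL_smul]
  ring

theorem atiyahBott_smul_left (r : ℝ) (a b : LocForm U W) :
    atiyahBott κ (r • a) b = r * atiyahBott κ a b := by
  simp only [atiyahBott_eq, abIntegrand_smul_left, MeasureTheory.integral_const_mul]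

theorem atiyahBott_smul_right (r : ℝ) (a b : LocForm U W) :
    atiyahBott κ a (r • b) = r * atiyahBott κ a b := by
  simp only [atiyahBott_eq, abIntegrand_smul_right, MeasureTheory.integral_const_mul]

theorem atiyahBott_self (a : LocForm U W) : atiyahBott κ a a = 0 := by
  have h : ∀ i e, abIntegrand κ a a i e = 0 := fun i e => by
    unfold abIntegrand
    -- Homogeneity with factor 0 says that the contraction of the zero form is 0.
    have := κ.contr_smul (U.chart i) e 0 fun _ _ => 0
    simp only [wedgeTrace_self]
    simpa using this
  simp only [atiyahBott_eq, h, MeasureTheory.integral_zero]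

variable {K : Set (W →L[ℂ] W)} {P : PrincipalBundle U W K} {𝔨 : Set (W →L[ℂ] W)}

theorem IsAdForm.eq_conj {a : LocForm U W} (ha : IsAdForm P 𝔨 a) {i j : U.ι} {e : Cn n}
    (he : e ∈ U.overlap i j) (u : Cn n) :
    a i e u = P.tr i j ((U.chart i).symm e) *
      a j (U.trans i j e) (fderiv ℝ (U.trans i j) e u) * P.tr j i ((U.chart i).symm e) := by
  rw [ha.gauge i j e he u, mul_assoc, P.tr_mul_tr (U.symm_mem_source he) he.2, mul_one]

/-- Between charts the values of adjoint forms are conjugated by the cocycle, which the trace does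
not see; only the change of coordinates remains. -/
theorem IsAdForm.wedgeTrace_trans {a b : LocForm U W} (ha : IsAdForm P 𝔨 a) (hb : IsAdForm P 𝔨 b)
    {i j : U.ι} {e : Cn n} (he : e ∈ U.overlap i j) (u v : Cn n) :
    wedgeTrace (a i e) (b i e) u v = wedgeTrace (a j (U.trans i j e)) (b j (U.trans i j e))
      (fderiv ℝ (U.trans i j) e u) (fderiv ℝ (U.trans i j) e v) := by
  have h := P.tr_mul_tr he.2 (U.symm_mem_source he)
  rw [wedgeTrace_apply, wedgeTrace_apply, ha.eq_conj he u, ha.eq_conj he v, hb.eq_conj he u,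
    hb.eq_conj he v, traceL_conj h, traceL_conj h]

variable [IsManifold 𝓘(ℂ, Cn n) ∞ X]

/-- Continuity gives integrability on the compact base, hence additivity of the form, and later the
vanishing of nonnegative integrands with zero integral. -/
theorem continuous_abIntegrand {a b : LocForm U W} (ha : IsAdForm P 𝔨 a) (hb : IsAdForm P 𝔨 b) :
    Continuous fun x => abIntegrand κ a b (U.idx x) (U.chart (U.idx x) x) := by
  refine U.continuous_glue (h := abIntegrand κ a b) (fun i => ?_) fun i j e he => ?_
  · refine κ.continuousOn_contr (U.mem_atlas i) fun u v => ?_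
    have h1 : ∀ {c : LocForm U W}, IsAdForm P 𝔨 c → ∀ u,
        ContinuousOn (fun e => c i e u) (U.chart i).target := fun hc u =>
      (hc.smooth i).continuousOn.clm_apply continuousOn_const
    simp only [wedgeTrace_apply]
    have h2 : ∀ u v, ContinuousOn (fun e => (traceL W (a i e u * b i e v)).re)
        (U.chart i).target := fun u v =>
      (Complex.continuous_re.comp continuous_traceL).comp_continuousOn ((h1 ha u).mul (h1 hb v))
    exact (h2 u v).neg.add (h2 v u)
  · exact κ.contr_trans U he _ (ha.wedgeTrace_trans hb he)

variable [BorelSpace X]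

theorem atiyahBott_add_left {a a' b : LocForm U W} (ha : IsAdForm P 𝔨 a) (ha' : IsAdForm P 𝔨 a')
    (hb : IsAdForm P 𝔨 b) : atiyahBott κ (a + a') b = atiyahBott κ a b + atiyahBott κ a' b := by
  simp only [atiyahBott_eq, abIntegrand_add_left]
  exact MeasureTheory.integral_add
    (κ.integrable_of_continuous (continuous_abIntegrand κ ha hb))
    (κ.integrable_of_continuous (continuous_abIntegrand κ ha' hb))

theorem atiyahBott_add_right {a b b' : LocForm U W} (ha : IsAdForm P 𝔨 a) (hb : IsAdForm P 𝔨 b)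
    (hb' : IsAdForm P 𝔨 b') :
    atiyahBott κ a (b + b') = atiyahBott κ a b + atiyahBott κ a b' := by
  simp only [atiyahBott_eq, abIntegrand_add_right]
  exact MeasureTheory.integral_add
    (κ.integrable_of_continuous (continuous_abIntegrand κ ha hb))
    (κ.integrable_of_continuous (continuous_abIntegrand κ ha hb'))

/-- The complex structure `a ↦ a(-i ·)` on 1-forms. -/
def rotForm (a : LocForm U W) : LocForm U W := fun i e => (a i e).comp (negI n)

theorem rotForm_apply (a : LocForm U W) (i : U.ι) (e u : Cn n) :
    rotForm a i e u = a i e ((-Complex.I) • u) := rfl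

theorem IsAdForm.rot {a : LocForm U W} (ha : IsAdForm P 𝔨 a) : IsAdForm P 𝔨 (rotForm a) where
  zero_off i e he := by
    rw [rotForm, ha.zero_off i e he]
    rfl
  mem_lie i e u := ha.mem_lie i e _
  smooth i := (ContDiffOn.clm_comp (ha.smooth i) contDiffOn_const)
  gauge i j e he u := by
    have h : fderiv ℝ (U.trans i j) e ((-Complex.I) • u) =
        (-Complex.I) • fderiv ℝ (U.trans i j) e u := by
      rw [neg_smul, map_neg, U.fderiv_trans_I he, neg_smul]
    have := ha.gauge i j e he ((-Complex.I) • u)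
    rw [h] at this
    exact this

/-- The `(0,2)`-part of `d_A a` is `∂̄_A` of the `(0,1)`-part of `a`, and the rotation multiplies
that part by a constant; likewise for `(2,0)`. So the rotated form stays tangent to `𝒜^{1,1}`. -/
theorem IsAdForm.type11_rot {a A : LocForm U W} (ha : IsAdForm P 𝔨 a)
    (h : IsType11 (covExtDeriv A a)) : IsType11 (covExtDeriv A (rotForm a)) := by
  intro i e he u v
  have hd : DifferentiableAt ℝ (a i) e :=
    ((ha.smooth i).contDiffAt ((U.chart i).open_target.mem_nhds he)).differentiableAt (by simp)
  have hf : ∀ u v, fderiv ℝ (rotForm a i) e u v = fderiv ℝ (a i) e u ((-Complex.I) • v) := by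
    intro u v
    let L := (ContinuousLinearMap.compL ℝ (Cn n) (Cn n) (W →L[ℂ] W)).flip (negI n)
    have h2 := fderiv_clm_comp (F := Cn n →L[ℝ] (W →L[ℂ] W)) (F' := Cn n →L[ℝ] (W →L[ℂ] W)) L
      (f := a i) hd u
    exact congrArg (fun T => T v) h2
  -- The condition for `a` at `(u, iv)` is, up to sign, the condition for the rotated form at `(u,
  -- v)`.
  have h1 := h i e he u (Complex.I • v)
  have hI : ∀ w : Cn n, Complex.I • Complex.I • w = -w := fun w => by
    rw [smul_smul, Complex.I_mul_I, neg_one_smul]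
  have hI' : ∀ w : Cn n, (-Complex.I) • Complex.I • w = w := fun w => by
    rw [smul_smul, neg_mul, Complex.I_mul_I, neg_neg, one_smul]
  simp only [covExtDeriv, hI, map_neg, neg_apply, mul_neg, neg_mul, sub_neg_eq_add] at h1
  simp only [covExtDeriv, hf, rotForm_apply, hI', neg_smul, map_neg, mul_neg, neg_mul,
    sub_neg_eq_add]
  rw [← sub_eq_zero] at h1 ⊢
  refine neg_eq_zero.1 (Eq.trans ?_ h1)
  abel

/-- The pairing of `a` with its rotation is the integral of a pointwise positive quantity, in effect
a squared `L²`-norm. -/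
theorem atiyahBott_rot_nonneg {a : LocForm U W} (ha : IsAdForm P 𝔨 a)
    (h𝔨 : 𝔨 ⊆ unitaryLie W) : 0 ≤ atiyahBott κ a (rotForm a) ∧
      (atiyahBott κ a (rotForm a) = 0 → a = 0) := by
  have hl : ∀ i e u, a i e u ∈ unitaryLie W := fun i e u => h𝔨 (ha.mem_lie i e u)
  have hpt : ∀ i, ∀ e ∈ (U.chart i).target, 0 ≤ abIntegrand κ a (rotForm a) i e ∧
      (abIntegrand κ a (rotForm a) i e = 0 →
        ∀ k, wedgeRot (a i e) (realBasis k) (realBasis k) = 0) :=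
    fun i e he => κ.contr_nonneg (U.mem_atlas i) he (wedgeRot (a i e)) (wedgeRot_symm _)
      (fun u => (wedgeRot_nonneg (hl i e) u).1) (wedgeRot_eq (a i e))
  have hnn : ∀ x, 0 ≤ abIntegrand κ a (rotForm a) (U.idx x) (U.chart (U.idx x) x) := fun x =>
    (hpt _ _ ((U.chart _).map_source (U.idx_mem x))).1
  refine ⟨MeasureTheory.integral_nonneg hnn, fun h0 => ?_⟩
  have hz : ∀ x, a (U.idx x) (U.chart (U.idx x) x) = 0 := by
    intro x
    have h1 := κ.eq_zero_of_integral_eq_zero (continuous_abIntegrand κ ha ha.rot) hnn h0 x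
    have h2 := (hpt _ _ ((U.chart _).map_source (U.idx_mem x))).2 h1
    have h3 : (a (U.idx x) (U.chart (U.idx x) x) : Cn n →ₗ[ℝ] (W →L[ℂ] W)) = 0 := by
      refine (realBas n).ext fun k => ?_
      rw [realBas_apply]
      exact (wedgeRot_nonneg (hl _ _) _).2 (h2 k)
    exact ContinuousLinearMap.coe_injective h3
  -- So far `a` vanishes in the chart chosen at each point; the gauge law carries this to all
  -- charts, and off the chart targets `a` is zero by convention.
  funext i e
  by_cases he : e ∈ (U.chart i).target
  · ext1 u
    have hx := (U.chart i).map_target he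
    have hov := U.mem_overlap hx (U.idx_mem ((U.chart i).symm e))
    rw [(U.chart i).right_inv he] at hov
    rw [ha.eq_conj hov]
    have : U.trans i (U.idx ((U.chart i).symm e)) e = U.chart (U.idx ((U.chart i).symm e))
      ((U.chart i).symm e) := rfl
    rw [this, hz]
    simp
    rfl
  · rw [ha.zero_off i e he]
    rfl

end AB

/-! ### The hermitian integrand for sections. -/

section Sections

variable {W₁ W₂ N : Type*}
  [NormedAddCommGroup W₁] [InnerProductSpace ℂ W₁] [FiniteDimensional ℂ W₁]
  [NormedAddCommGroup W₂] [InnerProductSpace ℂ W₂]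
  [NormedAddCommGroup N] [InnerProductSpace ℂ N] [FiniteDimensional ℂ N]
  {K₁ : Set (W₁ →L[ℂ] W₁)} {K₂ : Set (W₂ →L[ℂ] W₂)} {K : Set (N →L[ℂ] N)}
  {P₁ : PrincipalBundle U W₁ K₁} {P₂ : PrincipalBundle U W₂ K₂} {F : PrincipalBundle U N K}

theorem continuous_hermTrace {s t : LocSec U W₁ W₂ N} (hs : IsSection P₁ P₂ F s)
    (ht : IsSection P₁ P₂ F t) (h₁ : K₁ ⊆ unitaryGroup W₁) (h₂ : K₂ ⊆ unitaryGroup W₂)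
    (hK : K ⊆ unitaryGroup N) :
    Continuous fun x => (hermTrace (s (U.idx x) (U.chart (U.idx x) x))
      (t (U.idx x) (U.chart (U.idx x) x))).im := by
  refine U.continuous_glue (h := fun i e => (hermTrace (s i e) (t i e)).im) (fun i => ?_)
    fun i j e he => ?_
  · refine Complex.continuous_im.comp_continuousOn ?_
    unfold hermTrace
    refine continuousOn_finsetSum _ fun k _ => continuousOn_finsetSum _ fun l _ => ?_
    have h1 : ∀ {r : LocSec U W₁ W₂ N}, IsSection P₁ P₂ F r → ∀ m w,
        ContinuousOn (fun e => r i e m w) (U.chart i).target := fun hr m w =>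
      ((hr.smooth i).continuousOn.clm_apply continuousOn_const).clm_apply continuousOn_const
    exact (h1 hs _ _).inner (𝕜 := ℂ) (h1 ht _ _)
  · have hx : (U.chart i).symm e ∈ (U.chart i).source ∩ (U.chart j).source :=
      ⟨U.symm_mem_source he, he.2⟩
    exact congrArg Complex.im (hermTrace_gauge (hK (F.mem i j _ hx)) (h₁ (P₁.mem i j _ hx))
      (h₂ (P₂.mem i j _ hx)) (hs.gauge i j e he) (ht.gauge i j e he))

theorem IsSection.eq_zero {s : LocSec U W₁ W₂ N} (hs : IsSection P₁ P₂ F s)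
    (hz : ∀ x, s (U.idx x) (U.chart (U.idx x) x) = 0) : s = 0 := by
  funext i e
  by_cases he : e ∈ (U.chart i).target
  · have hx := (U.chart i).map_target he
    have hov := U.mem_overlap hx (U.idx_mem ((U.chart i).symm e))
    rw [(U.chart i).right_inv he] at hov
    set x := (U.chart i).symm e
    set j := U.idx x
    have ht : s j (U.trans i j e) = 0 := hz x
    ext m w
    -- The gauge law is evaluated at transformed vectors, so that the cocycles on the twisting and
    -- source bundles cancel.
    have hg := hs.gauge i j e hov (F.tr j i x m)
    have h1 : F.tr i j x (F.tr j i x m) = m :=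
      congrArg (fun T => T m) (F.tr_mul_tr hx (U.idx_mem x))
    have h2 : P₁.tr i j x (P₁.tr j i x w) = w :=
      congrArg (fun T => T w) (P₁.tr_mul_tr hx (U.idx_mem x))
    have h3 := congrArg (fun T => T (P₁.tr j i x w)) hg
    simp only [ContinuousLinearMap.comp_apply, ht, zero_apply, map_zero] at h3
    rw [show (U.chart i).symm e = x from rfl, h1, h2] at h3
    exact h3
  · rw [hs.zero_off i e he]
    rfl

end Sections

end Integrands

theorem differentiableAt_clm_comp {E F F' : Type*} [NormedAddCommGroup E] [NormedSpace ℝ E]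
    [NormedAddCommGroup F] [NormedSpace ℝ F] [NormedAddCommGroup F'] [NormedSpace ℝ F']
    (L : F →L[ℝ] F') {f : E → F} {e : E} (hf : DifferentiableAt ℝ f e) :
    DifferentiableAt ℝ (fun e' => L (f e')) e :=
  L.differentiableAt.comp e hf

/-! ### Intertwined operators -/

section Intertwine

variable {V₁ V₂ V₃ W₁ W₂ W₃ : Type*}
  [NormedAddCommGroup V₁] [InnerProductSpace ℂ V₁] [NormedAddCommGroup V₂] [InnerProductSpace ℂ V₂]
  [NormedAddCommGroup V₃] [InnerProductSpace ℂ V₃]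
  [NormedAddCommGroup W₁] [InnerProductSpace ℂ W₁] [NormedAddCommGroup W₂] [InnerProductSpace ℂ W₂]
  [NormedAddCommGroup W₃] [InnerProductSpace ℂ W₃]

/-- The operators `S` and `S'` correspond to each other under the maps `J₁`, `J₂`. -/
def Intertwines (J₁ : W₁ →L[ℂ] V₁) (J₂ : W₂ →L[ℂ] V₂) (S : V₁ →L[ℂ] V₂) (S' : W₁ →L[ℂ] W₂) :
    Prop :=
  ∀ w, S (J₁ w) = J₂ (S' w)

namespace Intertwines

variable {J₁ : W₁ →L[ℂ] V₁} {J₂ : W₂ →L[ℂ] V₂} {J₃ : W₃ →L[ℂ] V₃}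
  {S T : V₁ →L[ℂ] V₂} {S' T' : W₁ →L[ℂ] W₂} {R : V₂ →L[ℂ] V₃} {R' : W₂ →L[ℂ] W₃}

theorem comp (hR : Intertwines J₂ J₃ R R') (hS : Intertwines J₁ J₂ S S') :
    Intertwines J₁ J₃ (R.comp S) (R'.comp S') := fun w => by
  rw [ContinuousLinearMap.comp_apply, hS, hR]
  rfl

theorem add (hS : Intertwines J₁ J₂ S S') (hT : Intertwines J₁ J₂ T T') :
    Intertwines J₁ J₂ (S + T) (S' + T') := fun w => by
  rw [add_apply, add_apply, hS, hT, map_add]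

theorem sub (hS : Intertwines J₁ J₂ S S') (hT : Intertwines J₁ J₂ T T') :
    Intertwines J₁ J₂ (S - T) (S' - T') := fun w => by
  rw [sub_apply, sub_apply, hS, hT, map_sub]

theorem smul (c : ℂ) (hS : Intertwines J₁ J₂ S S') : Intertwines J₁ J₂ (c • S) (c • S') :=
  fun w => by rw [smul_apply, smul_apply, hS, map_smul]

/-- This lemma takes identities from the total space to the components; `apply_eq` takes them back,
one component at a time. -/
theorem eq_of_injective (hJ : Function.Injective J₂) (hS : Intertwines J₁ J₂ S S')
    (hT : Intertwines J₁ J₂ T T') (h : S = T) : S' = T' := by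
  ext w
  exact hJ (by rw [← hS, ← hT, h])

theorem apply_eq (hS : Intertwines J₁ J₂ S S') (hT : Intertwines J₁ J₂ T T') (h : S' = T')
    (w : W₁) : S (J₁ w) = T (J₁ w) := by rw [hS, hT, h]

/-- Derivatives of intertwined operators are intertwined. -/
theorem fderiv {E : Type*} [NormedAddCommGroup E] [NormedSpace ℝ E] {f : E → (V₁ →L[ℂ] V₂)}
    {f' : E → (W₁ →L[ℂ] W₂)} {e : E} (hf : DifferentiableAt ℝ f e) (hf' : DifferentiableAt ℝ f' e)
    (h : ∀ᶠ e' in nhds e, Intertwines J₁ J₂ (f e') (f' e')) (u : E) :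
    Intertwines J₁ J₂ (fderiv ℝ f e u) (fderiv ℝ f' e u) := by
  -- The relation says `L₁ ∘ f = L₂ ∘ f'` for the fixed linear maps `S ↦ S J₁` and `S' ↦ J₂ S'`,
  -- which commute with differentiation.
  let L₁ := ((ContinuousLinearMap.compL ℂ W₁ V₁ V₂).flip J₁).restrictScalars ℝ
  let L₂ := (ContinuousLinearMap.compL ℂ W₁ W₂ V₂ J₂).restrictScalars ℝ
  have h1 := fderiv_clm_comp L₁ hf u
  have h2 := fderiv_clm_comp L₂ hf' u
  have h3 : (fun e' => L₁ (f e')) =ᶠ[nhds e] fun e' => L₂ (f' e') :=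
    h.mono fun e' he' => ContinuousLinearMap.ext he'
  rw [h3.fderiv_eq, h2] at h1
  exact fun w => (congrArg (fun T => T w) h1).symm

end Intertwines

variable {n : ℕ} {X : Type*} [TopologicalSpace X] [ChartedSpace (Cn n) X] {U : HolCover n X}
  {N : Type*} [NormedAddCommGroup N] [InnerProductSpace ℂ N]

theorem LocForm.fderiv_apply {a : LocForm U V₁} {i : U.ι} {e : Cn n}
    (h : DifferentiableAt ℝ (a i) e) (u v : Cn n) :
    fderiv ℝ (a i) e u v = fderiv ℝ (fun e' => a i e' v) e u :=
  (fderiv_clm_comp (F := Cn n →L[ℝ] (V₁ →L[ℂ] V₁)) (F' := V₁ →L[ℂ] V₁)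
    (ContinuousLinearMap.apply ℝ _ v) (f := a i) h u).symm

theorem LocForm.differentiableAt_apply {a : LocForm U V₁} {i : U.ι} {e : Cn n}
    (h : DifferentiableAt ℝ (a i) e) (v : Cn n) : DifferentiableAt ℝ (fun e' => a i e' v) e :=
  DifferentiableAt.clm_apply h (differentiableAt_const v)

theorem LocSec.fderiv_apply {s : LocSec U V₁ V₂ N} {i : U.ι} {e : Cn n}
    (h : DifferentiableAt ℝ (s i) e) (u : Cn n) (m : N) :
    fderiv ℝ (s i) e u m = fderiv ℝ (fun e' => s i e' m) e u :=
  (fderiv_clm_comp (F := N →L[ℂ] (V₁ →L[ℂ] V₂)) (F' := V₁ →L[ℂ] V₂)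
    ((ContinuousLinearMap.apply ℂ _ m).restrictScalars ℝ) (f := s i) h u).symm

theorem LocSec.differentiableAt_apply {s : LocSec U V₁ V₂ N} {i : U.ι} {e : Cn n}
    (h : DifferentiableAt ℝ (s i) e) (m : N) : DifferentiableAt ℝ (fun e' => s i e' m) e :=
  differentiableAt_clm_comp (F := N →L[ℂ] (V₁ →L[ℂ] V₂)) (F' := V₁ →L[ℂ] V₂)
    ((ContinuousLinearMap.apply ℂ _ m).restrictScalars ℝ) (f := s i) h

variable {J₁ : W₁ →L[ℂ] V₁} {J₂ : W₂ →L[ℂ] V₂}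

theorem Intertwines.fderiv_form {a : LocForm U V₁} {a' : LocForm U W₁} {i : U.ι} {e : Cn n}
    (hd : DifferentiableAt ℝ (a i) e) (hd' : DifferentiableAt ℝ (a' i) e)
    (h : ∀ e u, Intertwines J₁ J₁ (a i e u) (a' i e u)) (u v : Cn n) :
    Intertwines J₁ J₁ (_root_.fderiv ℝ (a i) e u v) (_root_.fderiv ℝ (a' i) e u v) := by
  rw [LocForm.fderiv_apply hd, LocForm.fderiv_apply hd']
  exact Intertwines.fderiv (LocForm.differentiableAt_apply hd v)
    (LocForm.differentiableAt_apply hd' v) (Filter.Eventually.of_forall fun e' => h e' v) u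

theorem Intertwines.curv {a : LocForm U V₁} {a' : LocForm U W₁} {i : U.ι} {e : Cn n}
    (hd : DifferentiableAt ℝ (a i) e) (hd' : DifferentiableAt ℝ (a' i) e)
    (h : ∀ e u, Intertwines J₁ J₁ (a i e u) (a' i e u)) (u v : Cn n) :
    Intertwines J₁ J₁ (curv a i e u v) (curv a' i e u v) :=
  ((fderiv_form hd hd' h u v).sub (fderiv_form hd hd' h v u)).add
    (((h e u).comp (h e v)).sub ((h e v).comp (h e u)))

theorem Intertwines.covExtDeriv {A a : LocForm U V₁} {A' a' : LocForm U W₁} {i : U.ι} {e : Cn n}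
    (hd : DifferentiableAt ℝ (a i) e) (hd' : DifferentiableAt ℝ (a' i) e)
    (hA : ∀ e u, Intertwines J₁ J₁ (A i e u) (A' i e u))
    (h : ∀ e u, Intertwines J₁ J₁ (a i e u) (a' i e u)) (u v : Cn n) :
    Intertwines J₁ J₁ (covExtDeriv A a i e u v) (covExtDeriv A' a' i e u v) :=
  (((fderiv_form hd hd' h u v).sub (fderiv_form hd hd' h v u)).add
    (((hA e u).comp (h e v)).sub ((h e v).comp (hA e u)))).sub
    (((hA e v).comp (h e u)).sub ((h e u).comp (hA e v)))

theorem Intertwines.covDeriv {A₁ : LocForm U V₁} {A₂ : LocForm U V₂} {A₁' : LocForm U W₁}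
    {A₂' : LocForm U W₂} {B : LocForm U N} {s : LocSec U V₁ V₂ N} {s' : LocSec U W₁ W₂ N}
    {i : U.ι} {e : Cn n} (hd : DifferentiableAt ℝ (s i) e) (hd' : DifferentiableAt ℝ (s' i) e)
    (hA₁ : ∀ u, Intertwines J₁ J₁ (A₁ i e u) (A₁' i e u))
    (hA₂ : ∀ u, Intertwines J₂ J₂ (A₂ i e u) (A₂' i e u))
    (h : ∀ e m, Intertwines J₁ J₂ (s i e m) (s' i e m)) (u : Cn n) (m : N) :
    Intertwines J₁ J₂ (covDeriv A₁ A₂ B s i e u m) (covDeriv A₁' A₂' B s' i e u m) := by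
  unfold SQ.covDeriv
  rw [LocSec.fderiv_apply hd, LocSec.fderiv_apply hd']
  exact (((Intertwines.fderiv (LocSec.differentiableAt_apply hd m)
    (LocSec.differentiableAt_apply hd' m) (Filter.Eventually.of_forall fun e' => h e' m) u).add
    ((hA₂ u).comp (h e m))).sub ((h e m).comp (hA₁ u))).sub (h e _)

end Intertwine

/-! ### Isotypic components -/

section Weights

variable {V : Type*} [NormedAddCommGroup V] [InnerProductSpace ℂ V] [FiniteDimensional ℂ V]
  {C : EpsForm V} (G : GenQuiver C)

namespace GenQuiver

/-- The inclusion of the fibre at a vertex. -/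
def incl (χ : Weight G.H) : vertexSpace G χ →L[ℂ] V := (vertexSpace G χ).subtypeL

/-- The orthogonal projection to the fibre at a vertex. -/
def proj (χ : Weight G.H) : V →L[ℂ] vertexSpace G χ := (vertexSpace G χ).orthogonalProjectionOnto

theorem incl_apply (χ : Weight G.H) (w : vertexSpace G χ) : G.incl χ w = w := rfl

theorem incl_injective (χ : Weight G.H) : Function.Injective (G.incl χ) := Subtype.val_injective

theorem proj_incl (χ : Weight G.H) (w : vertexSpace G χ) : G.proj χ (G.incl χ w) = w :=
  Submodule.orthogonalProjectionOnto_mem_subspace_eq_self w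

/-- The values already lie in `V_μ`, so the orthogonal projection leaves them unchanged. -/
theorem intertwines_block {χ μ : Weight G.H} {T : V →L[ℂ] V}
    (hT : ∀ v ∈ vertexSpace G χ, T v ∈ vertexSpace G μ) :
    Intertwines (G.incl χ) (G.incl μ) T (block (vertexSpace G χ) (vertexSpace G μ) T) := fun w =>
  ((vertexSpace G μ).starProjection_eq_self_iff.2 (hT w w.2)).symm

theorem block_eq_of_intertwines {χ μ : Weight G.H} {T : V →L[ℂ] V}
    {T' : vertexSpace G χ →L[ℂ] vertexSpace G μ} (h : Intertwines (G.incl χ) (G.incl μ) T T') :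
    block (vertexSpace G χ) (vertexSpace G μ) T = T' := by
  ext1 w
  show G.proj μ (T (G.incl χ w)) = _
  rw [h, proj_incl]

theorem induction_weight {p : V → Prop} (h0 : p 0) (ha : ∀ v w, p v → p w → p (v + w))
    (hw : ∀ χ : Weight G.H, ∀ v ∈ vertexSpace G χ, p v) (v : V) : p v := by
  have hv : v ∈ ⨆ χ, weightSpace G.H χ := G.iSup_weightSpace ▸ Submodule.mem_top
  refine Submodule.iSup_induction _ (motive := p) hv (fun χ w hwχ => ?_) h0 ha
  by_cases hb : weightSpace G.H χ = ⊥
  · rw [hb, Submodule.mem_bot] at hwχ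
    exact hwχ ▸ h0
  · exact hw ⟨χ, hb⟩ w hwχ

theorem ext_weight {W : Type*} [NormedAddCommGroup W] [InnerProductSpace ℂ W] {S T : V →L[ℂ] W}
    (h : ∀ χ (w : vertexSpace G χ), S (G.incl χ w) = T (G.incl χ w)) : S = T := by
  ext v
  refine G.induction_weight (p := fun v => S v = T v) (by simp) (fun v w hv hw => ?_)
    (fun χ v hv => h χ ⟨v, hv⟩) v
  rw [map_add, map_add, hv, hw]

theorem dual_dual (χ : Weight G.H) : G.dual (G.dual χ) = χ := Subtype.ext (char_inv_inv χ.1)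

theorem form_eq_zero_of_ne {χ μ : Weight G.H} (h : μ ≠ G.dual χ) {v w : V}
    (hv : v ∈ vertexSpace G χ) (hw : w ∈ vertexSpace G μ) : C.form v w = 0 :=
  G.form_eq_zero (fun h' => h (Subtype.ext h')) hv hw

theorem weight_unique {χ μ : G.H →* ℂˣ} {v : V} (hv : v ≠ 0) (h1 : v ∈ weightSpace G.H χ)
    (h2 : v ∈ weightSpace G.H μ) : χ = μ := by
  refine MonoidHom.ext fun k => Units.ext ?_
  exact smul_left_injective ℂ hv ((h1 k).symm.trans (h2 k))

variable {G}

theorem mapsTo_of_mem_lieK {T : V →L[ℂ] V} (hT : T ∈ G.lieK) (χ : Weight G.H) :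
    ∀ v ∈ vertexSpace G χ, T v ∈ vertexSpace G χ := by
  intro v hv h
  have h1 : T (h.1.val v) = h.1.val (T v) := congrArg (fun S => S v) (hT.2.2 h.1 h.2)
  rw [← h1, hv h, map_smul]

theorem block_mem_unitaryLie {T : V →L[ℂ] V} (hT : T ∈ G.lieK) (χ : Weight G.H) :
    block (vertexSpace G χ) (vertexSpace G χ) T ∈ unitaryLie (vertexSpace G χ) := by
  intro v w
  have h := G.intertwines_block (mapsTo_of_mem_lieK hT χ)
  have h1 : inner ℂ (block (vertexSpace G χ) (vertexSpace G χ) T v) w = inner ℂ (T v) w :=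
    congrArg (fun z => inner ℂ z (w : V)) (h v).symm
  have h2 : inner ℂ v (block (vertexSpace G χ) (vertexSpace G χ) T w) = inner ℂ (v : V) (T w) :=
    congrArg (fun z => inner ℂ (v : V) z) (h w).symm
  rw [h1, h2]
  exact hT.1 v w

theorem block_compat {T : V →L[ℂ] V} (hT : T ∈ G.lieK) (χ : Weight G.H) (x : vertexSpace G χ)
    (y : vertexSpace G (G.dual χ)) :
    C.form (block (vertexSpace G χ) (vertexSpace G χ) T x : vertexSpace G χ) (y : V) +
      C.form (x : V) (block (vertexSpace G (G.dual χ)) (vertexSpace G (G.dual χ)) T y :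
        vertexSpace G (G.dual χ)) = 0 := by
  have h1 := G.intertwines_block (mapsTo_of_mem_lieK hT χ) x
  have h2 := G.intertwines_block (mapsTo_of_mem_lieK hT (G.dual χ)) y
  rw [incl_apply, incl_apply] at h1 h2
  rw [← h1, ← h2]
  exact hT.2.1 x y

theorem mem_lie_of_weights {T : V →L[ℂ] V} (h : ∀ χ μ : Weight G.H, ∀ v ∈ vertexSpace G χ,
    ∀ w ∈ vertexSpace G μ, C.form (T v) w + C.form v (T w) = 0) : T ∈ C.lie := by
  intro v w
  refine G.induction_weight (p := fun v => C.form (T v) w + C.form v (T w) = 0) (by simp)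
    (fun v v' hv hv' => ?_) (fun χ v hv => ?_) v
  · simp only [map_add, LinearMap.add_apply]
    linear_combination hv + hv'
  · refine G.induction_weight (p := fun w => C.form (T v) w + C.form v (T w) = 0) (by simp)
      (fun w w' hw hw' => ?_) (fun μ w hw => h χ μ v hv w hw) w
    simp only [map_add]
    linear_combination hw + hw'

/-- All three conditions are checked on pairs of isotypic components: distinct ones are orthogonal,
non-dual ones are `C`-orthogonal, the remaining pairs are the hypotheses, and `H` acts by scalars on
each component. -/
theorem mem_lieK_of_blocks (hG : G.Adapted) {T : V →L[ℂ] V}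
    {T' : ∀ χ, vertexSpace G χ →L[ℂ] vertexSpace G χ}
    (h : ∀ χ, Intertwines (G.incl χ) (G.incl χ) T (T' χ))
    (hu : ∀ χ, T' χ ∈ unitaryLie (vertexSpace G χ))
    (hc : ∀ χ (x : vertexSpace G χ) (y : vertexSpace G (G.dual χ)),
      C.form (T' χ x : vertexSpace G χ) (y : V) +
        C.form (x : V) (T' (G.dual χ) y : vertexSpace G (G.dual χ)) = 0) : T ∈ G.lieK := by
  have hmaps : ∀ χ, ∀ v ∈ vertexSpace G χ, T v ∈ vertexSpace G χ := fun χ v hv => by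
    have := h χ ⟨v, hv⟩
    rw [incl_apply, incl_apply] at this
    rw [this]
    exact (T' χ ⟨v, hv⟩).2
  refine ⟨fun v w => ?_, mem_lie_of_weights (G := G) fun χ μ v hv w hw => ?_, fun k hk => ?_⟩
  · refine G.induction_weight (p := fun v => inner ℂ (T v) w + inner ℂ v (T w) = 0) (by simp)
      (fun v v' hv hv' => ?_) (fun χ v hv => ?_) v
    · simp only [map_add, inner_add_left]
      linear_combination hv + hv'
    · refine G.induction_weight (p := fun w => inner ℂ (T v) w + inner ℂ v (T w) = 0) (by simp)
        (fun w w' hw hw' => ?_) (fun μ w hw => ?_) w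
      · simp only [map_add, inner_add_right]
        linear_combination hw + hw'
      · by_cases hχ : χ = μ
        · subst hχ
          have h1 := h χ ⟨v, hv⟩
          have h2 := h χ ⟨w, hw⟩
          rw [incl_apply, incl_apply] at h1 h2
          rw [h1, h2]
          exact hu χ ⟨v, hv⟩ ⟨w, hw⟩
        · have hne : χ.1 ≠ μ.1 := fun h' => hχ (Subtype.ext h')
          rw [hG.2 _ _ hne _ (hmaps χ v hv) _ hw, hG.2 _ _ hne _ hv _ (hmaps μ w hw), add_zero]
  · by_cases hχ : μ = G.dual χ
    · subst hχ
      have h1 := h χ ⟨v, hv⟩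
      have h2 := h (G.dual χ) ⟨w, hw⟩
      rw [incl_apply, incl_apply] at h1 h2
      rw [h1, h2]
      exact hc χ ⟨v, hv⟩ ⟨w, hw⟩
    · rw [G.form_eq_zero_of_ne hχ (hmaps χ v hv) hw, G.form_eq_zero_of_ne hχ hv (hmaps μ w hw),
        add_zero]
  · refine G.ext_weight fun χ w => ?_
    show T (k.val (G.incl χ w)) = k.val (T (G.incl χ w))
    have h1 : k.val (w : V) = _ := w.2 ⟨k, hk⟩
    have h2 : k.val (T w) = _ := hmaps χ w w.2 ⟨k, hk⟩
    rw [incl_apply, h1, h2, map_smul]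

/-! ### Arrows -/

/-- A nonzero piece remembers its unordered pair of arrows: one nonzero value of one of its elements
exhibits an arrow that both descriptions must contain. -/
theorem eq_of_piece_eq {χ μ χ' μ' : G.H →* ℂˣ} (h : piece C G.H χ μ = piece C G.H χ' μ')
    (hne : piece C G.H χ μ ≠ ⊥) : (χ' = χ ∧ μ' = μ) ∨ (χ' = μ⁻¹ ∧ μ' = χ⁻¹) := by
  obtain ⟨T, hT, hT0⟩ := (Submodule.ne_bot_iff _).1 hne
  have hT' : T ∈ piece C G.H χ' μ' := h ▸ hT
  -- Otherwise `T` would vanish on every isotypic component.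
  have key : ∃ ν ν' : G.H →* ℂˣ, (ν = χ ∧ ν' = μ ∨ ν = μ⁻¹ ∧ ν' = χ⁻¹) ∧
      ∃ v ∈ weightSpace G.H ν, T v ≠ 0 ∧ T v ∈ weightSpace G.H ν' := by
    by_contra! hcon
    refine hT0 (G.ext_weight fun ν w => ?_)
    by_cases h1 : ν.1 = χ
    · by_contra h0
      exact hcon χ μ (Or.inl ⟨rfl, rfl⟩) w (h1 ▸ w.2) h0 (hT.2.1 _ (h1 ▸ w.2))
    · by_cases h2 : ν.1 = μ⁻¹
      · by_contra h0
        exact hcon μ⁻¹ χ⁻¹ (Or.inr ⟨rfl, rfl⟩) w (h2 ▸ w.2) h0 (hT.2.2.1 _ (h2 ▸ w.2))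
      · exact hT.2.2.2 ν.1 h1 h2 _ w.2
  obtain ⟨ν, ν', hν, v, hv, hTv, hv'⟩ := key
  have key' : (χ' = ν ∧ μ' = ν') ∨ (μ'⁻¹ = ν ∧ χ'⁻¹ = ν') := by
    by_cases h1 : ν = χ'
    · subst h1
      exact Or.inl ⟨rfl, weight_unique G hTv (hT'.2.1 v hv) hv'⟩
    · by_cases h2 : ν = μ'⁻¹
      · subst h2
        exact Or.inr ⟨rfl, weight_unique G hTv (hT'.2.2.1 v hv) hv'⟩
      · exact absurd (hT'.2.2.2 ν h1 h2 v hv) hTv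
  rcases hν with ⟨rfl, rfl⟩ | ⟨rfl, rfl⟩ <;> rcases key' with ⟨h1, h2⟩ | ⟨h1, h2⟩
  · exact Or.inl ⟨h1, h2⟩
  · exact Or.inr ⟨by rw [← h2, char_inv_inv], by rw [← h1, char_inv_inv]⟩
  · exact Or.inr ⟨h1, h2⟩
  · refine Or.inl ⟨?_, ?_⟩
    · rw [← char_inv_inv χ', h2, char_inv_inv]
    · rw [← char_inv_inv μ', h1, char_inv_inv]

/-- The arrows of `α` are `χ → μ` and `μ⁻¹ → χ⁻¹`; if the tails agree, then `χ = μ⁻¹` and the two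
coincide. So the components along arrows can be prescribed independently. -/
theorem tail_injective (α : G.Summand) :
    Function.Injective fun c : G.toSym.Arr α => G.toSym.tail c := by
  intro c c' h
  have h' : c.1.1 = c'.1.1 := h
  have hp : piece C G.H c.1.1.1 c.1.2.1 = piece C G.H c'.1.1.1 c'.1.2.1 := c.2.symm.trans c'.2
  have hne : piece C G.H c.1.1.1 c.1.2.1 ≠ ⊥ := c.2 ▸ G.Z_ne_bot α
  refine Subtype.ext (Prod.ext h' (Subtype.ext ?_))
  rcases eq_of_piece_eq hp hne with ⟨-, h2⟩ | ⟨h1, h2⟩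
  · exact h2.symm
  · rw [h2, ← char_inv_inv c.1.2.1, ← h1, ← h']

variable {α : G.Summand}

theorem mapsTo_of_mem_Z {T : V →L[ℂ] V} (hT : T ∈ G.Z α) (c : G.toSym.Arr α) :
    ∀ v ∈ vertexSpace G (G.toSym.tail c), T v ∈ vertexSpace G (G.toSym.head c) := by
  have h : T ∈ piece C G.H c.1.1.1 c.1.2.1 := c.2 ▸ hT
  exact h.2.1

theorem mem_lie_of_mem_Z {T : V →L[ℂ] V} (hT : T ∈ G.Z α) : T ∈ C.lie := by
  obtain ⟨χ, μ, h⟩ := G.Z_eq α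
  rw [h] at hT
  exact hT.1

theorem eq_zero_of_mem_Z {T : V →L[ℂ] V} (hT : T ∈ G.Z α) {χ : Weight G.H}
    (hχ : ∀ c : G.toSym.Arr α, G.toSym.tail c ≠ χ) : ∀ v ∈ vertexSpace G χ, T v = 0 := by
  obtain ⟨ν, μ, h⟩ := G.Z_eq α
  have hT' := hT
  rw [h] at hT'
  refine hT'.2.2.2 χ.1 (fun h1 => ?_) fun h1 => ?_
  · exact hχ ⟨(ν, μ), h⟩ (Subtype.ext h1.symm)
  · exact hχ (G.toSym.σa ⟨(ν, μ), h⟩) (Subtype.ext h1.symm)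

theorem block_orth {T : V →L[ℂ] V} (hT : T ∈ G.Z α) (c : G.toSym.Arr α)
    (x : vertexSpace G (G.toSym.tail c)) (y : vertexSpace G (G.toSym.tail (G.toSym.σa c))) :
    C.form (block (vertexSpace G (G.toSym.tail c)) (vertexSpace G (G.toSym.head c)) T x :
        vertexSpace G (G.toSym.head c)) (y : V) +
      C.form (x : V) (block (vertexSpace G (G.toSym.tail (G.toSym.σa c)))
        (vertexSpace G (G.toSym.head (G.toSym.σa c))) T y :
          vertexSpace G (G.toSym.head (G.toSym.σa c))) = 0 := by
  have h1 := G.intertwines_block (mapsTo_of_mem_Z hT c) x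
  have h2 := G.intertwines_block (mapsTo_of_mem_Z hT (G.toSym.σa c)) y
  rw [incl_apply, incl_apply] at h1 h2
  rw [← h1, ← h2]
  exact mem_lie_of_mem_Z hT x y

/-- The orthogonality relation along the arrows, together with vanishing off their tails, amounts to
skewness for `C` on all of `V`. -/
theorem mem_Z_of_blocks {T : V →L[ℂ] V}
    {T' : ∀ c : G.toSym.Arr α,
      vertexSpace G (G.toSym.tail c) →L[ℂ] vertexSpace G (G.toSym.head c)}
    (h : ∀ c, Intertwines (G.incl (G.toSym.tail c)) (G.incl (G.toSym.head c)) T (T' c))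
    (h0 : ∀ χ, (∀ c : G.toSym.Arr α, G.toSym.tail c ≠ χ) → ∀ v ∈ vertexSpace G χ, T v = 0)
    (ho : ∀ (c : G.toSym.Arr α) (x : vertexSpace G (G.toSym.tail c))
      (y : vertexSpace G (G.toSym.tail (G.toSym.σa c))),
      C.form (T' c x : vertexSpace G (G.toSym.head c)) (y : V) +
        C.form (x : V) (T' (G.toSym.σa c) y : vertexSpace G (G.toSym.head (G.toSym.σa c))) = 0) :
    T ∈ G.Z α := by
  have hmaps : ∀ c : G.toSym.Arr α, ∀ v ∈ vertexSpace G (G.toSym.tail c),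
      T v ∈ vertexSpace G (G.toSym.head c) := fun c v hv => by
    have := h c ⟨v, hv⟩
    rw [incl_apply, incl_apply] at this
    rw [this]
    exact (T' c ⟨v, hv⟩).2
  have hlie : T ∈ C.lie := by
    refine mem_lie_of_weights (G := G) fun χ μ v hv w hw => ?_
    -- A nonzero `C(Tv, w)` or `C(v, Tw)` forces `χ` and `μ` to be the tails of an arrow and its
    -- `σ`-image: `T` moves along arrows, and `C` pairs only dual components. For every other pair
    -- both terms vanish.
    by_cases hpair : ∃ c : G.toSym.Arr α, G.toSym.tail c = χ ∧ G.toSym.tail (G.toSym.σa c) = μ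
    · obtain ⟨c, rfl, rfl⟩ := hpair
      have h1 := h c ⟨v, hv⟩
      have h2 := h (G.toSym.σa c) ⟨w, hw⟩
      rw [incl_apply, incl_apply] at h1 h2
      rw [h1, h2]
      exact ho c ⟨v, hv⟩ ⟨w, hw⟩
    · push Not at hpair
      have h1 : C.form (T v) w = 0 := by
        by_cases hc : ∃ c : G.toSym.Arr α, G.toSym.tail c = χ
        · obtain ⟨c, rfl⟩ := hc
          exact G.form_eq_zero_of_ne (fun h' => hpair c rfl h'.symm) (hmaps c v hv) hw
        · push Not at hc
          rw [h0 χ hc v hv, map_zero, LinearMap.zero_apply]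
      have h2 : C.form v (T w) = 0 := by
        by_cases hc : ∃ c : G.toSym.Arr α, G.toSym.tail c = μ
        · obtain ⟨c, rfl⟩ := hc
          refine G.form_eq_zero_of_ne (fun h' => hpair (G.toSym.σa c) ?_ ?_) hv (hmaps c w hw)
          · have h3 : G.toSym.tail (G.toSym.σa c) = G.dual (G.toSym.head c) := rfl
            rw [h3, h', G.dual_dual]
          · rw [G.toSym.σa_σa]
        · push Not at hc
          rw [h0 μ hc w hw, map_zero]
      rw [h1, h2, add_zero]
  obtain ⟨χ, μ, hZ⟩ := G.Z_eq α
  let c : G.toSym.Arr α := ⟨(χ, μ), hZ⟩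
  rw [hZ]
  refine ⟨hlie, hmaps c, hmaps (G.toSym.σa c), fun ν h1 h2 v hv => ?_⟩
  by_cases hb : weightSpace G.H ν = ⊥
  · rw [hb, Submodule.mem_bot] at hv
    rw [hv, map_zero]
  · refine h0 ⟨ν, hb⟩ (fun c' hc' => ?_) v hv
    have hp : piece C G.H χ.1 μ.1 = piece C G.H c'.1.1.1 c'.1.2.1 := hZ.symm.trans c'.2
    have hc'' : c'.1.1.1 = ν := congrArg Subtype.val hc'
    rcases eq_of_piece_eq hp (hZ ▸ G.Z_ne_bot α) with ⟨h3, -⟩ | ⟨h3, -⟩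
    · exact h1 (hc'' ▸ h3)
    · exact h2 (hc'' ▸ h3)

/-! ### Assembling operators from their components -/

variable (G)

/-- The endomorphism of `V` that is `T` on one isotypic component and zero on the others. -/
def expand (χ μ : Weight G.H) :
    (vertexSpace G χ →L[ℂ] vertexSpace G μ) →L[ℂ] (V →L[ℂ] V) :=
  (ContinuousLinearMap.compL ℂ V (vertexSpace G μ) V (G.incl μ)).comp
    ((ContinuousLinearMap.compL ℂ V (vertexSpace G χ) (vertexSpace G μ)).flip (G.proj χ))

theorem expand_apply (χ μ : Weight G.H) (T : vertexSpace G χ →L[ℂ] vertexSpace G μ) (v : V) :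
    G.expand χ μ T v = G.incl μ (T (G.proj χ v)) := rfl

variable {G}

/-- Orthogonality of the isotypic components makes the orthogonal projections annihilate the other
components. -/
theorem proj_incl_of_ne (hG : G.Adapted) {χ μ : Weight G.H} (h : χ ≠ μ) (w : vertexSpace G μ) :
    G.proj χ (G.incl μ w) = 0 := by
  refine Submodule.orthogonalProjectionOnto_eq_zero_iff.2 fun v hv => ?_
  exact hG.2 χ.1 μ.1 (fun h' => h (Subtype.ext h')) v hv w w.2

/-- Since the tails are distinct, only one summand survives on each of them. -/
theorem intertwines_sum_expand (hG : G.Adapted) {ι : Type*} [Fintype ι] {t h : ι → Weight G.H}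
    (ht : Function.Injective t) (T : ∀ c, vertexSpace G (t c) →L[ℂ] vertexSpace G (h c)) (c : ι) :
    Intertwines (G.incl (t c)) (G.incl (h c)) (∑ c, G.expand (t c) (h c) (T c)) (T c) := by
  intro w
  rw [sum_apply, Finset.sum_eq_single c]
  · rw [expand_apply, proj_incl]
  · intro c' _ hc'
    rw [expand_apply, proj_incl_of_ne hG (fun h' => hc' (ht h')), map_zero, map_zero]
  · simp

theorem sum_expand_eq_zero (hG : G.Adapted) {ι : Type*} [Fintype ι] {t h : ι → Weight G.H}
    (T : ∀ c, vertexSpace G (t c) →L[ℂ] vertexSpace G (h c)) {χ : Weight G.H}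
    (hχ : ∀ c, t c ≠ χ) : ∀ v ∈ vertexSpace G χ, (∑ c, G.expand (t c) (h c) (T c)) v = 0 := by
  intro v hv
  rw [sum_apply]
  refine Finset.sum_eq_zero fun c _ => ?_
  have := proj_incl_of_ne hG (hχ c) ⟨v, hv⟩
  rw [incl_apply] at this
  rw [expand_apply, this, map_zero, map_zero]

/-! ### Traces -/

/-- Operators on dual isotypic components that are negative transposes of each other have products
with the same traces. -/
theorem traceL_dual {χ : Weight G.H} {S T : vertexSpace G χ →L[ℂ] vertexSpace G χ}
    {S' T' : vertexSpace G (G.dual χ) →L[ℂ] vertexSpace G (G.dual χ)}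
    (hS : ∀ (x : vertexSpace G χ) (y : vertexSpace G (G.dual χ)),
      C.form (S x : vertexSpace G χ) (y : V) + C.form (x : V) (S' y : vertexSpace G (G.dual χ)) = 0)
    (hT : ∀ (x : vertexSpace G χ) (y : vertexSpace G (G.dual χ)),
      C.form (T x : vertexSpace G χ) (y : V) +
        C.form (x : V) (T' y : vertexSpace G (G.dual χ)) = 0) :
    traceL _ (S' * T') = traceL _ (S * T) := by
  -- The pairing `y ↦ C(·, y)` between dual components. It is injective because `C` is nondegenerate
  -- and `V_σ(χ)` pairs to zero with every component other than `V_χ`.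
  let Φ : ∀ χ : Weight G.H, vertexSpace G (G.dual χ) →ₗ[ℂ] Module.Dual ℂ (vertexSpace G χ) :=
    fun χ => (C.form.compl₁₂ (vertexSpace G χ).subtype (vertexSpace G (G.dual χ)).subtype).flip
  have hΦ : ∀ (χ : Weight G.H) (x : vertexSpace G χ) (y : vertexSpace G (G.dual χ)),
      Φ χ y x = C.form (x : V) (y : V) := fun _ _ _ => rfl
  have hinj : ∀ χ, Function.Injective (Φ χ) := by
    intro χ
    rw [injective_iff_map_eq_zero]
    intro y hy
    refine Subtype.ext (C.nondeg _ fun w => ?_)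
    rw [C.symm]
    refine mul_eq_zero_of_right _ ?_
    refine G.induction_weight (p := fun w => C.form w (y : V) = 0) (by simp)
      (fun v w hv hw => by rw [map_add, LinearMap.add_apply, hv, hw, add_zero])
      (fun μ v hv => ?_) w
    by_cases hμ : μ = χ
    · subst hμ
      exact congrArg (fun f => f ⟨v, hv⟩) hy
    · exact G.form_eq_zero_of_ne (fun h => hμ (by rw [← G.dual_dual μ, ← h, G.dual_dual])) hv y.2
  -- Used for `χ` and for `σ(χ)`, injectivity bounds the dimensions both ways, so the pairing is
  -- perfect.
  have hle : ∀ χ : Weight G.H,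
      Module.finrank ℂ (vertexSpace G (G.dual χ)) ≤ Module.finrank ℂ (vertexSpace G χ) := by
    intro χ
    have := LinearMap.finrank_le_finrank_of_injective (hinj χ)
    rwa [Subspace.dual_finrank_eq] at this
  have hfin : Module.finrank ℂ (vertexSpace G (G.dual χ)) =
      Module.finrank ℂ (Module.Dual ℂ (vertexSpace G χ)) := by
    rw [Subspace.dual_finrank_eq]
    refine le_antisymm (hle χ) ?_
    have := hle (G.dual χ)
    rwa [G.dual_dual] at this
  let e : vertexSpace G (G.dual χ) ≃ₗ[ℂ] Module.Dual ℂ (vertexSpace G χ) :=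
    LinearEquiv.ofInjectiveOfFinrankEq (Φ χ) (hinj χ) hfin
  have he : ∀ y x, e y x = C.form (x : V) (y : V) := fun _ _ => rfl
  -- `C(x, S'T'y) = -C(Sx, T'y) = C(TSx, y)`: the two signs cancel and the order is reversed.
  have hconj : e.conj ((S' * T' : vertexSpace G (G.dual χ) →L[ℂ] _) :
      vertexSpace G (G.dual χ) →ₗ[ℂ] vertexSpace G (G.dual χ)) =
      Module.Dual.transpose ((T * S : vertexSpace G χ →L[ℂ] _) :
        vertexSpace G χ →ₗ[ℂ] vertexSpace G χ) := by
    refine LinearMap.ext fun f => ?_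
    obtain ⟨y, rfl⟩ := e.surjective f
    rw [LinearEquiv.conj_apply_apply, e.symm_apply_apply]
    refine LinearMap.ext fun x => ?_
    show e (S' (T' y)) x = e y (T (S x))
    rw [he, he]
    linear_combination hS x (T' y) - hT (S x) y
  rw [traceL_mul_comm S T, traceL_apply, traceL_apply,
    ← LinearMap.trace_transpose' (M := vertexSpace G χ), ← hconj, LinearMap.trace_conj']

/-- In an orthonormal basis collected from the isotypic components, the basis vectors of `V_χ`
contribute the term of the unique arrow starting at `χ`, or nothing if there is none. For the latter
it suffices that one of the two factors vanishes there. -/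
theorem sum_hermTrace_block (hG : G.Adapted) {N : Type*} [NormedAddCommGroup N]
    [InnerProductSpace ℂ N] [FiniteDimensional ℂ N] {φ ψ : N →L[ℂ] (V →L[ℂ] V)}
    {φ' ψ' : ∀ c : G.toSym.Arr α,
      N →L[ℂ] (vertexSpace G (G.toSym.tail c) →L[ℂ] vertexSpace G (G.toSym.head c))}
    (hφ : ∀ c m, Intertwines (G.incl (G.toSym.tail c)) (G.incl (G.toSym.head c)) (φ m) (φ' c m))
    (hψ : ∀ c m, Intertwines (G.incl (G.toSym.tail c)) (G.incl (G.toSym.head c)) (ψ m) (ψ' c m))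
    (h0 : ∀ m χ, (∀ c : G.toSym.Arr α, G.toSym.tail c ≠ χ) → ∀ v ∈ vertexSpace G χ, φ m v = 0) :
    ∑ c, hermTrace (φ' c) (ψ' c) = hermTrace φ ψ := by
  classical
  have hfam : OrthogonalFamily ℂ (fun χ : Weight G.H => vertexSpace G χ)
      fun χ => (vertexSpace G χ).subtypeₗᵢ := by
    intro χ μ h v w
    exact hG.2 χ.1 μ.1 (fun h' => h (Subtype.ext h')) v v.2 w w.2
  have hint : DirectSum.IsInternal fun χ : Weight G.H => vertexSpace G χ := by
    rw [hfam.isInternal_iff, Submodule.eq_bot_iff]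
    intro v hv
    have hv' : ∀ w, inner ℂ w v = 0 := fun w =>
      G.induction_weight (p := fun w => inner ℂ w v = 0) (inner_zero_left _)
        (fun a b ha hb => by rw [inner_add_left, ha, hb, add_zero])
        (fun χ w hw => hv w (Submodule.mem_iSup_of_mem χ hw)) w
    exact inner_self_eq_zero.1 (hv' v)
  let b := hint.collectedOrthonormalBasis hfam fun χ => stdOrthonormalBasis ℂ (vertexSpace G χ)
  rw [hermTrace_eq φ ψ (stdOrthonormalBasis ℂ N) b]
  have hb : ∀ χ l, b ⟨χ, l⟩ = G.incl χ (stdOrthonormalBasis ℂ (vertexSpace G χ) l) := by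
    intro χ l
    simp [b, DirectSum.IsInternal.collectedOrthonormalBasis, incl_apply]
  simp only [Fintype.sum_sigma, hb]
  rw [Finset.sum_comm]
  refine Fintype.sum_of_injective (ι := G.toSym.Arr α) (κ := Weight G.H)
    (fun c => G.toSym.tail c) (tail_injective α) (fun c => hermTrace (φ' c) (ψ' c))
    (fun χ => ∑ k, ∑ l,
      inner ℂ (φ (stdOrthonormalBasis ℂ N k)
          (G.incl χ (stdOrthonormalBasis ℂ (vertexSpace G χ) l)))
        (ψ (stdOrthonormalBasis ℂ N k) (G.incl χ (stdOrthonormalBasis ℂ (vertexSpace G χ) l))))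
    (fun χ hχ => ?_) fun c => ?_
  · refine Finset.sum_eq_zero fun k _ => Finset.sum_eq_zero fun l _ => ?_
    have hz := h0 (stdOrthonormalBasis ℂ N k) χ (fun c hc => hχ ⟨c, hc⟩)
      (stdOrthonormalBasis ℂ (vertexSpace G χ) l) (Subtype.mem _)
    rw [incl_apply, hz, inner_zero_left]
  · refine Finset.sum_congr rfl fun k _ => Finset.sum_congr rfl fun l _ => ?_
    rw [hφ c, hψ c]
    rfl

end GenQuiver

end Weights

theorem contDiffOn_clm_comp {E F F' : Type*} [NormedAddCommGroup E] [NormedSpace ℝ E]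
    [NormedAddCommGroup F] [NormedSpace ℝ F] [NormedAddCommGroup F'] [NormedSpace ℝ F']
    (L : F →L[ℝ] F') {f : E → F} {O : Set E} (hf : ContDiffOn ℝ ∞ f O) :
    ContDiffOn ℝ ∞ (fun t => L (f t)) O :=
  L.contDiff.comp_contDiffOn hf

/-! ### Linear maps applied to local forms and sections -/

section Maps

variable {n : ℕ} {X : Type*} [TopologicalSpace X] [ChartedSpace (Cn n) X] {U : HolCover n X}
  {W₁ W₂ W₃ W₄ N : Type*}
  [NormedAddCommGroup W₁] [InnerProductSpace ℂ W₁] [NormedAddCommGroup W₂] [InnerProductSpace ℂ W₂]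
  [NormedAddCommGroup W₃] [InnerProductSpace ℂ W₃] [NormedAddCommGroup W₄] [InnerProductSpace ℂ W₄]
  [NormedAddCommGroup N] [InnerProductSpace ℂ N]

/-- A complex linear map applied to the values of a local 1-form. -/
def mapForm (L : (W₁ →L[ℂ] W₁) →L[ℂ] (W₂ →L[ℂ] W₂)) (a : LocForm U W₁) : LocForm U W₂ := fun i e =>
  (L.restrictScalars ℝ).comp (a i e)

/-- A complex linear map applied to the values of a local section. -/
def mapSec (L : (W₁ →L[ℂ] W₂) →L[ℂ] (W₃ →L[ℂ] W₄)) (s : LocSec U W₁ W₂ N) : LocSec U W₃ W₄ N :=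
  fun i e => L.comp (s i e)

variable (L : (W₁ →L[ℂ] W₁) →L[ℂ] (W₂ →L[ℂ] W₂)) (L' : (W₁ →L[ℂ] W₂) →L[ℂ] (W₃ →L[ℂ] W₄))

theorem mapForm_eq_zero {a : LocForm U W₁} {i : U.ι} {e : Cn n} (h : a i e = 0) :
    mapForm L a i e = 0 := by
  rw [mapForm, h, ContinuousLinearMap.comp_zero]

theorem mapSec_eq_zero {s : LocSec U W₁ W₂ N} {i : U.ι} {e : Cn n} (h : s i e = 0) :
    mapSec L' s i e = 0 := by
  rw [mapSec, h, ContinuousLinearMap.comp_zero]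

variable {E : Type*} [NormedAddCommGroup E] [NormedSpace ℝ E] {O : Set E} {i : U.ι} {g : E → Cn n}

theorem contDiffOn_mapForm {f : E → LocForm U W₁}
    (hf : ContDiffOn ℝ ∞ (fun t => f t i (g t)) O) :
    ContDiffOn ℝ ∞ (fun t => mapForm L (f t) i (g t)) O :=
  contDiffOn_const.clm_comp hf

theorem contDiffOn_mapSec {f : E → LocSec U W₁ W₂ N}
    (hf : ContDiffOn ℝ ∞ (fun t => f t i (g t)) O) :
    ContDiffOn ℝ ∞ (fun t => mapSec L' (f t) i (g t)) O :=
  contDiffOn_clm_comp (F := N →L[ℂ] (W₁ →L[ℂ] W₂)) (F' := N →L[ℂ] (W₃ →L[ℂ] W₄))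
    ((ContinuousLinearMap.compL ℂ N (W₁ →L[ℂ] W₂) (W₃ →L[ℂ] W₄) L').restrictScalars ℝ) hf

theorem differentiableAt_of_contDiffOn {F : Type*} [NormedAddCommGroup F] [NormedSpace ℝ F]
    {f : Cn n → F} (hf : ContDiffOn ℝ ∞ f (U.chart i).target) {e : Cn n}
    (he : e ∈ (U.chart i).target) : DifferentiableAt ℝ f e :=
  (hf.contDiffAt ((U.chart i).open_target.mem_nhds he)).differentiableAt (by simp)

end Maps

/-! ### The correspondence -/

section Correspondence

variable {V : Type*} [NormedAddCommGroup V] [InnerProductSpace ℂ V] [FiniteDimensional ℂ V]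
  {C : EpsForm V} {G : GenQuiver C}
  {n : ℕ} {X : Type*} [TopologicalSpace X] [ChartedSpace (Cn n) X] {U : HolCover n X}
  {N : Type*} [NormedAddCommGroup N] [InnerProductSpace ℂ N] {α : G.Summand}

namespace GenQuiver

/-- The 1-form with prescribed components at the vertices. -/
def asmForm (y : ∀ χ : Weight G.H, LocForm U (vertexSpace G χ)) : LocForm U V := fun i e =>
  ∑ χ, mapForm (G.expand χ χ) (y χ) i e

/-- The section with prescribed components along the arrows. -/
def asmSec (y : ∀ c : G.toSym.Arr α,
    LocSec U (vertexSpace G (G.toSym.tail c)) (vertexSpace G (G.toSym.head c)) N) :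
    LocSec U V V N := fun i e =>
  ∑ c : G.toSym.Arr α, mapSec (G.expand (G.toSym.tail c) (G.toSym.head c)) (y c) i e

theorem asmForm_apply (y : ∀ χ : Weight G.H, LocForm U (vertexSpace G χ)) (i : U.ι) (e u : Cn n) :
    asmForm y i e u = ∑ χ, G.expand χ χ (y χ i e u) :=
  sum_apply _ _ _

theorem asmSec_apply (y : ∀ c : G.toSym.Arr α,
    LocSec U (vertexSpace G (G.toSym.tail c)) (vertexSpace G (G.toSym.head c)) N)
    (i : U.ι) (e : Cn n) (m : N) : asmSec y i e m =
      ∑ c : G.toSym.Arr α, G.expand (G.toSym.tail c) (G.toSym.head c) (y c i e m) :=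
  sum_apply _ _ _

variable (G) in
/-- The 1-form `a` has the components `a'` at the vertices. -/
def FormComponents (a : LocForm U V) (a' : ∀ χ : Weight G.H, LocForm U (vertexSpace G χ)) : Prop :=
  ∀ χ i e u, Intertwines (G.incl χ) (G.incl χ) (a i e u) (a' χ i e u)

/-- The section `s` has the components `s'` along the arrows, and no other ones. -/
structure SecComponents (s : LocSec U V V N) (s' : ∀ c : G.toSym.Arr α,
    LocSec U (vertexSpace G (G.toSym.tail c)) (vertexSpace G (G.toSym.head c)) N) : Prop where
  inter : ∀ c i e m, Intertwines (G.incl (G.toSym.tail c)) (G.incl (G.toSym.head c))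
    (s i e m) (s' c i e m)
  zero : ∀ i e m χ, (∀ c : G.toSym.Arr α, G.toSym.tail c ≠ χ) →
    ∀ v ∈ vertexSpace G χ, s i e m v = 0

theorem formComponents_asmForm (hG : G.Adapted)
    (y : ∀ χ : Weight G.H, LocForm U (vertexSpace G χ)) : FormComponents G (asmForm y) y :=
  fun χ i e u => by
    rw [asmForm_apply]
    exact intertwines_sum_expand hG (t := id) (h := id) Function.injective_id
      (fun χ => y χ i e u) χ

theorem secComponents_asmSec (hG : G.Adapted) (y : ∀ c : G.toSym.Arr α,
    LocSec U (vertexSpace G (G.toSym.tail c)) (vertexSpace G (G.toSym.head c)) N) :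
    SecComponents (asmSec y) y where
  inter c i e m := by
    rw [asmSec_apply]
    exact intertwines_sum_expand hG (tail_injective α) (fun c => y c i e m) c
  zero i e m χ hχ := by
    rw [asmSec_apply]
    exact sum_expand_eq_zero hG (fun c : G.toSym.Arr α => y c i e m) hχ

theorem formComponents_block {a : LocForm U V} (ha : ∀ i e u, a i e u ∈ G.lieK) :
    FormComponents G a fun χ => blockForm (vertexSpace G χ) a := fun χ i e u =>
  G.intertwines_block (mapsTo_of_mem_lieK (ha i e u) χ)

theorem secComponents_block {s : LocSec U V V N} (hs : ∀ i e m, s i e m ∈ G.Z α) :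
    SecComponents s fun c : G.toSym.Arr α =>
      blockSec (vertexSpace G (G.toSym.tail c)) (vertexSpace G (G.toSym.head c)) s where
  inter c i e m := G.intertwines_block (mapsTo_of_mem_Z (hs i e m) c)
  zero i e m _ hχ := eq_zero_of_mem_Z (hs i e m) hχ

theorem FormComponents.block_eq {a : LocForm U V}
    {a' : ∀ χ : Weight G.H, LocForm U (vertexSpace G χ)} (h : FormComponents G a a')
    (χ : Weight G.H) : blockForm (vertexSpace G χ) a = a' χ := by
  funext i e
  ext1 u
  exact G.block_eq_of_intertwines (h χ i e u)

theorem FormComponents.unique {a b : LocForm U V}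
    {a' : ∀ χ : Weight G.H, LocForm U (vertexSpace G χ)} (ha : FormComponents G a a')
    (hb : FormComponents G b a') : a = b := by
  funext i e
  ext1 u
  exact G.ext_weight fun χ w => by rw [ha χ i e u, hb χ i e u]

theorem SecComponents.block_eq {s : LocSec U V V N} {s' : ∀ c : G.toSym.Arr α,
    LocSec U (vertexSpace G (G.toSym.tail c)) (vertexSpace G (G.toSym.head c)) N}
    (h : SecComponents s s') (c : G.toSym.Arr α) :
    blockSec (vertexSpace G (G.toSym.tail c)) (vertexSpace G (G.toSym.head c)) s = s' c := by
  funext i e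
  ext1 m
  exact G.block_eq_of_intertwines (h.inter c i e m)

/-- Two operators on `V` are equal if they agree on the tails of the arrows and on the remaining
isotypic components. -/
theorem ext_arrows {W : Type*} [NormedAddCommGroup W] [InnerProductSpace ℂ W]
    {S T : V →L[ℂ] W} (α : G.Summand)
    (h : ∀ (c : G.toSym.Arr α) w, S (G.incl (G.toSym.tail c) w) = T (G.incl (G.toSym.tail c) w))
    (h0 : ∀ χ, (∀ c : G.toSym.Arr α, G.toSym.tail c ≠ χ) →
      ∀ w, S (G.incl χ w) = T (G.incl χ w)) : S = T := by
  refine G.ext_weight fun χ w => ?_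
  by_cases hc : ∃ c : G.toSym.Arr α, G.toSym.tail c = χ
  · obtain ⟨c, rfl⟩ := hc
    exact h c w
  · push Not at hc
    exact h0 χ hc w

theorem SecComponents.unique {s t : LocSec U V V N} {s' : ∀ c : G.toSym.Arr α,
    LocSec U (vertexSpace G (G.toSym.tail c)) (vertexSpace G (G.toSym.head c)) N}
    (hs : SecComponents s s') (ht : SecComponents t s') : s = t := by
  funext i e
  ext1 m
  exact ext_arrows α (fun c w => by rw [hs.inter c i e m, ht.inter c i e m])
    fun χ hχ w => by rw [incl_apply, hs.zero i e m χ hχ _ w.2, ht.zero i e m χ hχ _ w.2]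

/-! ### Smoothness -/

section

variable {E' : Type*} [NormedAddCommGroup E'] [NormedSpace ℝ E'] {O : Set E'} {i : U.ι}
  {g : E' → Cn n}

theorem contDiffOn_asmForm {f : E' → ∀ χ : Weight G.H, LocForm U (vertexSpace G χ)}
    (hf : ∀ χ, ContDiffOn ℝ ∞ (fun t => f t χ i (g t)) O) :
    ContDiffOn ℝ ∞ (fun t => asmForm (f t) i (g t)) O :=
  ContDiffOn.sum fun χ _ => contDiffOn_mapForm (f := fun t => f t χ) _ (hf χ)

theorem contDiffOn_asmSec {f : E' → ∀ c : G.toSym.Arr α,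
    LocSec U (vertexSpace G (G.toSym.tail c)) (vertexSpace G (G.toSym.head c)) N}
    (hf : ∀ c, ContDiffOn ℝ ∞ (fun t => f t c i (g t)) O) :
    ContDiffOn ℝ ∞ (fun t => asmSec (f t) i (g t)) O :=
  ContDiffOn.sum fun c _ => contDiffOn_mapSec (f := fun t => f t c) _ (hf c)

end

/-! ### Connections and sections -/

variable (E : PrincipalBundle U V G.K)

/-- The bundle at a vertex, as a bundle with fibre `vertexSpace`. -/
abbrev fibreBundle (χ : Weight G.H) :
    PrincipalBundle U (vertexSpace G χ) (unitaryGroup (vertexSpace G χ)) :=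
  vertexBundle E χ

theorem intertwines_tr {i j : U.ι} {x : X}
    (hx : x ∈ (U.chart i).source ∩ (U.chart j).source) (χ : Weight G.H) :
    Intertwines (G.incl χ) (G.incl χ) (E.tr i j x) ((fibreBundle E χ).tr i j x) :=
  G.intertwines_block (G.mapsTo_of_mem_K (E.mem i j x hx) χ.1)

theorem overlap_mem {i j : U.ι} {e : Cn n} (he : e ∈ U.overlap i j) :
    (U.chart i).symm e ∈ (U.chart i).source ∩ (U.chart j).source :=
  ⟨U.symm_mem_source he, he.2⟩

theorem intertwines_fderiv_tr {i j : U.ι} {e : Cn n} (he : e ∈ U.overlap i j) (χ : Weight G.H)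
    (u : Cn n) : Intertwines (G.incl χ) (G.incl χ)
      (fderiv ℝ (fun e' => E.tr i j ((U.chart i).symm e')) e u)
      (fderiv ℝ (fun e' => (fibreBundle E χ).tr i j ((U.chart i).symm e')) e u) := by
  have ho := (U.isOpen_overlap i j).mem_nhds he
  refine Intertwines.fderiv (((E.smooth i j).contDiffAt ho).differentiableAt (by simp))
    ((((fibreBundle E χ).smooth i j).contDiffAt ho).differentiableAt (by simp)) ?_ u
  exact Filter.eventually_of_mem ho fun e' he' => intertwines_tr E (overlap_mem he') χ

variable {E}

theorem gauge_component {A : LocForm U V} {A' : ∀ χ : Weight G.H, LocForm U (vertexSpace G χ)}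
    (h : FormComponents G A A') {i j : U.ι} {e : Cn n} (he : e ∈ U.overlap i j) (u u' : Cn n)
    (χ : Weight G.H)
    (hg : E.tr i j ((U.chart i).symm e) * A j (U.trans i j e) u' =
      A i e u * E.tr i j ((U.chart i).symm e) +
        fderiv ℝ (fun e' => E.tr i j ((U.chart i).symm e')) e u) :
    (fibreBundle E χ).tr i j ((U.chart i).symm e) * A' χ j (U.trans i j e) u' =
      A' χ i e u *
        (fibreBundle E χ).tr i j ((U.chart i).symm e) +
        fderiv ℝ (fun e' => (fibreBundle E χ).tr i j ((U.chart i).symm e')) e u :=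
  Intertwines.eq_of_injective (G.incl_injective χ)
    ((intertwines_tr E (overlap_mem he) χ).comp (h χ j _ _))
    (((h χ i e u).comp (intertwines_tr E (overlap_mem he) χ)).add (intertwines_fderiv_tr E he χ u))
    hg

theorem adGauge_component {A : LocForm U V} {A' : ∀ χ : Weight G.H, LocForm U (vertexSpace G χ)}
    (h : FormComponents G A A') {i j : U.ι} {e : Cn n} (he : e ∈ U.overlap i j) (u u' : Cn n)
    (χ : Weight G.H)
    (hg : E.tr i j ((U.chart i).symm e) * A j (U.trans i j e) u' =
      A i e u * E.tr i j ((U.chart i).symm e)) :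
    (fibreBundle E χ).tr i j ((U.chart i).symm e) * A' χ j (U.trans i j e) u' =
      A' χ i e u *
        (fibreBundle E χ).tr i j ((U.chart i).symm e) :=
  Intertwines.eq_of_injective (G.incl_injective χ)
    ((intertwines_tr E (overlap_mem he) χ).comp (h χ j _ _))
    ((h χ i e u).comp (intertwines_tr E (overlap_mem he) χ)) hg

theorem isConnection_block {A : LocForm U V} (hA : IsConnection E G.lieK A) (χ : Weight G.H) :
    IsConnection (fibreBundle E χ) (unitaryLie (vertexSpace G χ))
      (blockForm (vertexSpace G χ) A) where
  zero_off i e he := mapForm_eq_zero _ (hA.zero_off i e he)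
  mem_lie i e u := block_mem_unitaryLie (hA.mem_lie i e u) χ
  smooth i := contDiffOn_mapForm (f := fun _ => A) (g := id) _ (hA.smooth i)
  gauge i j e he u := gauge_component (formComponents_block hA.mem_lie) he u _ χ
    (hA.gauge i j e he u)

theorem isAdForm_block {a : LocForm U V} (ha : IsAdForm E G.lieK a) (χ : Weight G.H) :
    IsAdForm (fibreBundle E χ) (unitaryLie (vertexSpace G χ))
      (blockForm (vertexSpace G χ) a) where
  zero_off i e he := mapForm_eq_zero _ (ha.zero_off i e he)
  mem_lie i e u := block_mem_unitaryLie (ha.mem_lie i e u) χ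
  smooth i := contDiffOn_mapForm (f := fun _ => a) (g := id) _ (ha.smooth i)
  gauge i j e he u := adGauge_component (formComponents_block ha.mem_lie) he u _ χ
    (ha.gauge i j e he u)

variable {y : ∀ χ : Weight G.H, LocForm U (vertexSpace G χ)}

theorem asmForm_mem_lieK (hG : G.Adapted)
    (hu : ∀ χ i e u, y χ i e u ∈ unitaryLie (vertexSpace G χ))
    (hc : CompatForm G.toSym C (vertexSpace G) y) (i : U.ι) (e u : Cn n) :
    asmForm y i e u ∈ G.lieK :=
  mem_lieK_of_blocks hG (fun χ => formComponents_asmForm hG y χ i e u) (fun χ => hu χ i e u)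
    fun χ => hc χ i e u

theorem asmForm_zero_off {i : U.ι} {e : Cn n} (h : ∀ χ, y χ i e = 0) : asmForm y i e = 0 :=
  Finset.sum_eq_zero fun χ _ => mapForm_eq_zero _ (h χ)

theorem isConnection_asmForm (hG : G.Adapted)
    (hy : ∀ χ, IsConnection (fibreBundle E χ) (unitaryLie (vertexSpace G χ)) (y χ))
    (hc : CompatForm G.toSym C (vertexSpace G) y) : IsConnection E G.lieK (asmForm y) where
  zero_off i e he := asmForm_zero_off fun χ => (hy χ).zero_off i e he
  mem_lie i e u := asmForm_mem_lieK hG (fun χ => (hy χ).mem_lie) hc i e u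
  smooth i := contDiffOn_asmForm (f := fun _ => y) (g := id) fun χ => (hy χ).smooth i
  gauge i j e he u := G.ext_weight fun χ => by
    have hc := formComponents_asmForm hG y
    have ht := intertwines_tr E (overlap_mem he) χ
    exact Intertwines.apply_eq (ht.comp (hc χ j _ _))
      (((hc χ i e u).comp ht).add (intertwines_fderiv_tr E he χ u)) ((hy χ).gauge i j e he u)

theorem isAdForm_asmForm (hG : G.Adapted)
    (hy : ∀ χ, IsAdForm (fibreBundle E χ) (unitaryLie (vertexSpace G χ)) (y χ))
    (hc : CompatForm G.toSym C (vertexSpace G) y) : IsAdForm E G.lieK (asmForm y) where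
  zero_off i e he := asmForm_zero_off fun χ => (hy χ).zero_off i e he
  mem_lie i e u := asmForm_mem_lieK hG (fun χ => (hy χ).mem_lie) hc i e u
  smooth i := contDiffOn_asmForm (f := fun _ => y) (g := id) fun χ => (hy χ).smooth i
  gauge i j e he u := G.ext_weight fun χ => by
    have hc := formComponents_asmForm hG y
    have ht := intertwines_tr E (overlap_mem he) χ
    exact Intertwines.apply_eq (ht.comp (hc χ j _ _)) ((hc χ i e u).comp ht)
      ((hy χ).gauge i j e he u)

/-- Applied to the curvature and to `d_A a`, both of which have as blocks the same expressions in
the blocks of `A` and `a`. -/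
theorem isType11_iff {β : ∀ _ : U.ι, Cn n → Cn n → Cn n → (V →L[ℂ] V)}
    {β' : ∀ (χ : Weight G.H) (_ : U.ι), Cn n → Cn n → Cn n →
      (vertexSpace G χ →L[ℂ] vertexSpace G χ)}
    (h : ∀ χ i, ∀ e ∈ (U.chart i).target, ∀ u v,
      Intertwines (G.incl χ) (G.incl χ) (β i e u v) (β' χ i e u v)) :
    IsType11 β ↔ ∀ χ, IsType11 (β' χ) :=
  ⟨fun hβ χ i e he u v => Intertwines.eq_of_injective (G.incl_injective χ) (h χ i e he _ _)
    (h χ i e he _ _) (hβ i e he u v), fun hβ i e he u v => G.ext_weight fun χ =>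
      Intertwines.apply_eq (h χ i e he _ _) (h χ i e he _ _) (hβ χ i e he u v)⟩

theorem isType11_curv_iff {A : LocForm U V} {A' : ∀ χ : Weight G.H, LocForm U (vertexSpace G χ)}
    (h : FormComponents G A A') (hA : ∀ i, ContDiffOn ℝ ∞ (A i) (U.chart i).target)
    (hA' : ∀ χ i, ContDiffOn ℝ ∞ (A' χ i) (U.chart i).target) :
    IsType11 (curv A) ↔ ∀ χ, IsType11 (curv (A' χ)) :=
  isType11_iff fun χ i _ he => Intertwines.curv (differentiableAt_of_contDiffOn (hA i) he)
    (differentiableAt_of_contDiffOn (hA' χ i) he) (h χ i)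

theorem isType11_covExtDeriv_iff {A a : LocForm U V}
    {A' a' : ∀ χ : Weight G.H, LocForm U (vertexSpace G χ)}
    (hA : FormComponents G A A') (h : FormComponents G a a')
    (ha : ∀ i, ContDiffOn ℝ ∞ (a i) (U.chart i).target)
    (ha' : ∀ χ i, ContDiffOn ℝ ∞ (a' χ i) (U.chart i).target) :
    IsType11 (covExtDeriv A a) ↔ ∀ χ, IsType11 (covExtDeriv (A' χ) (a' χ)) :=
  isType11_iff fun χ i _ he => Intertwines.covExtDeriv
    (differentiableAt_of_contDiffOn (ha i) he) (differentiableAt_of_contDiffOn (ha' χ i) he)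
    (hA χ i) (h χ i)

variable {K : Set (N →L[ℂ] N)} {F : PrincipalBundle U N K}

variable {z : ∀ c : G.toSym.Arr α,
  LocSec U (vertexSpace G (G.toSym.tail c)) (vertexSpace G (G.toSym.head c)) N}

theorem secGauge_component {s : LocSec U V V N} (h : SecComponents s z) {i j : U.ι} {e : Cn n}
    (he : e ∈ U.overlap i j) (m m' : N) (c : G.toSym.Arr α)
    (hg : (s i e m').comp (E.tr i j ((U.chart i).symm e)) =
      (E.tr i j ((U.chart i).symm e)).comp (s j (U.trans i j e) m)) :
    (z c i e m').comp ((fibreBundle E (G.toSym.tail c)).tr i j ((U.chart i).symm e)) =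
      ((fibreBundle E (G.toSym.head c)).tr i j ((U.chart i).symm e)).comp
        (z c j (U.trans i j e) m) :=
  Intertwines.eq_of_injective (G.incl_injective _)
    ((h.inter c i e _).comp (intertwines_tr E (overlap_mem he) (G.toSym.tail c)))
    ((intertwines_tr E (overlap_mem he) (G.toSym.head c)).comp (h.inter c j _ m)) hg

theorem isSection_block {s : LocSec U V V N} (hs : IsSection E E F s)
    (hZ : ∀ i e m, s i e m ∈ G.Z α) (c : G.toSym.Arr α) :
    IsSection (fibreBundle E (G.toSym.tail c)) (fibreBundle E (G.toSym.head c)) F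
      (blockSec (vertexSpace G (G.toSym.tail c)) (vertexSpace G (G.toSym.head c)) s) where
  zero_off i e he := mapSec_eq_zero _ (hs.zero_off i e he)
  smooth i := contDiffOn_mapSec (f := fun _ => s) (g := id) _ (hs.smooth i)
  gauge i j e he m := secGauge_component (secComponents_block hZ) he m _ c (hs.gauge i j e he m)

theorem isSection_asmSec (hG : G.Adapted)
    (hz : ∀ c, IsSection (fibreBundle E (G.toSym.tail c)) (fibreBundle E (G.toSym.head c)) F
      (z c)) : IsSection E E F (asmSec z) where
  zero_off i e he := Finset.sum_eq_zero fun c _ => mapSec_eq_zero _ ((hz c).zero_off i e he)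
  smooth i := contDiffOn_asmSec (f := fun _ => z) (g := id) fun c => (hz c).smooth i
  gauge i j e he m := by
    have hc := secComponents_asmSec hG z
    refine ext_arrows α (fun c => ?_) fun χ hχ w => ?_
    · have h1 := intertwines_tr E (overlap_mem he) (G.toSym.tail c)
      have h2 := intertwines_tr E (overlap_mem he) (G.toSym.head c)
      exact Intertwines.apply_eq ((hc.inter c i e _).comp h1) (h2.comp (hc.inter c j _ m))
        ((hz c).gauge i j e he m)
    -- Off the tails both sides vanish, because the cocycle preserves each isotypic component.
    · have h1 := intertwines_tr E (overlap_mem he) χ w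
      rw [ContinuousLinearMap.comp_apply, ContinuousLinearMap.comp_apply, h1, incl_apply,
        incl_apply, hc.zero i e _ χ hχ _ (Subtype.mem _), hc.zero j _ _ χ hχ _ w.2, map_zero]

theorem isHol_iff {A : LocForm U V} {A' : ∀ χ : Weight G.H, LocForm U (vertexSpace G χ)}
    (hA : FormComponents G A A') (B : LocForm U N) {s : LocSec U V V N}
    (h : SecComponents s z) (hs : ∀ i, ContDiffOn ℝ ∞ (s i) (U.chart i).target)
    (hz : ∀ c i, ContDiffOn ℝ ∞ (z c i) (U.chart i).target) :
    IsHol A A B s ↔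
      ∀ c : G.toSym.Arr α, IsHol (A' (G.toSym.tail c)) (A' (G.toSym.head c)) B (z c) := by
  have key : ∀ (c : G.toSym.Arr α) i, ∀ e ∈ (U.chart i).target, ∀ u m,
      Intertwines (G.incl (G.toSym.tail c)) (G.incl (G.toSym.head c)) (covDeriv A A B s i e u m)
        (covDeriv (A' (G.toSym.tail c)) (A' (G.toSym.head c)) B (z c) i e u m) :=
    fun c i e he => Intertwines.covDeriv (differentiableAt_of_contDiffOn (hs i) he)
      (differentiableAt_of_contDiffOn (hz c i) he) (hA _ i e) (hA _ i e) (h.inter c i)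
  constructor
  · intro hh c i e he u m
    exact Intertwines.eq_of_injective (G.incl_injective _) (key c i e he _ m)
      ((key c i e he u m).smul _) (hh i e he u m)
  · intro hh i e he u m
    refine ext_arrows α (fun c => ?_) fun χ hχ w => ?_
    · exact Intertwines.apply_eq (key c i e he _ m) ((key c i e he u m).smul _) (hh c i e he u m)
    -- Vanishing of `s` on `V_χ` is expressed as intertwining with second map `0`. The rule for
    -- covariant derivatives then shows that the derivative of `s` vanishes on `V_χ` too.
    · let z₀ : LocSec U (vertexSpace G χ) V N := fun _ _ => 0
      have h1 : ∀ e m, Intertwines (G.incl χ) (0 : V →L[ℂ] V) (s i e m) (z₀ i e m) :=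
        fun e m w => h.zero i e m χ hχ _ w.2
      have h0 : ∀ u, Intertwines (G.incl χ) (0 : V →L[ℂ] V) (covDeriv A A B s i e u m)
          (covDeriv (A' χ) A B z₀ i e u m) := fun u =>
        Intertwines.covDeriv (differentiableAt_of_contDiffOn (hs i) he)
          (differentiableAt_const _) (hA χ i e) (fun u w => map_zero _) h1 u m
      rw [h0 _ w, smul_apply, h0 u w]
      simp

end GenQuiver

end Correspondence

/-! ### Linear structure on forms and sections -/

section Calculus

variable {D F : Type*} [NormedAddCommGroup D] [NormedSpace ℝ D] [NormedAddCommGroup F]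
  [NormedSpace ℝ F]

theorem fderiv_zero_apply (e u v : D) :
    fderiv ℝ (fun _ : D => (0 : D →L[ℝ] F)) e u v = 0 := by
  rw [fderiv_fun_const]
  rfl

theorem fderiv_add_apply {f g : D → D →L[ℝ] F} {e : D} (hf : DifferentiableAt ℝ f e)
    (hg : DifferentiableAt ℝ g e) (u v : D) :
    fderiv ℝ (fun e' => f e' + g e') e u v = fderiv ℝ f e u v + fderiv ℝ g e u v := by
  rw [fderiv_fun_add hf hg]
  rfl

theorem fderiv_smul_apply {f : D → D →L[ℝ] F} {e : D} (hf : DifferentiableAt ℝ f e) (r : ℝ)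
    (u v : D) : fderiv ℝ (fun e' => r • f e') e u v = r • fderiv ℝ f e u v := by
  rw [fderiv_fun_const_smul hf]
  rfl

theorem contDiffOn_smul_real {f : D → F} {s : Set D} (r : ℝ) (hf : ContDiffOn ℝ ∞ f s) :
    ContDiffOn ℝ ∞ (fun e => r • f e) s :=
  contDiffOn_const.smul hf

theorem contDiffOn_smul_complex [NormedSpace ℂ F] [IsScalarTower ℝ ℂ F] {f : D → F} {s : Set D}
    (c : ℂ) (hf : ContDiffOn ℝ ∞ f s) : ContDiffOn ℝ ∞ (fun e => c • f e) s :=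
  contDiffOn_const.smul hf

end Calculus

section Linear

variable {n : ℕ} {X : Type*} [TopologicalSpace X] [ChartedSpace (Cn n) X] {U : HolCover n X}
  {W W₁ W₂ N : Type*}
  [NormedAddCommGroup W] [InnerProductSpace ℂ W]
  [NormedAddCommGroup W₁] [InnerProductSpace ℂ W₁] [NormedAddCommGroup W₂] [InnerProductSpace ℂ W₂]
  [NormedAddCommGroup N] [InnerProductSpace ℂ N]

theorem LocForm.add_apply (a b : LocForm U W) (i : U.ι) (e : Cn n) :
    (a + b) i e = a i e + b i e := rfl

theorem LocForm.smul_apply (r : ℝ) (a : LocForm U W) (i : U.ι) (e : Cn n) :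
    (r • a) i e = r • a i e := rfl

theorem LocForm.zero_apply (i : U.ι) (e : Cn n) : (0 : LocForm U W) i e = 0 := rfl

theorem LocSec.add_apply (a b : LocSec U W₁ W₂ N) (i : U.ι) (e : Cn n) :
    (a + b) i e = a i e + b i e := rfl

theorem LocSec.smul_apply (r : ℝ) (a : LocSec U W₁ W₂ N) (i : U.ι) (e : Cn n) :
    (r • a) i e = r • a i e := rfl

theorem LocSec.zero_apply (i : U.ι) (e : Cn n) : (0 : LocSec U W₁ W₂ N) i e = 0 := rfl

variable {K : Set (W →L[ℂ] W)} {P : PrincipalBundle U W K} {𝔨 : Set (W →L[ℂ] W)}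

theorem IsAdForm.zero (h𝔨 : (0 : W →L[ℂ] W) ∈ 𝔨) : IsAdForm P 𝔨 0 where
  zero_off i e he := rfl
  mem_lie i e u := h𝔨
  smooth i := contDiffOn_const
  gauge i j e he u := by
    rw [LocForm.zero_apply, LocForm.zero_apply]
    show P.tr i j _ * 0 = 0 * P.tr i j _
    rw [mul_zero, zero_mul]

theorem IsAdForm.add {a b : LocForm U W} (h𝔨 : ∀ S ∈ 𝔨, ∀ T ∈ 𝔨, S + T ∈ 𝔨)
    (ha : IsAdForm P 𝔨 a) (hb : IsAdForm P 𝔨 b) : IsAdForm P 𝔨 (a + b) where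
  zero_off i e he := by
    rw [LocForm.add_apply, ha.zero_off i e he, hb.zero_off i e he, add_zero]
  mem_lie i e u := h𝔨 _ (ha.mem_lie i e u) _ (hb.mem_lie i e u)
  smooth i := (ha.smooth i).add (hb.smooth i)
  gauge i j e he u := by
    rw [LocForm.add_apply, LocForm.add_apply, _root_.add_apply,
      _root_.add_apply, mul_add, add_mul, ha.gauge i j e he, hb.gauge i j e he]

theorem IsAdForm.smul {a : LocForm U W} (r : ℝ) (h𝔨 : ∀ T ∈ 𝔨, r • T ∈ 𝔨)
    (ha : IsAdForm P 𝔨 a) : IsAdForm P 𝔨 (r • a) where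
  zero_off i e he := by
    rw [LocForm.smul_apply, ha.zero_off i e he]
    exact ContinuousLinearMap.ext fun u => smul_zero r
  mem_lie i e u := h𝔨 _ (ha.mem_lie i e u)
  smooth i := contDiffOn_smul_real (F := Cn n →L[ℝ] (W →L[ℂ] W)) r (ha.smooth i)
  gauge i j e he u := by
    rw [LocForm.smul_apply, LocForm.smul_apply, _root_.smul_apply,
      _root_.smul_apply, mul_smul_comm, smul_mul_assoc, ha.gauge i j e he]

theorem isType11_covExtDeriv_zero (A : LocForm U W) : IsType11 (covExtDeriv A 0) := by
  have h : ∀ i e u v, covExtDeriv A 0 i e u v = 0 := by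
    intro i e u v
    have h1 : ∀ u v, fderiv ℝ ((0 : LocForm U W) i) e u v = 0 :=
      fderiv_zero_apply (F := W →L[ℂ] W) e
    simp [covExtDeriv, h1, LocForm.zero_apply]
  intro i e _ u v
  rw [h, h]

theorem covExtDeriv_add {A a b : LocForm U W} {i : U.ι} {e : Cn n}
    (ha : DifferentiableAt ℝ (a i) e) (hb : DifferentiableAt ℝ (b i) e) (u v : Cn n) :
    covExtDeriv A (a + b) i e u v = covExtDeriv A a i e u v + covExtDeriv A b i e u v := by
  have h1 : ∀ u v, fderiv ℝ ((a + b) i) e u v = fderiv ℝ (a i) e u v + fderiv ℝ (b i) e u v :=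
    fderiv_add_apply (F := W →L[ℂ] W) (f := a i) (g := b i) ha hb
  simp only [covExtDeriv, h1, LocForm.add_apply, _root_.add_apply, mul_add, add_mul]
  abel

theorem covExtDeriv_smul {A a : LocForm U W} {i : U.ι} {e : Cn n} (r : ℝ)
    (ha : DifferentiableAt ℝ (a i) e) (u v : Cn n) :
    covExtDeriv A (r • a) i e u v = r • covExtDeriv A a i e u v := by
  have h1 : ∀ u v, fderiv ℝ ((r • a) i) e u v = r • fderiv ℝ (a i) e u v :=
    fderiv_smul_apply (F := W →L[ℂ] W) (f := a i) ha r
  simp only [covExtDeriv, h1, LocForm.smul_apply, _root_.smul_apply, mul_smul_comm,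
    smul_mul_assoc, smul_add, smul_sub]

theorem isType11_covExtDeriv_add {A a b : LocForm U W} (ha : IsAdForm P 𝔨 a)
    (hb : IsAdForm P 𝔨 b) (h : IsType11 (covExtDeriv A a)) (h' : IsType11 (covExtDeriv A b)) :
    IsType11 (covExtDeriv A (a + b)) := fun i e he u v => by
  have h1 := differentiableAt_of_contDiffOn (ha.smooth i) he
  have h2 := differentiableAt_of_contDiffOn (hb.smooth i) he
  rw [covExtDeriv_add h1 h2, covExtDeriv_add h1 h2, h i e he, h' i e he]

theorem isType11_covExtDeriv_smul {A a : LocForm U W} (r : ℝ) (ha : IsAdForm P 𝔨 a)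
    (h : IsType11 (covExtDeriv A a)) : IsType11 (covExtDeriv A (r • a)) := fun i e he u v => by
  have h1 := differentiableAt_of_contDiffOn (ha.smooth i) he
  rw [covExtDeriv_smul r h1, covExtDeriv_smul r h1, h i e he]

variable {K₁ : Set (W₁ →L[ℂ] W₁)} {K₂ : Set (W₂ →L[ℂ] W₂)} {K' : Set (N →L[ℂ] N)}
  {P₁ : PrincipalBundle U W₁ K₁} {P₂ : PrincipalBundle U W₂ K₂} {F : PrincipalBundle U N K'}

theorem IsSection.add {s t : LocSec U W₁ W₂ N} (hs : IsSection P₁ P₂ F s)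
    (ht : IsSection P₁ P₂ F t) : IsSection P₁ P₂ F (s + t) where
  zero_off i e he := by
    rw [LocSec.add_apply, hs.zero_off i e he, ht.zero_off i e he, add_zero]
  smooth i := (hs.smooth i).add (ht.smooth i)
  gauge i j e he m := by
    rw [LocSec.add_apply, LocSec.add_apply, _root_.add_apply,
      _root_.add_apply, ContinuousLinearMap.add_comp, ContinuousLinearMap.comp_add,
      hs.gauge i j e he, ht.gauge i j e he]

/-- Multiplication of a local section by a complex number. -/
def LocSec.csmul (c : ℂ) (s : LocSec U W₁ W₂ N) : LocSec U W₁ W₂ N := fun i e => c • s i e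

theorem LocSec.csmul_apply (c : ℂ) (s : LocSec U W₁ W₂ N) (i : U.ι) (e : Cn n) :
    LocSec.csmul c s i e = c • s i e := rfl

theorem LocSec.smul_eq_csmul (r : ℝ) (s : LocSec U W₁ W₂ N) : r • s = LocSec.csmul (r : ℂ) s := by
  funext i e
  exact (Complex.coe_smul r (s i e)).symm

theorem IsSection.csmul {s : LocSec U W₁ W₂ N} (c : ℂ) (hs : IsSection P₁ P₂ F s) :
    IsSection P₁ P₂ F (LocSec.csmul c s) where
  zero_off i e he := by
    rw [LocSec.csmul_apply, hs.zero_off i e he]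
    exact ContinuousLinearMap.ext fun u => smul_zero c
  smooth i := contDiffOn_smul_complex (F := N →L[ℂ] (W₁ →L[ℂ] W₂)) c (hs.smooth i)
  gauge i j e he m := by
    rw [LocSec.csmul_apply, LocSec.csmul_apply, _root_.smul_apply,
      _root_.smul_apply, ContinuousLinearMap.smul_comp, ContinuousLinearMap.comp_smul,
      hs.gauge i j e he]

theorem IsSection.zero : IsSection P₁ P₂ F 0 where
  zero_off i e he := rfl
  smooth i := contDiffOn_const
  gauge i j e he m := by
    rw [LocSec.zero_apply, LocSec.zero_apply]
    show (0 : W₁ →L[ℂ] W₂).comp _ = ContinuousLinearMap.comp _ 0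
    rw [ContinuousLinearMap.zero_comp, ContinuousLinearMap.comp_zero]

end Linear

/-! ### Transport of symplectic forms -/

section Transport

variable {𝓔₁ 𝓔₂ : Type*} [AddCommGroup 𝓔₁] [Module ℝ 𝓔₁] [AddCommGroup 𝓔₂] [Module ℝ 𝓔₂]

/-- Nondegeneracy moves along a linear isomorphism of tangent spaces that preserves the forms,
whatever the signs of the coefficients in the target form. -/
theorem FormSpace.IsSymplectic.transport {S₁ : FormSpace 𝓔₁} {S₂ : FormSpace 𝓔₂}
    (h : S₁.IsSymplectic) {L : 𝓔₁ →ₗ[ℝ] 𝓔₂} (hc : Set.BijOn L S₁.carrier S₂.carrier)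
    (ht : ∀ x ∈ S₁.carrier, Set.BijOn L (S₁.tangent x) (S₂.tangent (L x)))
    (hf : ∀ x ∈ S₁.carrier, ∀ u ∈ S₁.tangent x, ∀ v ∈ S₁.tangent x,
      S₂.form (L u) (L v) = S₁.form u v) : S₂.IsSymplectic := by
  intro y hy
  obtain ⟨x, hx, rfl⟩ := hc.surjOn hy
  obtain ⟨T, B, hT, hB, halt, hnd⟩ := h x hx
  have hinj : Function.Injective (L.domRestrict T) := by
    intro u v huv
    exact Subtype.ext ((ht x hx).injOn (hT ▸ u.2) (hT ▸ v.2) huv)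
  let e := LinearEquiv.ofInjective (L.domRestrict T) hinj
  have he : ∀ u : T, (e u : 𝓔₂) = L u := fun _ => rfl
  refine ⟨LinearMap.range (L.domRestrict T),
    B.compl₁₂ (e.symm : _ →ₗ[ℝ] T) (e.symm : _ →ₗ[ℝ] T), ?_, ?_, ?_, ?_⟩
  · rw [← (ht x hx).image_eq, ← hT]
    ext z
    constructor
    · rintro ⟨u, rfl⟩
      exact ⟨u, u.2, rfl⟩
    · rintro ⟨u, hu, rfl⟩
      exact ⟨⟨u, hu⟩, rfl⟩
  · intro u v
    obtain ⟨u, rfl⟩ := e.surjective u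
    obtain ⟨v, rfl⟩ := e.surjective v
    show B (e.symm (e u)) (e.symm (e v)) = _
    rw [e.symm_apply_apply, e.symm_apply_apply, hB, he, he]
    exact (hf x hx u (hT ▸ u.2) v (hT ▸ v.2)).symm
  · intro u
    exact halt (e.symm u)
  · intro u hu
    rw [← e.symm.map_eq_zero_iff]
    refine hnd _ fun v => ?_
    have := hu (e v)
    rwa [LinearMap.compl₁₂_apply, LinearEquiv.coe_coe, e.symm_apply_apply] at this

end Transport

/-! ### The generalized quiver side -/

section GenSide

variable {V : Type*} [NormedAddCommGroup V] [InnerProductSpace ℂ V] [FiniteDimensional ℂ V]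
  {C : EpsForm V} {G : GenQuiver C}
  {n : ℕ} {X : Type*} [TopologicalSpace X] [ChartedSpace (Cn n) X] {U : HolCover n X}

namespace GenQuiver

theorem zero_mem_lieK : (0 : V →L[ℂ] V) ∈ G.lieK :=
  ⟨fun v w => by simp, zero_mem _, fun h _ => by rw [zero_mul, mul_zero]⟩

theorem add_mem_lieK (S : V →L[ℂ] V) (hS : S ∈ G.lieK) (T : V →L[ℂ] V) (hT : T ∈ G.lieK) :
    S + T ∈ G.lieK := by
  refine ⟨fun v w => ?_, add_mem hS.2.1 hT.2.1, fun h hh => ?_⟩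
  · have h1 := hS.1 v w
    have h2 := hT.1 v w
    rw [add_apply, add_apply, inner_add_left, inner_add_right]
    linear_combination h1 + h2
  · rw [add_mul, mul_add, hS.2.2 h hh, hT.2.2 h hh]

theorem smul_mem_lieK (r : ℝ) (T : V →L[ℂ] V) (hT : T ∈ G.lieK) : r • T ∈ G.lieK := by
  rw [← Complex.coe_smul]
  refine ⟨fun v w => ?_, Submodule.smul_mem _ _ hT.2.1, fun h hh => ?_⟩
  · have h1 := hT.1 v w
    rw [smul_apply, smul_apply, inner_smul_left, inner_smul_right, Complex.conj_ofReal]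
    linear_combination (r : ℂ) * h1
  · rw [smul_mul_assoc, mul_smul_comm, hT.2.2 h hh]

/-- For `w` in `V_σ(χ)` the vector `Tw` stays in `V_σ(χ)` and pairs only with `V_χ`, where skewness
moves `T` to the argument that it kills. -/
theorem eq_zero_on_dual {T : V →L[ℂ] V} (hT : T ∈ G.lieK) {χ : Weight G.H}
    (h : ∀ v ∈ vertexSpace G χ, T v = 0) : ∀ w ∈ vertexSpace G (G.dual χ), T w = 0 := by
  intro w hw
  refine C.nondeg _ fun v => ?_
  rw [C.symm]
  refine mul_eq_zero_of_right _ ?_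
  refine G.induction_weight (p := fun v => C.form v (T w) = 0) (by simp)
    (fun a b ha hb => by rw [map_add, LinearMap.add_apply, ha, hb, add_zero]) (fun μ v hv => ?_) v
  by_cases hμ : μ = χ
  · subst hμ
    have := hT.2.1 v w
    rwa [h v hv, map_zero, LinearMap.zero_apply, zero_add] at this
  · exact G.form_eq_zero_of_ne (fun h => hμ (by rw [← G.dual_dual μ, ← h, G.dual_dual])) hv
      (mapsTo_of_mem_lieK hT _ w hw)

theorem K_subset : G.K ⊆ unitaryGroup V := fun _ h => h.1

/-- The vertices are the disjoint union of `S`, its dual and the fixed ones; folding the dual half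
onto `S` adds the two parameters of each pair. -/
theorem sum_vertices {S : Finset (Weight G.H)} (hS : ∀ χ ∈ S, G.dual χ ≠ χ)
    (hS' : ∀ χ, G.dual χ ≠ χ → (χ ∈ S ↔ G.dual χ ∉ S)) {a b p f : Weight G.H → ℝ}
    (hpa : ∀ χ ∈ S, p χ + p (G.dual χ) = a χ) (hpb : ∀ χ, G.dual χ = χ → p χ = b χ)
    (hf : ∀ χ, f (G.dual χ) = f χ) [DecidablePred fun χ => G.dual χ = χ] :
    ∑ χ, p χ * f χ = ∑ χ ∈ S, a χ * f χ +
      ∑ χ ∈ Finset.univ.filter (fun χ => G.dual χ = χ), b χ * f χ := by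
  classical
  rw [← Finset.sum_filter_add_sum_filter_not Finset.univ (fun χ => G.dual χ = χ), add_comm]
  congr 1
  · rw [← Finset.sum_filter_add_sum_filter_not _ (fun χ => χ ∈ S)]
    have h1 : (Finset.univ.filter fun χ => ¬G.dual χ = χ).filter (fun χ => χ ∈ S) = S := by
      ext χ
      simp only [Finset.mem_filter, Finset.mem_univ, true_and]
      exact ⟨fun h => h.2, fun h => ⟨hS χ h, h⟩⟩
    have h2 : ∑ χ ∈ (Finset.univ.filter fun χ => ¬G.dual χ = χ).filter (fun χ => χ ∉ S),
        p χ * f χ = ∑ χ ∈ S, p (G.dual χ) * f χ := by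
      have hd : ∀ χ, G.dual χ ≠ χ → G.dual (G.dual χ) ≠ G.dual χ := fun χ h => by
        rw [G.dual_dual]
        exact h.symm
      refine Finset.sum_nbij' G.dual G.dual (fun χ hχ => ?_) (fun χ hχ => ?_)
        (fun χ _ => G.dual_dual χ) (fun χ _ => G.dual_dual χ) fun χ _ => ?_
      · simp only [Finset.mem_filter, Finset.mem_univ, true_and] at hχ
        rw [hS' _ (hd χ hχ.1), G.dual_dual]
        exact hχ.2
      · simp only [Finset.mem_filter, Finset.mem_univ, true_and]
        exact ⟨hd χ (hS χ hχ), (hS' χ (hS χ hχ)).1 hχ⟩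
      · rw [G.dual_dual, hf]
    rw [h1, h2, ← Finset.sum_add_distrib]
    refine Finset.sum_congr rfl fun χ hχ => ?_
    rw [← hpa χ hχ]
    ring
  · refine Finset.sum_congr rfl fun χ hχ => ?_
    rw [hpb χ (Finset.mem_filter.1 hχ).2]

variable [CompactSpace X] [MeasurableSpace X] (κ : KahlerMetric n X)

theorem atiyahBott_dual {u v : LocForm U V} (hu : ∀ i e w, u i e w ∈ G.lieK)
    (hv : ∀ i e w, v i e w ∈ G.lieK) (χ : Weight G.H) :
    atiyahBott κ (blockForm (vertexSpace G (G.dual χ)) u)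
        (blockForm (vertexSpace G (G.dual χ)) v) =
      atiyahBott κ (blockForm (vertexSpace G χ) u) (blockForm (vertexSpace G χ) v) := by
  have key : ∀ i e w w', traceL _ (blockForm (vertexSpace G (G.dual χ)) u i e w *
      blockForm (vertexSpace G (G.dual χ)) v i e w') =
      traceL _ (blockForm (vertexSpace G χ) u i e w * blockForm (vertexSpace G χ) v i e w') :=
    fun i e w w' => traceL_dual (block_compat (hu i e w) χ) (block_compat (hv i e w') χ)
  have key' : ∀ i e, wedgeTrace (blockForm (vertexSpace G (G.dual χ)) u i e)
      (blockForm (vertexSpace G (G.dual χ)) v i e) =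
      wedgeTrace (blockForm (vertexSpace G χ) u i e) (blockForm (vertexSpace G χ) v i e) := by
    intro i e
    refine LinearMap.ext fun w => LinearMap.ext fun w' => ?_
    rw [wedgeTrace_apply, wedgeTrace_apply, key, key]
  simp only [atiyahBott_eq, abIntegrand, key']

variable (M : G.Summand → Type*) [∀ α, NormedAddCommGroup (M α)] [∀ α, InnerProductSpace ℂ (M α)]
  [∀ α, FiniteDimensional ℂ (M α)] (E : PrincipalBundle U V G.K)
  (F : ∀ α, PrincipalBundle U (M α) (unitaryGroup (M α)))

/-- The tangent space of the space of pairs, as a real vector space. -/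
def genTangent (A : LocForm U V) : Submodule ℝ (GenAmbient G M U) where
  carrier := {y | (IsAdForm E G.lieK y.1 ∧ IsType11 (covExtDeriv A y.1)) ∧
    ∀ α, IsSection E E (F α) (y.2 α) ∧ ∀ i e m, y.2 α i e m ∈ G.Z α}
  add_mem' := fun {x y} hx hy => ⟨⟨hx.1.1.add add_mem_lieK hy.1.1,
    isType11_covExtDeriv_add hx.1.1 hy.1.1 hx.1.2 hy.1.2⟩, fun α =>
      ⟨(hx.2 α).1.add (hy.2 α).1, fun i e m => add_mem ((hx.2 α).2 i e m) ((hy.2 α).2 i e m)⟩⟩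
  zero_mem' := ⟨⟨IsAdForm.zero zero_mem_lieK, isType11_covExtDeriv_zero A⟩, fun α =>
    ⟨IsSection.zero, fun _ _ _ => zero_mem _⟩⟩
  smul_mem' := fun r x hx => ⟨⟨hx.1.1.smul r (smul_mem_lieK r),
    isType11_covExtDeriv_smul r hx.1.1 hx.1.2⟩, fun α => by
      have h : (r • x).2 α = LocSec.csmul (r : ℂ) (x.2 α) := LocSec.smul_eq_csmul r (x.2 α)
      rw [h]
      exact ⟨(hx.2 α).1.csmul _, fun i e m => Submodule.smul_mem _ _ ((hx.2 α).2 i e m)⟩⟩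

/-- The part of the symplectic form that concerns the sections. -/
def secForm (s t : ∀ α, LocSec U V V (M α)) : ℝ :=
  ∫ z, ∑ α, (hermTrace (s α (U.idx z) (U.chart (U.idx z) z))
    (t α (U.idx z) (U.chart (U.idx z) z))).im ∂κ.vol

/-- The part of the symplectic form that concerns the connections. -/
def connForm (c : Weight G.H → ℝ) (u v : LocForm U V) : ℝ :=
  ∑ χ, c χ * atiyahBott κ (blockForm (vertexSpace G χ) u) (blockForm (vertexSpace G χ) v)

section
variable {M E F}

theorem continuous_secIntegrand {s t : ∀ α, LocSec U V V (M α)}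
    (hs : ∀ α, IsSection E E (F α) (s α)) (ht : ∀ α, IsSection E E (F α) (t α)) :
    Continuous fun z => ∑ α, (hermTrace (s α (U.idx z) (U.chart (U.idx z) z))
      (t α (U.idx z) (U.chart (U.idx z) z))).im :=
  continuous_finsetSum _ fun α _ =>
    continuous_hermTrace (hs α) (ht α) K_subset K_subset subset_rfl

theorem secForm_self (s : ∀ α, LocSec U V V (M α)) : secForm κ M s s = 0 := by
  simp only [secForm, hermTrace_self_im, Finset.sum_const_zero, MeasureTheory.integral_zero]

theorem secForm_smul_left (r : ℝ) (s t : ∀ α, LocSec U V V (M α)) :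
    secForm κ M (r • s) t = r * secForm κ M s t := by
  have h : ∀ α i e, (hermTrace ((r • s) α i e) (t α i e)).im =
      r * (hermTrace (s α i e) (t α i e)).im := fun α i e => by
    rw [Pi.smul_apply, LocSec.smul_apply, hermTrace_smul_left, Complex.im_ofReal_mul]
  simp only [secForm, h, ← Finset.mul_sum, MeasureTheory.integral_const_mul]

theorem secForm_smul_right (r : ℝ) (s t : ∀ α, LocSec U V V (M α)) :
    secForm κ M s (r • t) = r * secForm κ M s t := by
  have h : ∀ α i e, (hermTrace (s α i e) ((r • t) α i e)).im =
      r * (hermTrace (s α i e) (t α i e)).im := fun α i e => by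
    rw [Pi.smul_apply, LocSec.smul_eq_csmul, LocSec.csmul_apply, hermTrace_smul_right,
      Complex.im_ofReal_mul]
  simp only [secForm, h, ← Finset.mul_sum, MeasureTheory.integral_const_mul]

theorem connForm_self (c : Weight G.H → ℝ) (u : LocForm U V) : connForm κ c u u = 0 := by
  simp only [connForm, atiyahBott_self, mul_zero, Finset.sum_const_zero]

theorem connForm_smul_left (c : Weight G.H → ℝ) (r : ℝ) (u v : LocForm U V) :
    connForm κ c (r • u) v = r * connForm κ c u v := by
  simp only [connForm, map_smul, atiyahBott_smul_left, Finset.mul_sum]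
  exact Finset.sum_congr rfl fun _ _ => by ring

theorem connForm_smul_right (c : Weight G.H → ℝ) (r : ℝ) (u v : LocForm U V) :
    connForm κ c u (r • v) = r * connForm κ c u v := by
  simp only [connForm, map_smul, atiyahBott_smul_right, Finset.mul_sum]
  exact Finset.sum_congr rfl fun _ _ => by ring

variable [IsManifold 𝓘(ℂ, Cn n) ∞ X] [BorelSpace X]

theorem secForm_add_left {s s' t : ∀ α, LocSec U V V (M α)}
    (hs : ∀ α, IsSection E E (F α) (s α)) (hs' : ∀ α, IsSection E E (F α) (s' α))
    (ht : ∀ α, IsSection E E (F α) (t α)) :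
    secForm κ M (s + s') t = secForm κ M s t + secForm κ M s' t := by
  have h : ∀ α i e, (hermTrace ((s + s') α i e) (t α i e)).im =
      (hermTrace (s α i e) (t α i e)).im + (hermTrace (s' α i e) (t α i e)).im := fun α i e => by
    rw [Pi.add_apply, LocSec.add_apply, hermTrace_add_left, Complex.add_im]
  simp only [secForm, h, Finset.sum_add_distrib]
  exact MeasureTheory.integral_add
    (κ.integrable_of_continuous (continuous_secIntegrand hs ht))
    (κ.integrable_of_continuous (continuous_secIntegrand hs' ht))

theorem secForm_add_right {s t t' : ∀ α, LocSec U V V (M α)}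
    (hs : ∀ α, IsSection E E (F α) (s α)) (ht : ∀ α, IsSection E E (F α) (t α))
    (ht' : ∀ α, IsSection E E (F α) (t' α)) :
    secForm κ M s (t + t') = secForm κ M s t + secForm κ M s t' := by
  have h : ∀ α i e, (hermTrace (s α i e) ((t + t') α i e)).im =
      (hermTrace (s α i e) (t α i e)).im + (hermTrace (s α i e) (t' α i e)).im := fun α i e => by
    rw [Pi.add_apply, LocSec.add_apply, hermTrace_add_right, Complex.add_im]
  simp only [secForm, h, Finset.sum_add_distrib]
  exact MeasureTheory.integral_add
    (κ.integrable_of_continuous (continuous_secIntegrand hs ht))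
    (κ.integrable_of_continuous (continuous_secIntegrand hs ht'))

theorem connForm_add_left (c : Weight G.H → ℝ) {u u' v : LocForm U V} (hu : IsAdForm E G.lieK u)
    (hu' : IsAdForm E G.lieK u') (hv : IsAdForm E G.lieK v) :
    connForm κ c (u + u') v = connForm κ c u v + connForm κ c u' v := by
  simp only [connForm, map_add, ← Finset.sum_add_distrib]
  refine Finset.sum_congr rfl fun χ _ => ?_
  rw [atiyahBott_add_left κ (isAdForm_block hu χ) (isAdForm_block hu' χ) (isAdForm_block hv χ),
    mul_add]

theorem connForm_add_right (c : Weight G.H → ℝ) {u v v' : LocForm U V} (hu : IsAdForm E G.lieK u)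
    (hv : IsAdForm E G.lieK v) (hv' : IsAdForm E G.lieK v') :
    connForm κ c u (v + v') = connForm κ c u v + connForm κ c u v' := by
  simp only [connForm, map_add, ← Finset.sum_add_distrib]
  refine Finset.sum_congr rfl fun χ _ => ?_
  rw [atiyahBott_add_right κ (isAdForm_block hu χ) (isAdForm_block hv χ) (isAdForm_block hv' χ),
    mul_add]

theorem eq_zero_of_secForm {s : ∀ α, LocSec U V V (M α)}
    (hs : ∀ α, IsSection E E (F α) (s α))
    (h : secForm κ M s (fun α => LocSec.csmul Complex.I (s α)) = 0) : s = 0 := by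
  have hI : ∀ α i e, (hermTrace (s α i e) (LocSec.csmul Complex.I (s α) i e)).im =
      (hermTrace (s α i e) (s α i e)).re := fun α i e => by
    rw [LocSec.csmul_apply, hermTrace_smul_right, Complex.I_mul_im]
  have hc := continuous_secIntegrand hs fun α => (hs α).csmul Complex.I
  simp only [secForm, hI] at h hc
  have h1 := κ.eq_zero_of_integral_eq_zero hc
    (fun z => Finset.sum_nonneg fun α _ => hermTrace_self_re_nonneg _) h
  funext α
  refine (hs α).eq_zero fun x => ?_
  have h2 := (Finset.sum_eq_zero_iff_of_nonneg
    (fun α _ => hermTrace_self_re_nonneg (s α (U.idx x) (U.chart (U.idx x) x)))).1 (h1 x)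
  exact eq_zero_of_hermTrace_self (h2 α (Finset.mem_univ α))

/-- A sum of nonnegative terms vanishes, so each block of positive weight is zero. One positive
weight in each dual pair suffices, by `eq_zero_on_dual`. -/
theorem eq_zero_of_connForm {u : LocForm U V} (hu : IsAdForm E G.lieK u) {c : Weight G.H → ℝ}
    (hc : ∀ χ, 0 ≤ c χ) (hc' : ∀ χ, 0 < c χ ∨ 0 < c (G.dual χ))
    (h : connForm κ c u (rotForm u) = 0) : u = 0 := by
  have hr : ∀ χ, blockForm (vertexSpace G χ) (rotForm u) =
      rotForm (blockForm (vertexSpace G χ) u) := fun _ => rfl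
  have hab : ∀ χ, 0 ≤ atiyahBott κ (blockForm (vertexSpace G χ) u)
      (rotForm (blockForm (vertexSpace G χ) u)) ∧ (atiyahBott κ (blockForm (vertexSpace G χ) u)
      (rotForm (blockForm (vertexSpace G χ) u)) = 0 → blockForm (vertexSpace G χ) u = 0) :=
    fun χ => atiyahBott_rot_nonneg κ (isAdForm_block hu χ) subset_rfl
  simp only [connForm, hr] at h
  have h1 := (Finset.sum_eq_zero_iff_of_nonneg
    (fun χ _ => mul_nonneg (hc χ) (hab χ).1)).1 h
  have h2 : ∀ χ, 0 < c χ → ∀ i e w, ∀ v ∈ vertexSpace G χ, u i e w v = 0 := by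
    intro χ hχ i e w v hv
    have h3 := (hab χ).2 ((mul_eq_zero.1 (h1 χ (Finset.mem_univ χ))).resolve_left hχ.ne')
    have h4 : u i e w v = (blockForm (vertexSpace G χ) u i e w ⟨v, hv⟩ : vertexSpace G χ) :=
      formComponents_block hu.mem_lie χ i e w ⟨v, hv⟩
    rw [h3] at h4
    exact h4
  funext i e
  ext1 w
  refine G.ext_weight fun χ v => ?_
  rcases hc' χ with hχ | hχ
  · exact h2 χ hχ i e w v v.2
  · refine eq_zero_on_dual (hu.mem_lie i e w) (h2 _ hχ i e w) _ ?_
    rw [G.dual_dual]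
    exact v.2

end

open Classical in
/-- The weights of the generalized quiver, extended by zero. -/
def extWeights (S : Finset (Weight G.H)) (a b : Weight G.H → ℝ) (χ : Weight G.H) : ℝ :=
  if χ ∈ S then a χ else if G.dual χ = χ then b χ else 0

/-- Rewrites the two sums over `S` and over the fixed vertices as one sum over all vertices, with
weight zero on the duals of `S`. -/
theorem genSpace_form {S : Finset (Weight G.H)} (hS : ∀ χ ∈ S, G.dual χ ≠ χ)
    (a b : Weight G.H → ℝ) (x y : GenAmbient G M U) :
    (genSpace G M κ E F S a b).form x y =
      connForm κ (extWeights S a b) x.1 y.1 + secForm κ M x.2 y.2 := by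
  classical
  show _ + _ + _ = _
  refine congrArg (· + secForm κ M x.2 y.2) ?_
  unfold connForm
  rw [← Finset.sum_filter_add_sum_filter_not Finset.univ (fun χ => χ ∈ S)]
  refine congrArg₂ (· + ·) ?_ ?_
  · rw [Finset.filter_univ_mem]
    refine Finset.sum_congr rfl fun χ hχ => ?_
    rw [extWeights, if_pos hχ]
    rfl
  · have h1 : ∀ χ ∈ Finset.univ.filter (fun χ => χ ∉ S), extWeights S a b χ *
        atiyahBott κ (blockForm (vertexSpace G χ) x.1) (blockForm (vertexSpace G χ) y.1) =
        if G.dual χ = χ then b χ *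
          atiyahBott κ (blockForm (vertexSpace G χ) x.1) (blockForm (vertexSpace G χ) y.1)
        else 0 := by
      intro χ hχ
      rw [extWeights, if_neg (Finset.mem_filter.1 hχ).2]
      split_ifs with h
      · rfl
      · rw [zero_mul]
    rw [Finset.sum_congr rfl h1, ← Finset.sum_filter]
    refine Finset.sum_congr ?_ fun χ _ => rfl
    ext χ
    simp only [Finset.mem_filter, Finset.mem_univ, true_and]
    exact ⟨fun h => ⟨fun h' => hS χ h' h, h⟩, fun h => h.2⟩

variable [IsManifold 𝓘(ℂ, Cn n) ∞ X] [BorelSpace X]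

theorem isSymplectic_genSpace {S : Finset (Weight G.H)} (hS : ∀ χ ∈ S, G.dual χ ≠ χ)
    (hS' : ∀ χ, G.dual χ ≠ χ → (χ ∈ S ↔ G.dual χ ∉ S)) {a b : Weight G.H → ℝ}
    (ha : ∀ χ ∈ S, 0 < a χ) (hb : ∀ χ, G.dual χ = χ → 0 < b χ) :
    (genSpace G M κ E F S a b).IsSymplectic := by
  intro x _
  have hf := genSpace_form κ M E F hS a b
  set c := extWeights S a b with hcdef
  refine ⟨genTangent M E F x.1,
    LinearMap.mk₂ ℝ (fun u v => connForm κ c u.1.1 v.1.1 + secForm κ M u.1.2 v.1.2)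
      (fun u u' v => ?_) (fun r u v => ?_) (fun u v v' => ?_) (fun r u v => ?_), rfl,
    fun u v => (hf u.1 v.1).symm, fun u => ?_, fun u hu => ?_⟩
  · show connForm κ c (u.1.1 + u'.1.1) v.1.1 + secForm κ M (u.1.2 + u'.1.2) v.1.2 = _
    rw [connForm_add_left κ c u.2.1.1 u'.2.1.1 v.2.1.1,
      secForm_add_left κ (fun α => (u.2.2 α).1) (fun α => (u'.2.2 α).1) (fun α => (v.2.2 α).1)]
    ring
  · show connForm κ c (r • u.1.1) v.1.1 + secForm κ M (r • u.1.2) v.1.2 = _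
    rw [connForm_smul_left, secForm_smul_left, smul_eq_mul]
    ring
  · show connForm κ c u.1.1 (v.1.1 + v'.1.1) + secForm κ M u.1.2 (v.1.2 + v'.1.2) = _
    rw [connForm_add_right κ c u.2.1.1 v.2.1.1 v'.2.1.1,
      secForm_add_right κ (fun α => (u.2.2 α).1) (fun α => (v.2.2 α).1) (fun α => (v'.2.2 α).1)]
    ring
  · show connForm κ c u.1.1 (r • v.1.1) + secForm κ M u.1.2 (r • v.1.2) = _
    rw [connForm_smul_right, secForm_smul_right, smul_eq_mul]
    ring
  · show connForm κ c u.1.1 u.1.1 + secForm κ M u.1.2 u.1.2 = 0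
    rw [connForm_self, secForm_self, add_zero]
  · have hu' : ∀ v ∈ genTangent M E F x.1,
        connForm κ c u.1.1 v.1 + secForm κ M u.1.2 v.2 = 0 := fun v hv => hu ⟨v, hv⟩
    refine Subtype.ext (Prod.ext ?_ ?_)
    · refine eq_zero_of_connForm κ u.2.1.1 (c := c) (fun χ => ?_) (fun χ => ?_) ?_
      · rw [hcdef, extWeights]
        split_ifs with h1 h2
        · exact (ha χ h1).le
        · exact (hb χ h2).le
        · exact le_rfl
      · by_cases h : G.dual χ = χ
        · left
          rw [hcdef, extWeights, if_neg (fun h' => hS χ h' h), if_pos h]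
          exact hb χ h
        · by_cases h' : χ ∈ S
          · left
            rw [hcdef, extWeights, if_pos h']
            exact ha χ h'
          · right
            have h'' : G.dual χ ∈ S := by
              by_contra h0
              exact h' ((hS' χ h).2 h0)
            rw [hcdef, extWeights, if_pos h'']
            exact ha _ h''
      -- Test vector in the direction of the connections: the rotated 1-form.
      · have h1 := hu' (rotForm u.1.1, 0) ⟨⟨u.2.1.1.rot, u.2.1.1.type11_rot u.2.1.2⟩,
          fun α => ⟨IsSection.zero, fun _ _ _ => zero_mem _⟩⟩
        have h2 : secForm κ M u.1.2 0 = 0 := by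
          have := secForm_smul_right κ 0 u.1.2 0
          rwa [smul_zero, zero_mul] at this
        rwa [h2, add_zero] at h1
    · refine eq_zero_of_secForm κ (fun α => (u.2.2 α).1) ?_
      -- Test vector in the direction of the sections: `is`, admissible because each `Z_α` is a
      -- complex subspace. It turns the imaginary part of the hermitian form into the squared norm.
      have h1 := hu' (0, fun α => LocSec.csmul Complex.I (u.1.2 α))
        ⟨⟨IsAdForm.zero zero_mem_lieK, isType11_covExtDeriv_zero _⟩,
        fun α => ⟨(u.2.2 α).1.csmul _, fun i e m => Submodule.smul_mem _ _ ((u.2.2 α).2 i e m)⟩⟩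
      have h2 : connForm κ c u.1.1 0 = 0 := by
        have := connForm_smul_right κ c 0 u.1.1 0
        rwa [smul_zero, zero_mul] at this
      rwa [h2, zero_add] at h1

end GenQuiver

end GenSide

/-! ### The symplectomorphism -/

section Main

variable {V : Type*} [NormedAddCommGroup V] [InnerProductSpace ℂ V] [FiniteDimensional ℂ V]
  {C : EpsForm V} {G : GenQuiver C}
  {n : ℕ} {X : Type*} [TopologicalSpace X] [ChartedSpace (Cn n) X] {U : HolCover n X}
  {M : G.Summand → Type*} [∀ α, NormedAddCommGroup (M α)] [∀ α, InnerProductSpace ℂ (M α)]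
  [∀ α, FiniteDimensional ℂ (M α)]

namespace GenQuiver

/-- The inverse of the correspondence: families at the vertices and along the arrows are assembled
into endomorphisms of the total space. -/
def asm (y : PlainAmbient G.toSym (vertexSpace G) M U) : GenAmbient G M U :=
  (asmForm y.1, fun α => asmSec (y.2 α))

theorem bundleMap_asm (hG : G.Adapted) (y : PlainAmbient G.toSym (vertexSpace G) M U) :
    bundleMap G M (asm y) = y :=
  Prod.ext (funext fun χ => (formComponents_asmForm hG y.1).block_eq χ)
    (funext fun α => funext fun c => (secComponents_asmSec hG (y.2 α)).block_eq c)

theorem asm_bundleMap (hG : G.Adapted) {x : GenAmbient G M U} (h : ∀ i e u, x.1 i e u ∈ G.lieK)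
    (h' : ∀ α i e m, x.2 α i e m ∈ G.Z α) : asm (bundleMap G M x) = x :=
  Prod.ext ((formComponents_asmForm hG _).unique (formComponents_block h))
    (funext fun α => (secComponents_asmSec hG _).unique (secComponents_block (h' α)))

theorem asmSec_mem_Z (hG : G.Adapted) {y : PlainAmbient G.toSym (vertexSpace G) M U}
    (h : OrthSec G.toSym C (vertexSpace G) M y.2) (α : G.Summand) (i : U.ι) (e : Cn n) (m : M α) :
    asmSec (y.2 α) i e m ∈ G.Z α :=
  mem_Z_of_blocks (fun c => (secComponents_asmSec hG (y.2 α)).inter c i e m)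
    ((secComponents_asmSec hG (y.2 α)).zero i e m) fun c => h α c i e m

variable [CompactSpace X] [MeasurableSpace X] {κ : KahlerMetric n X} {E : PrincipalBundle U V G.K}
  {F : ∀ α, PrincipalBundle U (M α) (unitaryGroup (M α))} {S : Finset (Weight G.H)}
  {a b p : Weight G.H → ℝ}

theorem bundleMap_mem_carrier {x : GenAmbient G M U}
    (hx : x ∈ (genSpace G M κ E F S a b).carrier) : bundleMap G M x ∈
      (orthSpace G.toSym C (vertexSpace G) M κ (vertexBundle E) F p).carrier := by
  obtain ⟨⟨hA, h11⟩, hs⟩ := hx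
  have hb := fun χ => isConnection_block hA χ
  exact ⟨⟨fun χ => ⟨hb χ, (isType11_curv_iff (formComponents_block hA.mem_lie) hA.smooth
    fun χ => (hb χ).smooth).1 h11 χ⟩, fun χ i e u => block_compat (hA.mem_lie i e u) χ⟩,
    fun α c => isSection_block (hs α).1 (hs α).2 c,
    fun α c i e m => block_orth ((hs α).2 i e m) c⟩

theorem bundleMap_mem_tangent {x v : GenAmbient G M U}
    (hx : x ∈ (genSpace G M κ E F S a b).carrier)
    (hv : v ∈ (genSpace G M κ E F S a b).tangent x) : bundleMap G M v ∈
      (orthSpace G.toSym C (vertexSpace G) M κ (vertexBundle E) F p).tangent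
        (bundleMap G M x) := by
  obtain ⟨⟨hA, h11⟩, hs⟩ := hv
  have hb := fun χ => isAdForm_block hA χ
  exact ⟨⟨fun χ => ⟨hb χ, (isType11_covExtDeriv_iff (formComponents_block hx.1.1.mem_lie)
    (formComponents_block hA.mem_lie) hA.smooth fun χ => (hb χ).smooth).1 h11 χ⟩,
    fun χ i e u => block_compat (hA.mem_lie i e u) χ⟩,
    fun α c => isSection_block (hs α).1 (hs α).2 c,
    fun α c i e m => block_orth ((hs α).2 i e m) c⟩

theorem asm_mem_carrier (hG : G.Adapted) {y : PlainAmbient G.toSym (vertexSpace G) M U}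
    (hy : y ∈ (orthSpace G.toSym C (vertexSpace G) M κ (vertexBundle E) F p).carrier) :
    asm y ∈ (genSpace G M κ E F S a b).carrier := by
  obtain ⟨⟨hA, hc⟩, hs, ho⟩ := hy
  have hb := isConnection_asmForm hG (fun χ => (hA χ).1) hc
  exact ⟨⟨hb, (isType11_curv_iff (formComponents_asmForm hG y.1) hb.smooth
    fun χ => (hA χ).1.smooth).2 fun χ => (hA χ).2⟩,
    fun α => ⟨isSection_asmSec hG (hs α), asmSec_mem_Z hG ho α⟩⟩

theorem asm_mem_tangent (hG : G.Adapted) {x : GenAmbient G M U}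
    {y : PlainAmbient G.toSym (vertexSpace G) M U}
    (hx : x ∈ (genSpace G M κ E F S a b).carrier)
    (hy : y ∈ (orthSpace G.toSym C (vertexSpace G) M κ (vertexBundle E) F p).tangent
      (bundleMap G M x)) : asm y ∈ (genSpace G M κ E F S a b).tangent x := by
  obtain ⟨⟨hA, hc⟩, hs, ho⟩ := hy
  have hb := isAdForm_asmForm hG (fun χ => (hA χ).1) hc
  exact ⟨⟨hb, (isType11_covExtDeriv_iff (formComponents_block hx.1.1.mem_lie)
    (formComponents_asmForm hG y.1) hb.smooth
    fun χ => (hA χ).1.smooth).2 fun χ => (hA χ).2⟩,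
    fun α => ⟨isSection_asmSec hG (hs α), asmSec_mem_Z hG ho α⟩⟩

theorem bijOn_carrier (hG : G.Adapted) : Set.BijOn (bundleMap G M)
    (genSpace G M κ E F S a b).carrier
    (orthSpace G.toSym C (vertexSpace G) M κ (vertexBundle E) F p).carrier :=
  Set.InvOn.bijOn (f' := asm) ⟨fun _ hx => asm_bundleMap hG hx.1.1.mem_lie fun α => (hx.2 α).2,
    fun y _ => bundleMap_asm hG y⟩ (fun _ => bundleMap_mem_carrier) fun _ => asm_mem_carrier hG

theorem bijOn_tangent (hG : G.Adapted) {x : GenAmbient G M U}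
    (hx : x ∈ (genSpace G M κ E F S a b).carrier) : Set.BijOn (bundleMap G M)
    ((genSpace G M κ E F S a b).tangent x)
    ((orthSpace G.toSym C (vertexSpace G) M κ (vertexBundle E) F p).tangent
      (bundleMap G M x)) :=
  Set.InvOn.bijOn (f' := asm) ⟨fun _ hv => asm_bundleMap hG hv.1.1.mem_lie fun α => (hv.2 α).2,
    fun y _ => bundleMap_asm hG y⟩ (fun _ => bundleMap_mem_tangent hx)
    fun _ => asm_mem_tangent hG hx

theorem isSmoothMap_bundleMap : IsSmoothMap (genSpace G M κ E F S a b)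
    (orthSpace G.toSym C (vertexSpace G) M κ (vertexBundle E) F p) (bundleMap G M) :=
  fun _ _ c _ _ hc i =>
    ⟨fun _ => contDiffOn_mapForm (f := fun t => (c t.1).1) (g := Prod.snd) _ (hc i).1,
      fun α _ => contDiffOn_mapSec (f := fun t => (c t.1).2 α) (g := Prod.snd) _ ((hc i).2 α)⟩

theorem isSmoothMap_asm :
    IsSmoothMap (orthSpace G.toSym C (vertexSpace G) M κ (vertexBundle E) F p)
      (genSpace G M κ E F S a b) asm :=
  fun _ _ c _ _ hc i =>
    ⟨contDiffOn_asmForm (f := fun t => (c t.1).1) (g := Prod.snd) (hc i).1,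
      fun α => contDiffOn_asmSec (f := fun t => (c t.1).2 α) (g := Prod.snd) ((hc i).2 α)⟩

theorem form_bundleMap (hG : G.Adapted) (hS : ∀ χ ∈ S, G.dual χ ≠ χ)
    (hS' : ∀ χ, G.dual χ ≠ χ → (χ ∈ S ↔ G.dual χ ∉ S))
    (hpa : ∀ χ ∈ S, p χ + p (G.dual χ) = a χ) (hpb : ∀ χ, G.dual χ = χ → p χ = b χ)
    {x u v : GenAmbient G M U} (hu : u ∈ (genSpace G M κ E F S a b).tangent x)
    (hv : v ∈ (genSpace G M κ E F S a b).tangent x) :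
    (orthSpace G.toSym C (vertexSpace G) M κ (vertexBundle E) F p).form
      (bundleMap G M u) (bundleMap G M v) = (genSpace G M κ E F S a b).form u v := by
  classical
  refine congrArg₂ (· + ·) ?_ (congrArg (fun f => ∫ z, f z ∂κ.vol) (funext fun z => ?_))
  · refine (sum_vertices hS hS' (f := fun χ => atiyahBott κ (blockForm (vertexSpace G χ) u.1)
      (blockForm (vertexSpace G χ) v.1)) hpa hpb
      fun χ => atiyahBott_dual κ hu.1.1.mem_lie hv.1.1.mem_lie χ).trans ?_
    refine congrArg _ (Finset.sum_congr ?_ fun _ _ => rfl)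
    ext χ
    simp only [Finset.mem_filter]
  · refine Finset.sum_congr rfl fun α _ => ?_
    have hs := secComponents_block (hu.2 α).2
    have ht := secComponents_block (hv.2 α).2
    rw [← sum_hermTrace_block hG (fun c => hs.inter c (U.idx z) (U.chart (U.idx z) z))
      (fun c => ht.inter c (U.idx z) (U.chart (U.idx z) z)) (hs.zero _ _), Complex.im_sum]
    rfl

theorem genIsHol_iff (B : ∀ α, LocForm U (M α)) {x : GenAmbient G M U}
    (hx : x ∈ (genSpace G M κ E F S a b).carrier) :
    GenIsHol G M B x ↔ PlainIsHol G.toSym (vertexSpace G) M B (bundleMap G M x) :=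
  forall_congr' fun α => isHol_iff (formComponents_block hx.1.1.mem_lie) (B α)
    (secComponents_block (hx.2 α).2) (hx.2 α).1.smooth
    fun c => (isSection_block (hx.2 α).1 (hx.2 α).2 c).smooth

end GenQuiver

end Main

end SQ

end

theorem mainTheorem5 {n : ℕ} {X : Type*} [TopologicalSpace X] [ChartedSpace (SQ.Cn n) X]
    [IsManifold 𝓘(ℂ, SQ.Cn n) ∞ X] [CompactSpace X] [T2Space X]
    [MeasurableSpace X] [BorelSpace X] (κ : SQ.KahlerMetric n X)
    {V : Type*} [NormedAddCommGroup V] [InnerProductSpace ℂ V] [FiniteDimensional ℂ V]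
    {C : SQ.EpsForm V} (G : SQ.GenQuiver C) (hG : G.Adapted)
    (U : SQ.HolCover n X) (E : SQ.PrincipalBundle U V G.K)
    (M : G.Summand → Type*) [∀ α, NormedAddCommGroup (M α)] [∀ α, InnerProductSpace ℂ (M α)]
    [∀ α, FiniteDimensional ℂ (M α)]
    (F : ∀ α, SQ.PrincipalBundle U (M α) (SQ.unitaryGroup (M α)))
    (B : ∀ α, SQ.LocForm U (M α))
    (hB : ∀ α, SQ.IsConnection (F α) (SQ.unitaryLie (M α)) (B α) ∧ SQ.IsType11 (SQ.curv (B α)))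
    (S : Finset (SQ.Weight G.H))
    (hS : ∀ χ ∈ S, G.dual χ ≠ χ)
    (hS' : ∀ χ, G.dual χ ≠ χ → (χ ∈ S ↔ G.dual χ ∉ S))
    (a b p : SQ.Weight G.H → ℝ)
    (ha : ∀ χ ∈ S, 0 < a χ) (hb : ∀ χ, G.dual χ = χ → 0 < b χ)
    (hpa : ∀ χ ∈ S, p χ + p (G.dual χ) = a χ)
    (hpb : ∀ χ, G.dual χ = χ → p χ = b χ) :
    SQ.IsSymplectomorphism (SQ.genSpace G M κ E F S a b)
        (SQ.orthSpace G.toSym C (SQ.vertexSpace G) M κ (SQ.vertexBundle E) F p)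
        (SQ.bundleMap G M) ∧
      ∀ x ∈ (SQ.genSpace G M κ E F S a b).carrier,
        SQ.GenIsHol G M B x ↔
          SQ.PlainIsHol G.toSym (SQ.vertexSpace G) M B (SQ.bundleMap G M x) := by
  have hT : ∀ x ∈ (SQ.genSpace G M κ E F S a b).carrier, _ := fun x hx =>
    SQ.GenQuiver.bijOn_tangent (p := p) hG hx
  have hf : ∀ x ∈ (SQ.genSpace G M κ E F S a b).carrier, ∀ u ∈ _, ∀ v ∈ _, _ :=
    fun x _ u hu v hv => SQ.GenQuiver.form_bundleMap (κ := κ) (E := E) (F := F) (x := x)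
      hG hS hS' hpa hpb hu hv
  have hs := SQ.GenQuiver.isSymplectic_genSpace κ M E F hS hS' ha hb
  have hc := SQ.GenQuiver.bijOn_carrier (κ := κ) (E := E) (F := F) (S := S) (a := a) (b := b)
    (p := p) hG
  -- Positivity of the weights is available only on the generalized side, so the target form
  -- inherits nondegeneracy through the bijection on tangent spaces.
  exact ⟨⟨hs, hs.transport hc hT hf, hc, SQ.GenQuiver.isSmoothMap_bundleMap,
    ⟨SQ.GenQuiver.asm, fun _ => SQ.GenQuiver.asm_mem_carrier hG,
      ⟨fun _ hx => SQ.GenQuiver.asm_bundleMap hG hx.1.1.mem_lie fun α => (hx.2 α).2,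
        fun y _ => SQ.GenQuiver.bundleMap_asm hG y⟩, SQ.GenQuiver.isSmoothMap_asm⟩, hT, hf⟩,
    fun _ hx => SQ.GenQuiver.genIsHol_iff B hx⟩
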